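/- **(A)** Let $G_1$ be a connected finite-dimensional real Lie group with Lie algebra $\mathfrak g$, let $\tau\in\mathrm{Aut}(G_1)$ be a smooth automorphism with $\tau^2=\mathrm{id}$, and put $G:=G_1\rtimes\{\mathbf 1,\tau\}$. Write $\mathfrak g^{\pm\tau}=\{x\in\mathfrak g : d\tau(x)=\pm x\}$, and let $[\mathfrak g^{-\tau},\mathfrak g^{-\tau}]$ be the linear span of the brackets of elements of $\mathfrak g^{-\tau}$. Then $\mathfrak b:=\mathfrak g^{-\tau}+[\mathfrak g^{-\tau},\mathfrak g^{-\tau}]$ is an ideal of $\mathfrak g$, the integral subgroup $B:=\langle\exp\mathfrak b\rangle\subseteq G_1$ has Lie algebra $\{x\in\mathfrak g:\exp(\mathbb Rx)\subseteq B\}=\mathfrak b$, and the subgroup of $G$ generated by the conjugacy class $C_\tau$ of $\tau$ in $G$ is $B\{\mathbf 1,\tau\}$. In particular, $C_\tau$ generates $G$ if and only if $\mathfrak g^{\tau}=[\mathfrak g^{-\tau},\mathfrak g^{-\tau}]$. **(B)** Let $d\ge 2$, let $[x,y]=x_0y_0-\sum_{j=1}^{d-1}x_jy_j$ be the Lorentzian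 form on $\mathbb R^{1,d-1}=\mathbb R^d$, and let $P(d)=\mathbb R^{1,d-1}\rtimes \mathrm O_{1,d-1}(\mathbb R)$ and $P(d)_+=\mathbb R^{1,d-1}\rtimes \mathrm{SO}_{1,d-1}(\mathbb R)$. A wedge is a set $W=gW_R$ with $g\in P(d)$ and $W_R=\{x : x_1>|x_0|\}$, and its reflection is $r_W=gR_{01}g^{-1}$ with $R_{01}=\mathrm{diag}(-1,-1,1,\dots,1)$. Let $W$ be any wedge. Then $r_W\in P(d)_+$, and (i) the conjugacy class of $r_W$ in $P(d)_+$ generates $P(d)_+$ if and only if $d>2$; (ii) there is an element of the conformal group $\mathrm{SO}_{2,d}(\mathbb R)$ that acts on $\mathbb R^{1,d-1}$ as $r_W$, and the conjugacy class in $\mathrm{SO}_{2,d}(\mathbb R)$ of every such element generates $\mathrm{SO}_{2,d}(\mathbb R)$. Here $x\in\mathbb R^{1,d-1}$ is identified with the null line in $\mathbb R^{2,d}$ spanned by $\eta(x)=\big(\tfrac{1-[x,x]}2,\,x,\,\tfrac{1+[x,x]}2\big)$ (the first two coordinates of $\mathbb R^{2,d}$ being the positive ones), and $\rho\in \mathrm{SO}_{2,d}(\mathbb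 R)$ acts on $\mathbb R^{1,d-1}$ as $f$ if $\rho(\eta(x))\in\mathbb R^\times\eta(f(x))$ for all $x$. For $d=1$, statement (ii) also holds, with $r_W$ replaced by any point reflection $x\mapsto 2c-x$ of $\mathbb R$. -/

import Mathlib

open scoped Manifold ContDiff Pointwise

noncomputable section

namespace ConjInv

/-! ### Lie groups: differential of an automorphism, one-parameter groups, integral subgroups -/

section LieGroups

variable {E : Type*} [NormedAddCommGroup E] [NormedSpace ℝ E]
  {G : Type*} [TopologicalSpace G] [ChartedSpace E G] [Group G]

variable (E) in
/-- The differential at the identity of an automorphism `τ` of `G`, as an endomorphism of the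
Lie algebra. `mfderiv` takes values in the tangent space at `τ 1`, which is the tangent space
at `1` because `τ 1 = 1`. -/
def dAut (τ : MulAut G) : Module.End ℝ (GroupLieAlgebra 𝓘(ℝ, E) G) :=
  let D : GroupLieAlgebra 𝓘(ℝ, E) G →L[ℝ] GroupLieAlgebra 𝓘(ℝ, E) G :=
    mfderiv 𝓘(ℝ, E) 𝓘(ℝ, E) (fun g : G => τ g) (1 : G)
  D.toLinearMap

/-- `γ : ℝ → G` is the smooth one-parameter subgroup `t ↦ exp (t x)` generated by the element
`x` of the Lie algebra. -/
def IsOneParam (γ : ℝ → G) (x : GroupLieAlgebra 𝓘(ℝ, E) G) : Prop :=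
  (∀ s t : ℝ, γ (s + t) = γ s * γ t) ∧ ContMDiff 𝓘(ℝ, ℝ) 𝓘(ℝ, E) ∞ γ ∧
    (mfderiv 𝓘(ℝ, ℝ) 𝓘(ℝ, E) γ (0 : ℝ) : ℝ →L[ℝ] E) (1 : ℝ) = x

/-- The subgroup `⟨exp 𝔟⟩` generated by the exponential image of `𝔟`. When `𝔟` is a Lie
subalgebra this is the integral subgroup belonging to `𝔟`. -/
def integralSubgroup (𝔟 : Submodule ℝ (GroupLieAlgebra 𝓘(ℝ, E) G)) : Subgroup G :=
  Subgroup.closure {g | ∃ x ∈ 𝔟, ∃ γ : ℝ → G, IsOneParam γ x ∧ g = γ 1}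

variable (E) in
/-- The Lie algebra `{x | exp (ℝ x) ⊆ B}` of a subgroup `B` of `G`. -/
def subgroupLieAlgebra (B : Subgroup G) : Set (GroupLieAlgebra 𝓘(ℝ, E) G) :=
  {x | ∃ γ : ℝ → G, IsOneParam γ x ∧ ∀ t, γ t ∈ B}

variable (E) in
/-- `𝔤^τ`, the fixed points of the differential of `τ`. -/
def fixedPart (τ : MulAut G) : Submodule ℝ (GroupLieAlgebra 𝓘(ℝ, E) G) :=
  Module.End.eigenspace (dAut E τ) 1

variable (E) in
/-- `𝔤^{-τ}`, the `(-1)`-eigenspace of the differential of `τ`. -/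
def antiPart (τ : MulAut G) : Submodule ℝ (GroupLieAlgebra 𝓘(ℝ, E) G) :=
  Module.End.eigenspace (dAut E τ) (-1)

variable (E) in
/-- `[𝔤^{-τ}, 𝔤^{-τ}]`, the linear span of all brackets. -/
def antiBracket (τ : MulAut G) : Submodule ℝ (GroupLieAlgebra 𝓘(ℝ, E) G) :=
  Submodule.span ℝ {z | ∃ x ∈ antiPart E τ, ∃ y ∈ antiPart E τ, z = ⁅x, y⁆}

variable (E) in
/-- `𝔟 = 𝔤^{-τ} + [𝔤^{-τ}, 𝔤^{-τ}]`. -/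
def bPart (τ : MulAut G) : Submodule ℝ (GroupLieAlgebra 𝓘(ℝ, E) G) :=
  antiPart E τ ⊔ antiBracket E τ

end LieGroups

section Semidirect

variable {G : Type*} [Group G]

/-- The group `G ⋊ {1, τ}`, for an automorphism `τ` with `τ² = 1`. -/
abbrev InvSemidirect (τ : MulAut G) : Type _ :=
  G ⋊[(Subgroup.zpowers τ).subtype] (Subgroup.zpowers τ)

/-- `τ` as an element of `G ⋊ {1, τ}`. -/
def invElt (τ : MulAut G) : InvSemidirect τ :=
  SemidirectProduct.inr ⟨τ, Subgroup.mem_zpowers τ⟩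

end Semidirect

/-! ### Pseudo-orthogonal groups, the Poincaré group, wedges -/

/-- The form `x₀y₀ + ⋯ + x_{p-1}y_{p-1} - x_p y_p - ⋯ - x_{n-1}y_{n-1}` of `ℝ^{p,n-p}`. -/
def form (p : ℕ) {n : ℕ} (x y : Fin n → ℝ) : ℝ :=
  ∑ i, (if i.val < p then (1 : ℝ) else -1) * (x i * y i)

/-- `O_{p,n-p}(ℝ)`. -/
def O (p n : ℕ) : Subgroup ((Fin n → ℝ) ≃ₗ[ℝ] (Fin n → ℝ)) where
  carrier := {g | ∀ x y, form p (g x) (g y) = form p x y}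
  mul_mem' := by
    intro a b ha hb x y
    rw [LinearEquiv.mul_apply, LinearEquiv.mul_apply, ha, hb]
  one_mem' := fun _ _ => rfl
  inv_mem' := by
    intro a ha x y
    have h := ha (a⁻¹ x) (a⁻¹ y)
    rw [← LinearEquiv.mul_apply, ← LinearEquiv.mul_apply, mul_inv_cancel] at h
    exact h.symm

/-- `SO_{p,n-p}(ℝ)`. -/
def SO (p n : ℕ) : Subgroup ((Fin n → ℝ) ≃ₗ[ℝ] (Fin n → ℝ)) :=
  O p n ⊓ LinearEquiv.det.ker

/-- The Poincaré group `P(d)`: the affine maps of `ℝ^{1,d-1}` with linear part in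
`O_{1,d-1}(ℝ)`. -/
def P (d : ℕ) : Subgroup ((Fin d → ℝ) ≃ᵃ[ℝ] (Fin d → ℝ)) :=
  (O 1 d).comap AffineEquiv.linearHom

/-- `P(d)_+`: the elements of `P(d)` with linear part in `SO_{1,d-1}(ℝ)`. -/
def Pplus (d : ℕ) : Subgroup ((Fin d → ℝ) ≃ᵃ[ℝ] (Fin d → ℝ)) :=
  (SO 1 d).comap AffineEquiv.linearHom

/-- The right wedge `W_R = {x | x₁ > |x₀|}`. -/
def rightWedge (d : ℕ) (hd : 2 ≤ d) : Set (Fin d → ℝ) :=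
  {x | |x ⟨0, by omega⟩| < x ⟨1, by omega⟩}

/-- A wedge is a set of the form `g W_R` with `g ∈ P(d)`. -/
def IsWedge (d : ℕ) (hd : 2 ≤ d) (W : Set (Fin d → ℝ)) : Prop :=
  ∃ g ∈ P d, W = g '' rightWedge d hd

/-- `R₀₁ = diag(-1, -1, 1, …, 1)`. -/
def R01 (d : ℕ) : (Fin d → ℝ) ≃ᵃ[ℝ] (Fin d → ℝ) :=
  (LinearEquiv.piCongrRight fun i : Fin d =>
    if i.val < 2 then LinearEquiv.neg ℝ else LinearEquiv.refl ℝ ℝ).toAffineEquiv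

/-- `r` is the reflection `r_W = g R₀₁ g⁻¹` of the wedge `W = g W_R`. -/
def IsWedgeReflection (d : ℕ) (hd : 2 ≤ d) (W : Set (Fin d → ℝ))
    (r : (Fin d → ℝ) ≃ᵃ[ℝ] (Fin d → ℝ)) : Prop :=
  ∃ g ∈ P d, W = g '' rightWedge d hd ∧ r = g * R01 d * g⁻¹

/-- The conformal embedding of `ℝ^{1,d-1}` in the cone of null vectors of `ℝ^{2,d}`,
`x ↦ ((1 - [x,x])/2, x, (1 + [x,x])/2)`. -/
def nullLift {d : ℕ} (x : Fin d → ℝ) : Fin (d + 2) → ℝ :=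
  Fin.cons ((1 - form 1 x x) / 2)
    (Fin.snoc (α := fun _ => ℝ) x ((1 + form 1 x x) / 2) : Fin (d + 1) → ℝ)

/-- The element `ρ` of the conformal group `SO_{2,d}(ℝ)` acts on `ℝ^{1,d-1}`, seen through
`nullLift` as a set of null lines, as the map `f`. -/
def ActsAs {d : ℕ} (ρ : SO 2 (d + 2)) (f : (Fin d → ℝ) → (Fin d → ℝ)) : Prop :=
  ∀ x, ∃ c : ℝ, c ≠ 0 ∧ ρ.val (nullLift x) = c • nullLift (f x)

end ConjInv

end

open scoped Manifold ContDiff Pointwise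

noncomputable section

namespace ConjInv

/-! (A) The conjugates of `τ` are the elements `g τ(g)⁻¹ · τ`, so the claim is that the elements `g
τ(g)⁻¹` generate `B = ⟨exp 𝔟⟩`. The group `B` is normal and `τ`-stable because `𝔟` is an ideal
stable under the differential of `τ`. Since `𝔤 = 𝔟 + 𝔤^τ`, every `g` near `1` is an element of `B`
times a product of one-parameter elements fixed by `τ`; hence `{g | g τ(g)⁻¹ ∈ B}` is an open
subgroup of a connected group, that is, everything. Conversely `exp x = g τ(g)⁻¹` for `x ∈ 𝔤^{-τ}`
and `g = exp (x/2)`, so it remains to see that `exp 𝔤^{-τ}` already generates `B`. The vectors `Ad a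
v` with `a ∈ ⟨exp 𝔤^{-τ}⟩` and `v ∈ 𝔤^{-τ}` span `𝔟`, because the derivative of `Ad` is the bracket
(`hasDerivAt_Ad_zero`). Coordinates of the second kind along a basis of such vectors therefore stay
in `⟨exp 𝔤^{-τ}⟩` (`integralSubgroup_properties`).

That the Lie algebra of `B` is no larger than `𝔟` is shown without Frobenius' theorem. Near `1` the
group has coordinates `(s, t) ↦ ψ s * χ t` with `ψ` tangent to `𝔟` everywhere, and along any map
tangent to `𝔟` the coordinate `t` is locally constant (`fderiv_transverse`). The group `B` is a
countable union of images of such maps, so it meets only countably many values of `t`. A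
one-parameter subgroup inside `B` then has constant `t` near `0`, and its generator lies in `𝔟`.

(B) A wedge reflection is a product of two affine reflections with orthogonal normals `u`, `v` of
positive and negative length. It lifts to such a product `s_u s_v` in `ℝ^{2,d}`, and the only
isometries inducing the same map are `± s_u s_v` (`eq_one_or_neg_of_nullLift`). The conjugates of `c
s_u s_v`, with `c = ± 1`, include all such products for other pairs. Quotients of two of them give
the products of two reflections of equal sign; these give `c`, hence also the mixed products, and by
Cartan–Dieudonné everything (`properIsometries_le_closure`). The argument needs two directions of
one sign, which exist in `ℝ^{2,d}` always and in `ℝ^{1,d-1}` exactly for `d > 2`. In that case the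
translations arise as commutators; for `d = 2` the linear part of `r_W` is the central element `-1`.
-/

set_option linter.unusedSectionVars false

/-! ### Logarithmic derivatives and the adjoint action in the chart at the identity. -/

section LogDerivative

open Set Filter Topology

variable {E : Type*} [NormedAddCommGroup E] [NormedSpace ℝ E]
  {G : Type*} [TopologicalSpace G] [ChartedSpace E G] [Group G]
  {V V' : Type*} [NormedAddCommGroup V] [NormedSpace ℝ V]
  [NormedAddCommGroup V'] [NormedSpace ℝ V']

variable (E G) in
/-- The preferred chart at the identity of the group. -/
def unitChart : PartialEquiv G E := extChartAt 𝓘(ℝ, E) (1 : G)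

local notation "φ" => unitChart E G

variable (E) in
/-- The right logarithmic derivative of a map from a normed space to a Lie group. -/
def rlog (f : V → G) (p : V) : V →L[ℝ] E := fderiv ℝ (fun q => φ (f q * (f p)⁻¹)) p

variable (E) in
/-- The differential at `1` of a self-map of `G` fixing `1`, read in the chart at `1`. -/
def diffOne (C : G → G) : E →L[ℝ] E := fderiv ℝ (fun u => φ (C ((φ).symm u))) (φ 1)

variable (E) in
/-- The adjoint action. -/
def Ad (g : G) : E →L[ℝ] E := diffOne E (fun h => g * h * g⁻¹)

variable (E G) in
/-- The multiplication read in the chart at `1`. -/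
def chartMul (p : E × E) : E := φ ((φ).symm p.1 * (φ).symm p.2)

theorem unitChart_symm_one : (φ).symm (φ 1) = 1 := extChartAt_to_inv (I := 𝓘(ℝ, E)) (1 : G)

theorem eventually_unitChart_symm_apply : ∀ᶠ g in 𝓝 (1 : G), (φ).symm (φ g) = g := by
  filter_upwards [extChartAt_source_mem_nhds (I := 𝓘(ℝ, E)) (1 : G)] with g hg
  exact PartialEquiv.left_inv _ hg

theorem eventually_unitChart_apply_symm : ∀ᶠ u in 𝓝 (φ 1), φ ((φ).symm u) = u := by
  filter_upwards [extChartAt_target_mem_nhds (I := 𝓘(ℝ, E)) (1 : G)] with u hu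
  exact PartialEquiv.right_inv _ hu

theorem continuousAt_unitChart : ContinuousAt φ (1 : G) := continuousAt_extChartAt (1 : G)

theorem tendsto_unitChart_symm : Tendsto (φ).symm (𝓝 (φ 1)) (𝓝 1) := by
  have h := continuousAt_extChartAt_symm (I := 𝓘(ℝ, E)) (1 : G)
  have h2 : Tendsto (φ).symm (𝓝 (φ 1)) (𝓝 ((φ).symm (φ 1))) := h
  rwa [unitChart_symm_one] at h2

variable [LieGroup 𝓘(ℝ, E) ∞ G]

theorem contMDiffAt_unitChart {g : G} (hg : g ∈ (φ).source) :
    ContMDiffAt 𝓘(ℝ, E) 𝓘(ℝ, E) ∞ φ g := by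
  have : IsManifold 𝓘(ℝ, E) ∞ G := inferInstance
  exact contMDiffAt_extChartAt' (by simpa [unitChart] using hg)

theorem contMDiffAt_unitChart_symm : ContMDiffAt 𝓘(ℝ, E) 𝓘(ℝ, E) ∞ (φ).symm (φ 1) :=
  (contMDiffOn_extChartAt_symm (1 : G)).contMDiffAt (extChartAt_target_mem_nhds (1 : G))

theorem one_mem_unitChart_source : (1 : G) ∈ (φ).source := mem_extChartAt_source (1 : G)

theorem contDiffAt_unitChart_comp {f : V → G} {p : V} (hf : ContMDiffAt 𝓘(ℝ, V) 𝓘(ℝ, E) ∞ f p)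
    (hp : f p ∈ (φ).source) : ContDiffAt ℝ ∞ (fun q => φ (f q)) p :=
  ((contMDiffAt_unitChart hp).comp p hf).contDiffAt

theorem contDiffAt_diffOne {C : G → G} (hC : ContMDiff 𝓘(ℝ, E) 𝓘(ℝ, E) ∞ C) (h1 : C 1 = 1) :
    ContDiffAt ℝ ∞ (fun u => φ (C ((φ).symm u))) (φ 1) := by
  refine contDiffAt_unitChart_comp (f := fun u => C ((φ).symm u)) ?_ ?_
  · exact hC.contMDiffAt.comp _ contMDiffAt_unitChart_symm
  · simp only [unitChart_symm_one, h1]; exact one_mem_unitChart_source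

/-- Chain rule for the differential at the identity. -/
theorem fderiv_unitChart_comp {C : G → G} (hC : ContMDiff 𝓘(ℝ, E) 𝓘(ℝ, E) ∞ C) (h1 : C 1 = 1)
    {f : V → G} {p : V} (hf : ContMDiffAt 𝓘(ℝ, V) 𝓘(ℝ, E) ∞ f p) (hp : f p = 1) :
    fderiv ℝ (fun q => φ (C (f q))) p = (diffOne E C).comp (fderiv ℝ (fun q => φ (f q)) p) := by
  have hfd : DifferentiableAt ℝ (fun q => φ (f q)) p :=
    (contDiffAt_unitChart_comp hf (by rw [hp]; exact one_mem_unitChart_source)).differentiableAt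
      (by simp)
  have hCd := (contDiffAt_diffOne hC h1).differentiableAt (by simp)
  have e : (fun q => φ (C (f q))) =ᶠ[𝓝 p]
      (fun u => φ (C ((φ).symm u))) ∘ (fun q => φ (f q)) := by
    have h2 : Tendsto f (𝓝 p) (𝓝 1) := hp ▸ hf.continuousAt
    filter_upwards [h2.eventually (eventually_unitChart_symm_apply (E := E))] with q hq
    simp [hq]
  rw [e.fderiv_eq]
  have hCd' : DifferentiableAt ℝ (fun u => φ (C ((φ).symm u))) (φ (f p)) := by rw [hp]; exact hCd
  rw [fderiv_comp p hCd' hfd, hp, diffOne]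

theorem contDiffAt_chartMul : ContDiffAt ℝ ∞ (chartMul E G) (φ 1, φ 1) := by
  refine contDiffAt_unitChart_comp (f := fun p : E × E => (φ).symm p.1 * (φ).symm p.2) ?_ ?_
  · have h1 : ContMDiffAt 𝓘(ℝ, E × E) 𝓘(ℝ, E) ∞ (fun p : E × E => (φ).symm p.1) (φ 1, φ 1) :=
      ContMDiffAt.comp (φ 1, φ 1) (g := (φ).symm) contMDiffAt_unitChart_symm
        contDiffAt_fst.contMDiffAt
    have h2 : ContMDiffAt 𝓘(ℝ, E × E) 𝓘(ℝ, E) ∞ (fun p : E × E => (φ).symm p.2) (φ 1, φ 1) :=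
      ContMDiffAt.comp (φ 1, φ 1) (g := (φ).symm) contMDiffAt_unitChart_symm
        contDiffAt_snd.contMDiffAt
    exact h1.mul h2
  · simp only [unitChart_symm_one, mul_one]; exact one_mem_unitChart_source

theorem eventually_chartMul_one_right : ∀ᶠ u in 𝓝 (φ 1), chartMul E G (u, φ 1) = u := by
  filter_upwards [eventually_unitChart_apply_symm (E := E) (G := G)] with u hu
  simp only [chartMul, unitChart_symm_one, mul_one, hu]

theorem eventually_chartMul_one_left : ∀ᶠ u in 𝓝 (φ 1), chartMul E G (φ 1, u) = u := by
  filter_upwards [eventually_unitChart_apply_symm (E := E) (G := G)] with u hu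
  simp only [chartMul, unitChart_symm_one, one_mul, hu]

/-- As `1` is neutral on both sides, both partial derivatives at `(1, 1)` are the identity. This is
what turns products of group-valued maps into sums of differentials. -/
theorem hasFDerivAt_chartMul_one :
    HasFDerivAt (chartMul E G)
      (ContinuousLinearMap.fst ℝ E E + ContinuousLinearMap.snd ℝ E E) (φ 1, φ 1) := by
  have h := ((contDiffAt_chartMul (E := E) (G := G)).differentiableAt (by simp)).hasFDerivAt
  set A := fderiv ℝ (chartMul E G) (φ 1, φ 1)
  have h1 : A.comp (ContinuousLinearMap.inl ℝ E E) = ContinuousLinearMap.id ℝ E := by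
    have := HasFDerivAt.comp (φ 1) (f := fun e : E => (e, (φ 1 : E))) h
      (hasFDerivAt_prodMk_left (𝕜 := ℝ) (φ 1) (φ 1))
    exact (this.congr_of_eventuallyEq
      ((eventually_chartMul_one_right (E := E) (G := G)).mono fun u hu => hu.symm)).unique
        (hasFDerivAt_id _)
  have h2 : A.comp (ContinuousLinearMap.inr ℝ E E) = ContinuousLinearMap.id ℝ E := by
    have := HasFDerivAt.comp (φ 1) (f := fun e : E => ((φ 1 : E), e)) h
      (hasFDerivAt_prodMk_right (𝕜 := ℝ) (φ 1) (φ 1))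
    exact (this.congr_of_eventuallyEq
      ((eventually_chartMul_one_left (E := E) (G := G)).mono fun u hu => hu.symm)).unique
        (hasFDerivAt_id _)
  have h3 : ContinuousLinearMap.fst ℝ E E + ContinuousLinearMap.snd ℝ E E = A := by
    ext a
    · simpa using (congrArg (fun L => L a) h1).symm
    · simpa using (congrArg (fun L => L a) h2).symm
  rwa [h3]

theorem fderiv_unitChart_mul {f h : V → G} {p : V} (hf : ContMDiffAt 𝓘(ℝ, V) 𝓘(ℝ, E) ∞ f p)
    (hh : ContMDiffAt 𝓘(ℝ, V) 𝓘(ℝ, E) ∞ h p) (hp : f p = 1) (hp' : h p = 1) :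
    fderiv ℝ (fun q => φ (f q * h q)) p =
      fderiv ℝ (fun q => φ (f q)) p + fderiv ℝ (fun q => φ (h q)) p := by
  have hfd := ((contDiffAt_unitChart_comp hf (by rw [hp]; exact
    one_mem_unitChart_source)).differentiableAt (by simp)).hasFDerivAt
  have hhd := ((contDiffAt_unitChart_comp hh (by rw [hp']; exact
    one_mem_unitChart_source)).differentiableAt (by simp)).hasFDerivAt
  have hm : HasFDerivAt (chartMul E G) (ContinuousLinearMap.fst ℝ E E +
      ContinuousLinearMap.snd ℝ E E) (φ (f p), φ (h p)) := by
    rw [hp, hp']; exact hasFDerivAt_chartMul_one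
  have key := hm.comp p (hfd.prodMk hhd)
  have e : (fun q => φ (f q * h q)) =ᶠ[𝓝 p] chartMul E G ∘ (fun q => (φ (f q), φ (h q))) := by
    have h1 : Tendsto f (𝓝 p) (𝓝 1) := hp ▸ hf.continuousAt
    have h2 : Tendsto h (𝓝 p) (𝓝 1) := hp' ▸ hh.continuousAt
    filter_upwards [h1.eventually (eventually_unitChart_symm_apply (E := E)),
      h2.eventually (eventually_unitChart_symm_apply (E := E))] with q hq1 hq2
    simp [chartMul, hq1, hq2]
  rw [(key.congr_of_eventuallyEq e).fderiv]
  ext v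
  simp

theorem contMDiff_conj (g : G) : ContMDiff 𝓘(ℝ, E) 𝓘(ℝ, E) ∞ (fun h : G => g * h * g⁻¹) :=
  (contMDiff_mul_right (a := g⁻¹)).comp (contMDiff_mul_left (a := g))

theorem contMDiffAt_mul_const {f : V → G} {p : V} (hf : ContMDiffAt 𝓘(ℝ, V) 𝓘(ℝ, E) ∞ f p)
    (g : G) : ContMDiffAt 𝓘(ℝ, V) 𝓘(ℝ, E) ∞ (fun q => f q * g) p :=
  hf.mul contMDiffAt_const

/-- Write `f h (f h)(p)⁻¹` as `f f(p)⁻¹` times the conjugate of `h h(p)⁻¹` by `f(p)`. Both factors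
are `1` at `p`, so their differentials add. -/
theorem rlog_mul {f h : V → G} {p : V} (hf : ContMDiffAt 𝓘(ℝ, V) 𝓘(ℝ, E) ∞ f p)
    (hh : ContMDiffAt 𝓘(ℝ, V) 𝓘(ℝ, E) ∞ h p) :
    rlog E (fun q => f q * h q) p = rlog E f p + (Ad E (f p)).comp (rlog E h p) := by
  have h1 := contMDiffAt_mul_const hf (f p)⁻¹
  have h2 := contMDiffAt_mul_const hh (h p)⁻¹
  have h3 : ContMDiffAt 𝓘(ℝ, V) 𝓘(ℝ, E) ∞ (fun q => f p * (h q * (h p)⁻¹) * (f p)⁻¹) p :=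
    (contMDiff_conj (f p)).contMDiffAt.comp p h2
  have e : (fun q => φ (f q * h q * (f p * h p)⁻¹)) =
      fun q => φ ((f q * (f p)⁻¹) * (f p * (h q * (h p)⁻¹) * (f p)⁻¹)) := by
    funext q; congr 1; group
  unfold rlog
  rw [e, fderiv_unitChart_mul h1 h3 (by simp) (by simp), Ad,
    ← fderiv_unitChart_comp (contMDiff_conj (f p)) (by simp) h2 (by simp)]

theorem rlog_comp {f : V → G} {c : V' → V} {p : V'} (hf : ContMDiffAt 𝓘(ℝ, V) 𝓘(ℝ, E) ∞ f (c p))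
    (hc : DifferentiableAt ℝ c p) :
    rlog E (fun q => f (c q)) p = (rlog E f (c p)).comp (fderiv ℝ c p) := by
  have h1 := contMDiffAt_mul_const hf (f (c p))⁻¹
  have hd := (contDiffAt_unitChart_comp h1 (by rw [mul_inv_cancel]; exact
    one_mem_unitChart_source)).differentiableAt (by simp)
  exact fderiv_comp p (g := fun q => φ (f q * (f (c p))⁻¹)) hd hc

theorem diffOne_comp {C D : G → G} (hC : ContMDiff 𝓘(ℝ, E) 𝓘(ℝ, E) ∞ C) (h1 : C 1 = 1)
    (hD : ContMDiff 𝓘(ℝ, E) 𝓘(ℝ, E) ∞ D) (h2 : D 1 = 1) :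
    diffOne E (fun g => C (D g)) = (diffOne E C).comp (diffOne E D) := by
  have : ContMDiffAt 𝓘(ℝ, E) 𝓘(ℝ, E) ∞ (fun u => D ((φ).symm u)) (φ 1) :=
    hD.contMDiffAt.comp _ contMDiffAt_unitChart_symm
  exact fderiv_unitChart_comp hC h1 this (by rw [unitChart_symm_one, h2])

theorem diffOne_id : diffOne E (fun g : G => g) = ContinuousLinearMap.id ℝ E := by
  unfold diffOne
  have : (fun u => φ ((φ).symm u)) =ᶠ[𝓝 (φ 1)] fun u => u :=
    eventually_unitChart_apply_symm
  rw [this.fderiv_eq, fderiv_fun_id]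

theorem Ad_mul (g h : G) : Ad E (g * h) = (Ad E g).comp (Ad E h) := by
  unfold Ad
  rw [← diffOne_comp (contMDiff_conj g) (by simp) (contMDiff_conj h) (by simp)]
  congr 1; funext x; group

theorem Ad_one : Ad E (1 : G) = ContinuousLinearMap.id ℝ E := by
  unfold Ad
  simpa using diffOne_id (E := E) (G := G)

/-- Differentials of automorphisms intertwine the adjoint actions. -/
theorem diffOne_Ad (C : MulAut G) (hC : ContMDiff 𝓘(ℝ, E) 𝓘(ℝ, E) ∞ (fun g => C g)) (g : G)
    (y : E) : diffOne E (fun g => C g) (Ad E g y) = Ad E (C g) (diffOne E (fun g => C g) y) := by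
  have h1 := diffOne_comp hC (map_one C) (contMDiff_conj (E := E) g) (by simp)
  have h2 := diffOne_comp (contMDiff_conj (E := E) (C g)) (by simp) hC (map_one C)
  have : (fun x => C (g * x * g⁻¹)) = fun x => C g * C x * (C g)⁻¹ := by
    funext x; simp
  rw [this, h2] at h1
  exact (congrArg (fun L => L y) h1).symm

end LogDerivative

/-! ### The Lie bracket in the chart at the identity. -/

section ChartBracket

open Set Filter Topology VectorField

variable {E : Type*} [NormedAddCommGroup E] [NormedSpace ℝ E]
  {G : Type*} [TopologicalSpace G] [ChartedSpace E G] [Group G] [LieGroup 𝓘(ℝ, E) ∞ G]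

local notation "φ" => unitChart E G

/-- The derivative of `C` uses the chart at `C 1`, which equals `1` only propositionally in the
applications; the free point `y` absorbs the transport. -/
theorem mfderiv_one_eq {C : G → G} {y : G} (hy : C 1 = y)
    (hC : MDifferentiableAt 𝓘(ℝ, E) 𝓘(ℝ, E) C 1) :
    (mfderiv 𝓘(ℝ, E) 𝓘(ℝ, E) C 1 : E →L[ℝ] E) =
      fderiv ℝ (fun u => extChartAt 𝓘(ℝ, E) y (C ((φ).symm u))) (φ 1) := by
  subst hy
  obtain ⟨L, hL⟩ : ∃ L : E →L[ℝ] E, L = mfderiv 𝓘(ℝ, E) 𝓘(ℝ, E) C 1 := ⟨_, rfl⟩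
  have h0 := hC.hasMFDerivAt.2
  rw [← hL] at h0
  have h : HasFDerivWithinAt (E := E) (F := E)
      (fun u => extChartAt 𝓘(ℝ, E) (C 1) (C ((φ).symm u))) L (range 𝓘(ℝ, E)) (φ 1) := h0
  rw [ModelWithCorners.range_eq_univ, hasFDerivWithinAt_univ] at h
  exact hL.symm.trans h.fderiv.symm

theorem dAut_apply (τ : MulAut G) (hτ : ContMDiff 𝓘(ℝ, E) 𝓘(ℝ, E) ∞ (fun g : G => τ g))
    (x : GroupLieAlgebra 𝓘(ℝ, E) G) : dAut E τ x = diffOne E (fun g => τ g) x := by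
  have := mfderiv_one_eq (E := E) (C := fun g => τ g) (map_one τ)
    (hτ.mdifferentiableAt (by simp))
  exact congrArg (fun L : E →L[ℝ] E => L x) this

theorem mfderiv_curve_eq {f : ℝ → G} {t : ℝ} {y : G} (hy : f t = y)
    (hf : MDifferentiableAt 𝓘(ℝ, ℝ) 𝓘(ℝ, E) f t) :
    (mfderiv 𝓘(ℝ, ℝ) 𝓘(ℝ, E) f t : ℝ →L[ℝ] E) =
      fderiv ℝ (fun u => extChartAt 𝓘(ℝ, E) y (f u)) t := by
  subst hy
  obtain ⟨L, hL⟩ : ∃ L : ℝ →L[ℝ] E, L = mfderiv 𝓘(ℝ, ℝ) 𝓘(ℝ, E) f t := ⟨_, rfl⟩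
  have h0 := hf.hasMFDerivAt.2
  rw [← hL] at h0
  have h : HasFDerivWithinAt (E := ℝ) (F := E) (fun u => extChartAt 𝓘(ℝ, E) (f t) (f u))
      L (range 𝓘(ℝ, ℝ)) t := h0
  rw [ModelWithCorners.range_eq_univ, hasFDerivWithinAt_univ] at h
  exact hL.symm.trans h.fderiv.symm

theorem hasMFDerivAt_unitChart_symm :
    HasMFDerivAt 𝓘(ℝ, E) 𝓘(ℝ, E) (φ).symm (φ 1) (ContinuousLinearMap.id ℝ E) := by
  refine ⟨(contMDiffAt_unitChart_symm (E := E) (G := G)).continuousAt,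
    HasFDerivAt.hasFDerivWithinAt (E := E) (F := E) (x := (φ 1 : E)) <|
    (hasFDerivAt_id (𝕜 := ℝ) (φ 1 : E)).congr_of_eventuallyEq ?_⟩
  have : ∀ y : G, y = 1 → (fun u : E => extChartAt 𝓘(ℝ, E) y ((φ).symm u)) =ᶠ[𝓝 (φ 1)] id := by
    rintro y rfl
    exact eventually_unitChart_apply_symm
  exact this _ unitChart_symm_one

theorem hasMFDerivAt_unitChart :
    HasMFDerivAt 𝓘(ℝ, E) 𝓘(ℝ, E) (φ) (1 : G) (ContinuousLinearMap.id ℝ E) := by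
  refine ⟨continuousAt_unitChart,
    HasFDerivAt.hasFDerivWithinAt (E := E) (F := E) (x := (φ 1 : E)) <|
    (hasFDerivAt_id (𝕜 := ℝ) (φ 1 : E)).congr_of_eventuallyEq ?_⟩
  exact eventually_unitChart_apply_symm

variable (G) in
/-- A left-invariant vector field read in the chart at `1`. -/
def chartField (v u : E) : E := fderiv ℝ (fun q => chartMul E G (u, q)) (φ 1) v

theorem eventually_contDiffAt_chartMul :
    ∀ᶠ u in 𝓝 (φ 1), ContDiffAt ℝ 1 (chartMul E G) (u, φ 1) := by
  have h : ContDiffAt ℝ 1 (chartMul E G) (φ 1, φ 1) := contDiffAt_chartMul.of_le (by simp)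
  have := h.eventually (by simp)
  exact (Continuous.prodMk_left (φ 1 : E)).continuousAt.eventually (p := fun p =>
    ContDiffAt ℝ 1 (chartMul E G) p) this

/-- Differentiating `φ⁻¹(m(u, q)) = φ⁻¹(u) φ⁻¹(q)` in `q` at `φ 1`, with `m` the multiplication in
the chart, gives `A ∘ L = B`. Here `A` is the derivative of `φ⁻¹` at `u`, `L` the partial derivative
of `m`, and `B` that of left translation, so the pullback `A⁻¹ B v` is `L v`. -/
theorem eventually_mulInvariantVectorField_eq (v : GroupLieAlgebra 𝓘(ℝ, E) G) :
    mpullbackWithin 𝓘(ℝ, E) 𝓘(ℝ, E) (φ).symm (mulInvariantVectorField v) (range 𝓘(ℝ, E))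
      =ᶠ[𝓝 (φ 1)] chartField (E := E) G v := by
  have hs : ∀ᶠ u in 𝓝 (φ 1), u ∈ (φ).target := extChartAt_target_mem_nhds (1 : G)
  have hnear : ∀ᶠ u in 𝓝 (φ 1), ∀ᶠ q in 𝓝 (φ 1), (φ).symm (chartMul E G (u, q)) =
      (φ).symm u * (φ).symm q := by
    have h1 : Tendsto (fun p : E × E => (φ).symm p.1 * (φ).symm p.2) (𝓝 (φ 1, φ 1)) (𝓝 1) := by
      have := (tendsto_unitChart_symm (E := E) (G := G)).prodMap
        (tendsto_unitChart_symm (E := E) (G := G))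
      rw [← nhds_prod_eq, ← nhds_prod_eq] at this
      have hG : ContinuousMul G := by
        have : IsTopologicalGroup G := topologicalGroup_of_lieGroup 𝓘(ℝ, E) ∞
        infer_instance
      have h2 := (continuous_mul (M := G)).tendsto (1, 1)
      simp only [mul_one] at h2
      exact h2.comp this
    have h2 := h1.eventually (eventually_unitChart_symm_apply (E := E) (G := G))
    rw [nhds_prod_eq] at h2
    exact h2.curry
  filter_upwards [hs, eventually_chartMul_one_right (E := E) (G := G),
    eventually_contDiffAt_chartMul (E := E) (G := G), hnear] with u hu hu1 hu2 hu3
  have hinv := isInvertible_mfderivWithin_extChartAt_symm (I := 𝓘(ℝ, E)) (x := (1 : G)) hu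
  rw [mpullbackWithin_apply]
  have hsd : MDifferentiableWithinAt 𝓘(ℝ, E) 𝓘(ℝ, E) (φ).symm (range 𝓘(ℝ, E)) u :=
    mdifferentiableWithinAt_extChartAt_symm hu
  have hA := hsd.hasMFDerivWithinAt
  set A := mfderivWithin 𝓘(ℝ, E) 𝓘(ℝ, E) (φ).symm (range 𝓘(ℝ, E)) u with hAdef
  have hinv' : A.IsInvertible := hinv
  have hA' : HasMFDerivAt 𝓘(ℝ, E) 𝓘(ℝ, E) (φ).symm u A := by
    rw [ModelWithCorners.range_eq_univ] at hA
    exact hasMFDerivWithinAt_univ.1 hA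
  have hm : HasFDerivAt (fun q => chartMul E G (u, q))
      (fderiv ℝ (fun q => chartMul E G (u, q)) (φ 1)) (φ 1) := by
    apply DifferentiableAt.hasFDerivAt
    exact DifferentiableAt.comp (g := chartMul E G) (f := fun q : E => (u, q)) _
      (hu2.differentiableAt (by simp)) (by fun_prop)
  set L := fderiv ℝ (fun q => chartMul E G (u, q)) (φ 1)
  have c1 : HasMFDerivAt 𝓘(ℝ, E) 𝓘(ℝ, E) (fun q => (φ).symm (chartMul E G (u, q))) (φ 1)
      ((A : E →L[ℝ] E).comp L) := by
    have hA2 : ∀ u' : E, u' = u → HasMFDerivAt 𝓘(ℝ, E) 𝓘(ℝ, E) (φ).symm u' (A : E →L[ℝ] E) := by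
      rintro _ rfl; exact hA'
    exact HasMFDerivAt.comp (φ 1 : E) (hA2 _ hu1) hm.hasMFDerivAt
  have hleft : HasMFDerivAt 𝓘(ℝ, E) 𝓘(ℝ, E) (fun h : G => (φ).symm u * h) (1 : G)
      (mfderiv 𝓘(ℝ, E) 𝓘(ℝ, E) (fun h : G => (φ).symm u * h) (1 : G)) :=
    ((contMDiff_mul_left (I := 𝓘(ℝ, E)) (n := ∞) (a := (φ).symm u)).mdifferentiableAt
      (by simp)).hasMFDerivAt
  set B := mfderiv 𝓘(ℝ, E) 𝓘(ℝ, E) (fun h : G => (φ).symm u * h) (1 : G) with hB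
  have c2 : HasMFDerivAt 𝓘(ℝ, E) 𝓘(ℝ, E) (fun q => (φ).symm u * (φ).symm q) (φ 1)
      (((B : E →L[ℝ] E)).comp (ContinuousLinearMap.id ℝ E)) := by
    have hB2 : ∀ y : G, y = 1 → HasMFDerivAt 𝓘(ℝ, E) 𝓘(ℝ, E) (fun h : G => (φ).symm u * h) y
        (B : E →L[ℝ] E) := by
      rintro _ rfl; exact hleft
    exact HasMFDerivAt.comp (φ 1 : E) (hB2 _ unitChart_symm_one) hasMFDerivAt_unitChart_symm
  have c3 := (c2.congr_of_eventuallyEq hu3)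
  have e : (A : E →L[ℝ] E).comp L = (B : E →L[ℝ] E).comp (ContinuousLinearMap.id ℝ E) :=
    hasMFDerivAt_unique (f := fun q => (φ).symm (chartMul E G (u, q))) c1 c3
  have e2 : (A : E →L[ℝ] E) (L v) = (B : E →L[ℝ] E) v := congrArg (fun L => L v) e
  change (A : E →L[ℝ] E).inverse ((B : E →L[ℝ] E) v) = L v
  rw [← e2]
  exact ContinuousLinearMap.IsInvertible.inverse_apply_eq (f := (A : E →L[ℝ] E)) hinv' |>.2 rfl

/-- The bracket of the Lie algebra, read in the chart at `1`. -/
theorem bracket_eq_chart (v w : GroupLieAlgebra 𝓘(ℝ, E) G) :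
    (⁅v, w⁆ : GroupLieAlgebra 𝓘(ℝ, E) G) =
      (fderiv ℝ (chartField (E := E) G w) (φ 1) v - fderiv ℝ (chartField (E := E) G v) (φ 1) w : E) := by
  have ev : ∀ v : E, chartField G v (φ 1) = v := by
    intro v
    unfold chartField
    have : (fun q => chartMul E G (φ 1, q)) =ᶠ[𝓝 (φ 1)] fun q => q :=
      eventually_chartMul_one_left
    rw [this.fderiv_eq, fderiv_fun_id]; rfl
  rw [GroupLieAlgebra.bracket_def, mlieBracket, mlieBracketWithin_apply]
  have h1 : mfderiv 𝓘(ℝ, E) 𝓘(ℝ, E) (extChartAt 𝓘(ℝ, E) (1 : G)) 1 =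
      (ContinuousLinearMap.id ℝ E : E →L[ℝ] E) :=
    (hasMFDerivAt_unitChart (E := E) (G := G)).mfderiv
  rw [h1]
  have key : ∀ (v w : E) (X Y : E → E), X =ᶠ[𝓝 (φ 1)] chartField (E := E) G v →
      Y =ᶠ[𝓝 (φ 1)] chartField (E := E) G w →
      lieBracketWithin ℝ X Y ((φ).symm ⁻¹' univ ∩ range 𝓘(ℝ, E)) (φ 1) =
      fderiv ℝ (chartField (E := E) G w) (φ 1) v -
        fderiv ℝ (chartField (E := E) G v) (φ 1) w := by
    intro v w X Y hX hY
    rw [preimage_univ, ModelWithCorners.range_eq_univ, univ_inter, lieBracketWithin_univ,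
      hX.lieBracket_vectorField_eq (𝕜 := ℝ) hY]
    simp only [lieBracket]
    rw [ev, ev]
  refine Eq.trans ?_ (key v w _ _ (eventually_mulInvariantVectorField_eq v)
    (eventually_mulInvariantVectorField_eq w))
  exact ContinuousLinearMap.IsInvertible.inverse_apply_eq
    (f := ContinuousLinearMap.id ℝ E) ⟨ContinuousLinearEquiv.refl ℝ E, rfl⟩ |>.2 rfl

end ChartBracket

/-! ### One-parameter subgroups; the bracket as derivative of the adjoint action. -/

section OneParam

open Set Filter Topology VectorField

variable {E : Type*} [NormedAddCommGroup E] [NormedSpace ℝ E]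
  {G : Type*} [TopologicalSpace G] [ChartedSpace E G] [Group G] [LieGroup 𝓘(ℝ, E) ∞ G]

local notation "φ" => unitChart E G

theorem one_add_one_le_infty : (1 : WithTop ℕ∞) + 1 ≤ ∞ := by
  have h : ((1 + 1 : ℕ∞) : WithTop ℕ∞) ≤ ∞ := WithTop.coe_le_coe.2 le_top
  exact h

variable (G) in
/-- The bracket of the Lie algebra of `G`, on the model space. -/
def bracketE (v w : E) : E :=
  Bracket.bracket (L := GroupLieAlgebra 𝓘(ℝ, E) G) (M := GroupLieAlgebra 𝓘(ℝ, E) G) v w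

theorem IsOneParam.map_zero {γ : ℝ → G} {x : E} (h : IsOneParam γ x) : γ 0 = 1 := by
  have := h.1 0 0
  simpa using this

theorem IsOneParam.map_neg {γ : ℝ → G} {x : E} (h : IsOneParam γ x) (t : ℝ) :
    γ (-t) = (γ t)⁻¹ := by
  have := h.1 (-t) t
  rw [neg_add_cancel, h.map_zero] at this
  exact eq_inv_of_mul_eq_one_left this.symm

theorem IsOneParam.hasDerivAt {γ : ℝ → G} {x : E} (h : IsOneParam γ x) :
    HasDerivAt (fun t => φ (γ t)) x 0 := by
  have h1 := mfderiv_curve_eq (E := E) h.map_zero (h.2.1.mdifferentiableAt (by simp))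
  have h2 : fderiv ℝ (fun t => φ (γ t)) 0 1 = x := by
    rw [← h.2.2]; exact (congrArg (fun L : ℝ →L[ℝ] E => L 1) h1).symm
  have h3 := (contDiffAt_unitChart_comp (p := (0 : ℝ)) h.2.1.contMDiffAt
    (by rw [h.map_zero]; exact one_mem_unitChart_source)).differentiableAt (by simp)
  rw [← h2]
  exact h3.hasFDerivAt.hasDerivAt

theorem IsOneParam.of_hasDerivAt {γ : ℝ → G} {x : E} (h1 : ∀ s t, γ (s + t) = γ s * γ t)
    (h2 : ContMDiff 𝓘(ℝ, ℝ) 𝓘(ℝ, E) ∞ γ) (h3 : HasDerivAt (fun t => φ (γ t)) x 0) :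
    IsOneParam γ x := by
  refine ⟨h1, h2, ?_⟩
  have h0 : γ 0 = 1 := by
    have := h1 0 0
    simpa using this
  have h4 := mfderiv_curve_eq (E := E) h0 (h2.mdifferentiableAt (by simp))
  refine (congrArg (fun L : ℝ →L[ℝ] E => L 1) h4).trans ?_
  exact h3.deriv

theorem IsOneParam.rlog_apply {γ : ℝ → G} {x : E} (h : IsOneParam γ x) (t c : ℝ) :
    rlog E γ t c = c • x := by
  have e : (fun q => φ (γ q * (γ t)⁻¹)) = fun q => φ (γ (q - t)) := by
    funext q; rw [← h.map_neg, ← h.1, sub_eq_add_neg]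
  have h1 : HasDerivAt (fun q => φ (γ (q - t))) x t := by
    have := h.hasDerivAt
    rw [← sub_self t] at this
    exact this.comp_sub_const t t
  unfold rlog
  rw [e, h1.hasFDerivAt.fderiv]
  simp

theorem IsOneParam.comp_diffOne {γ : ℝ → G} {x : E} (h : IsOneParam γ x) (C : MulAut G)
    (hC : ContMDiff 𝓘(ℝ, E) 𝓘(ℝ, E) ∞ (fun g => C g)) :
    IsOneParam (fun t => C (γ t)) (diffOne E (fun g => C g) x : E) := by
  refine IsOneParam.of_hasDerivAt (fun s t => by rw [h.1, map_mul]) (hC.comp h.2.1) ?_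
  have := fderiv_unitChart_comp hC (map_one C) (p := (0 : ℝ)) h.2.1.contMDiffAt h.map_zero
  have hd := (contDiffAt_unitChart_comp (f := fun t => C (γ t)) (p := (0 : ℝ))
    (hC.comp h.2.1).contMDiffAt (by simp only [h.map_zero, map_one]; exact
      one_mem_unitChart_source)).differentiableAt (by simp)
  have h3 := hd.hasFDerivAt.hasDerivAt
  rw [this] at h3
  convert h3 using 1
  simp only [ContinuousLinearMap.comp_apply]
  congr 1
  exact h.hasDerivAt.deriv.symm

theorem IsOneParam.conj {γ : ℝ → G} {x : E} (h : IsOneParam γ x) (g : G) :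
    IsOneParam (fun t => g * γ t * g⁻¹) (Ad E g x : E) :=
  h.comp_diffOne (MulAut.conj g) (contMDiff_conj g)

theorem IsOneParam.smul {γ : ℝ → G} {x : E} (h : IsOneParam γ x) (c : ℝ) :
    IsOneParam (fun t => γ (c * t)) (c • x : E) := by
  refine IsOneParam.of_hasDerivAt (fun s t => by rw [mul_add, h.1])
    (h.2.1.comp (contDiff_const.mul contDiff_id).contMDiff) ?_
  have h1 : HasDerivAt (fun t => φ (γ t)) x (c * 0) := by rw [mul_zero]; exact h.hasDerivAt
  have h2 : HasDerivAt (fun t : ℝ => c * t) c 0 := by simpa using (hasDerivAt_id (0 : ℝ)).const_mul c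
  exact h1.scomp (0 : ℝ) h2

/-- A left-invariant field is a partial derivative of the multiplication in its second slot, so its
derivative is a mixed second partial. -/
theorem fderiv_chartField (x y : E) :
    fderiv ℝ (chartField G x) (φ 1) y =
      fderiv ℝ (fderiv ℝ (chartMul E G)) (φ 1, φ 1) (y, 0) (0, x) := by
  have hd : DifferentiableAt ℝ (fderiv ℝ (chartMul E G)) (φ 1, φ 1) :=
    (contDiffAt_chartMul.fderiv_right (m := 1) one_add_one_le_infty).differentiableAt (by simp)
  have e : chartField G x =ᶠ[𝓝 (φ 1)] fun p => fderiv ℝ (chartMul E G) (p, φ 1) (0, x) := by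
    filter_upwards [eventually_contDiffAt_chartMul (E := E) (G := G)] with p hp
    unfold chartField
    have h1 := HasFDerivAt.comp (φ 1 : E) (f := fun q : E => (p, q))
      (hp.differentiableAt (by simp)).hasFDerivAt (hasFDerivAt_prodMk_right (𝕜 := ℝ) p (φ 1))
    have h2 : fderiv ℝ (fun q => chartMul E G (p, q)) (φ 1) = _ := h1.fderiv
    rw [h2]; rfl
  rw [e.fderiv_eq]
  have h1 := HasFDerivAt.comp (φ 1 : E) (f := fun p : E => (p, (φ 1 : E))) hd.hasFDerivAt
    (hasFDerivAt_prodMk_left (𝕜 := ℝ) (φ 1) (φ 1))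
  have h2 := h1.clm_apply (hasFDerivAt_const ((0 : E), x) (φ 1 : E))
  have h3 : fderiv ℝ (fun p => fderiv ℝ (chartMul E G) (p, φ 1) (0, x)) (φ 1) = _ := h2.fderiv
  rw [h3]
  simp

theorem eventually_differentiableAt_chartMul :
    ∀ᶠ p in 𝓝 ((φ 1, φ 1) : E × E), DifferentiableAt ℝ (chartMul E G) p := by
  have h : ContDiffAt ℝ 1 (chartMul E G) (φ 1, φ 1) := contDiffAt_chartMul.of_le (by simp)
  exact (h.eventually (by simp)).mono fun p hp => hp.differentiableAt (by simp)

theorem contDiffAt_Ad_curve {γ : ℝ → G} {x : E} (h : IsOneParam γ x) (y : E) :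
    DifferentiableAt ℝ (fun t => Ad E (γ t) y) 0 := by
  have h1 : ContDiffAt ℝ ∞ (fun p : ℝ × E => φ (γ p.1 * (φ).symm p.2 * (γ p.1)⁻¹)) (0, φ 1) := by
    refine contDiffAt_unitChart_comp
      (f := fun p : ℝ × E => γ p.1 * (φ).symm p.2 * (γ p.1)⁻¹) ?_ ?_
    · have a1 : ContMDiffAt 𝓘(ℝ, ℝ × E) 𝓘(ℝ, E) ∞ (fun p : ℝ × E => γ p.1) (0, φ 1) :=
        ContMDiffAt.comp (0, (φ 1 : E)) (g := γ) h.2.1.contMDiffAt contDiffAt_fst.contMDiffAt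
      have a2 : ContMDiffAt 𝓘(ℝ, ℝ × E) 𝓘(ℝ, E) ∞ (fun p : ℝ × E => (φ).symm p.2) (0, φ 1) :=
        ContMDiffAt.comp ((0 : ℝ), (φ 1 : E)) (g := (φ).symm) contMDiffAt_unitChart_symm
          contDiffAt_snd.contMDiffAt
      exact (a1.mul a2).mul a1.inv
    · simp only [unitChart_symm_one, mul_one, mul_inv_cancel]; exact one_mem_unitChart_source
  have h2 : ContDiffAt ℝ 1 (fun t : ℝ => fderiv ℝ
      (fun q : E => φ (γ t * (φ).symm q * (γ t)⁻¹)) (φ 1)) 0 :=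
    ContDiffAt.fderiv (n := ∞) (f := fun t q => φ (γ t * (φ).symm q * (γ t)⁻¹)) h1
      contDiffAt_const one_add_one_le_infty
  exact (h2.differentiableAt (by simp)).clm_apply (differentiableAt_const y)

/-- From `g q = (g q g⁻¹) g` with `g = γ t`: the left-invariant field with value `y` at `1` is, at
`g`, the right translate of `Ad g y`. -/
theorem Ad_curve_identity {γ : ℝ → G} {x : E} (h : IsOneParam γ x) (y : E) :
    ∀ᶠ t in 𝓝 (0 : ℝ), chartField G y (φ (γ t)) =
      fderiv ℝ (chartMul E G) (φ 1, φ (γ t)) (Ad E (γ t) y, 0) := by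
  have hc : Tendsto (fun t => φ (γ t)) (𝓝 0) (𝓝 (φ 1)) := by
    have := (h.hasDerivAt (E := E)).continuousAt.tendsto
    simpa only [h.map_zero] using this
  have hγ : Tendsto γ (𝓝 0) (𝓝 1) := by
    have := h.2.1.continuous.tendsto 0
    rwa [h.map_zero] at this
  have e1 := (tendsto_const_nhds (x := (φ 1 : E))).prodMk_nhds hc |>.eventually
    eventually_differentiableAt_chartMul
  have e2 := hγ.eventually (eventually_unitChart_symm_apply (E := E) (G := G))
  filter_upwards [e1, e2] with t ht1 ht2
  have a1 : ContDiffAt ℝ ∞ (fun q : E => φ (γ t * (φ).symm q * (γ t)⁻¹)) (φ 1) :=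
    contDiffAt_diffOne (contMDiff_conj (γ t)) (by simp)
  have a2 := (a1.differentiableAt (by simp)).hasFDerivAt
  have a3 := HasFDerivAt.comp (φ 1 : E)
    (f := fun q : E => (φ (γ t * (φ).symm q * (γ t)⁻¹), φ (γ t))) (g := chartMul E G)
    (g' := fderiv ℝ (chartMul E G) (φ 1, φ (γ t)))
    (by simp only [unitChart_symm_one, mul_one, mul_inv_cancel]; exact ht1.hasFDerivAt)
    (a2.prodMk (hasFDerivAt_const (φ (γ t)) (φ 1 : E)))
  have e : (fun q => chartMul E G (φ (γ t), q)) =ᶠ[𝓝 (φ 1)]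
      chartMul E G ∘ (fun q : E => (φ (γ t * (φ).symm q * (γ t)⁻¹), φ (γ t))) := by
    have : Tendsto (fun q => γ t * (φ).symm q * (γ t)⁻¹) (𝓝 (φ 1)) (𝓝 1) := by
      have b1 := ((contMDiff_conj (E := E) (γ t)).continuous.tendsto (1 : G)).comp
        (tendsto_unitChart_symm (E := E) (G := G))
      simpa [Function.comp_def] using b1
    filter_upwards [this.eventually (eventually_unitChart_symm_apply (E := E) (G := G))] with q hq
    simp only [chartMul, Function.comp, hq, ht2]
    congr 1; group
  have a4 := (a3.congr_of_eventuallyEq e).fderiv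
  unfold chartField
  rw [a4]
  rfl

/-- The derivative of the adjoint action is the bracket. -/
theorem hasDerivAt_Ad_zero {γ : ℝ → G} {x : E} (h : IsOneParam γ x) (y : E) :
    HasDerivAt (fun t => Ad E (γ t) y) (bracketE G x y) 0 := by
  have hY := (contDiffAt_Ad_curve h y).hasDerivAt
  set Y' := deriv (fun t => Ad E (γ t) y) 0
  have hu := h.hasDerivAt (E := E)
  have hd : DifferentiableAt ℝ (fderiv ℝ (chartMul E G)) (φ 1, φ 1) :=
    (contDiffAt_chartMul.fderiv_right (m := 1) one_add_one_le_infty).differentiableAt (by simp)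
  have hsymm := (contDiffAt_chartMul (E := E) (G := G)).isSymmSndFDerivAt
    (by rw [minSmoothness_of_isRCLikeNormedField, ← one_add_one_eq_two]
        exact one_add_one_le_infty)
  have hcf : DifferentiableAt ℝ (chartField G y) (φ 1) := by
    have c1 : ContDiffAt ℝ 1 (fun p : E => fderiv ℝ (fun q => chartMul E G (p, q)) (φ 1)) (φ 1) :=
      ContDiffAt.fderiv (n := ∞) (f := fun p q => chartMul E G (p, q)) contDiffAt_chartMul
        contDiffAt_const one_add_one_le_infty
    exact (c1.differentiableAt (by simp)).clm_apply (differentiableAt_const y)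
  have d1 : HasDerivAt (fun t => chartField G y (φ (γ t)))
      (fderiv ℝ (chartField G y) (φ 1) x) 0 := by
    have : HasFDerivAt (chartField G y) (fderiv ℝ (chartField G y) (φ 1)) (φ (γ 0)) := by
      rw [h.map_zero]; exact hcf.hasFDerivAt
    exact this.comp_hasDerivAt (0 : ℝ) hu
  have d2 : HasDerivAt (fun t => fderiv ℝ (chartMul E G) (φ 1, φ (γ t)) (Ad E (γ t) y, 0))
      (fderiv ℝ (fderiv ℝ (chartMul E G)) (φ 1, φ 1) (0, x) (y, 0) + Y') 0 := by
    have b1 : HasFDerivAt (fderiv ℝ (chartMul E G))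
        (fderiv ℝ (fderiv ℝ (chartMul E G)) (φ 1, φ 1)) (φ 1, φ (γ 0)) := by
      rw [h.map_zero]; exact hd.hasFDerivAt
    have b2 := b1.comp_hasDerivAt (0 : ℝ) ((hasDerivAt_const (0 : ℝ) (φ 1 : E)).prodMk hu)
    have b3 := b2.clm_apply (hY.prodMk (hasDerivAt_const (0 : ℝ) (0 : E)))
    refine HasDerivAt.congr_deriv b3 ?_
    simp only [Function.comp]
    rw [h.map_zero, Ad_one]
    simp [(hasFDerivAt_chartMul_one (E := E) (G := G)).fderiv]
  -- The two sides of `Ad_curve_identity` are differentiated at `t = 0`. The right side yields a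
  -- mixed second derivative plus `Y'`; by symmetry of second derivatives the mixed term is the
  -- derivative of the field of `x` along `y`, so `Y'` is the bracket.
  have d3 := (d1.congr_of_eventuallyEq
    ((Ad_curve_identity h y).mono fun t ht => ht.symm)).unique d2
  have d4 : Y' = bracketE G x y := by
    have d5 : bracketE G x y = fderiv ℝ (chartField G y) (φ 1) x -
        fderiv ℝ (chartField G x) (φ 1) y := bracket_eq_chart x y
    rw [d5, fderiv_chartField x y, ← hsymm.eq, d3]
    abel
  rwa [← d4]

theorem hasDerivAt_Ad {γ : ℝ → G} {x : E} (h : IsOneParam γ x) (y : E) (t : ℝ) :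
    HasDerivAt (fun t => Ad E (γ t) y) (bracketE G x (Ad E (γ t) y)) t := by
  have h1 := hasDerivAt_Ad_zero h (Ad E (γ t) y)
  have e : (fun s => Ad E (γ s) y) = fun s => Ad E (γ (s - t)) (Ad E (γ t) y) := by
    funext s
    rw [← ContinuousLinearMap.comp_apply, ← Ad_mul, ← h.1, sub_add_cancel]
  rw [e]
  rw [← sub_self t] at h1
  exact h1.comp_sub_const t t

end OneParam

/-! ### Existence, uniqueness and smoothness of one-parameter subgroups. -/

section OneParamExistence

open Set Filter Topology VectorField

variable {E : Type*} [NormedAddCommGroup E] [NormedSpace ℝ E]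
  {G : Type*} [TopologicalSpace G] [ChartedSpace E G]

local notation "φ" => unitChart E G

/-- `G` is not assumed Hausdorff. Charts into a `T1` space give `T0`, and a `T0` topological group
is Hausdorff, as the uniqueness of integral curves requires. -/
theorem t0Space_of_chartedSpace (E G : Type*) [TopologicalSpace E] [T1Space E] [TopologicalSpace G]
    [ChartedSpace E G] : T0Space G := by
  refine ⟨fun x y hxy => ?_⟩
  have hy : y ∈ (chartAt E x).source :=
    (hxy.mem_open_iff (chartAt E x).open_source).1 (mem_chart_source E x)
  by_contra hne
  have hne' : chartAt E x x ≠ chartAt E x y := fun h =>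
    hne ((chartAt E x).injOn (mem_chart_source E x) hy h)
  have ho := (chartAt E x).isOpen_inter_preimage (isOpen_compl_singleton (x := chartAt E x y))
  have := (hxy.mem_open_iff ho).1 ⟨mem_chart_source E x, hne'⟩
  exact this.2 rfl

variable [Group G] [LieGroup 𝓘(ℝ, E) ∞ G]

theorem t2Space_of_lieGroup (E G : Type*) [NormedAddCommGroup E] [NormedSpace ℝ E]
    [TopologicalSpace G] [ChartedSpace E G] [Group G] [LieGroup 𝓘(ℝ, E) ∞ G] : T2Space G := by
  have := topologicalGroup_of_lieGroup (G := G) 𝓘(ℝ, E) ∞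
  have := t0Space_of_chartedSpace E G
  infer_instance

variable (E G) in
theorem lieGroup_minSmoothness : LieGroup 𝓘(ℝ, E) (minSmoothness ℝ 3) G := by
  refine LieGroup.of_le (n := ∞) ?_
  rw [minSmoothness_of_isRCLikeNormedField]
  have h : ((3 : ℕ∞) : WithTop ℕ∞) ≤ ∞ := WithTop.coe_le_coe.2 le_top
  exact h

theorem contMDiff_one_mulInvariantVectorField (x : GroupLieAlgebra 𝓘(ℝ, E) G) :
    ContMDiff 𝓘(ℝ, E) 𝓘(ℝ, E).tangent 1
      (fun g : G => (⟨g, mulInvariantVectorField x g⟩ : TangentBundle 𝓘(ℝ, E) G)) := by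
  have := lieGroup_minSmoothness E G
  refine (contMDiff_mulInvariantVectorField x).of_le ?_
  rw [minSmoothness_of_isRCLikeNormedField]
  exact one_le_two

theorem hasMFDerivAt_mul_left (g h : G) (x : GroupLieAlgebra 𝓘(ℝ, E) G) :
    mfderiv 𝓘(ℝ, E) 𝓘(ℝ, E) (fun z : G => g * z) h (mulInvariantVectorField x h) =
      mulInvariantVectorField x (g * h) := by
  have hd : ∀ a b : G, MDifferentiableAt 𝓘(ℝ, E) 𝓘(ℝ, E) (fun z : G => a * z) b := fun a b =>
    (contMDiff_mul_left (I := 𝓘(ℝ, E)) (n := ∞) (a := a)).mdifferentiableAt (by simp)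
  set L : E →L[ℝ] E := mfderiv 𝓘(ℝ, E) 𝓘(ℝ, E) (fun z : G => g * z) h with hL
  have h1 : ∀ y, y = h → HasMFDerivAt 𝓘(ℝ, E) 𝓘(ℝ, E) (fun z : G => g * z) y L := by
    rintro _ rfl; exact (hd g _).hasMFDerivAt
  have h2 := HasMFDerivAt.comp (1 : G) (h1 (h * 1) (mul_one h)) (hd h 1).hasMFDerivAt
  have e : (fun z : G => g * z) ∘ (fun z => h * z) = fun z => (g * h) * z := by
    funext z; simp [mul_assoc]
  rw [e] at h2
  have h3 := hasMFDerivAt_unique h2 (hd (g * h) 1).hasMFDerivAt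
  exact congrArg (fun L : E →L[ℝ] E => L x) h3

theorem isMIntegralCurveOn_mul_left {γ : ℝ → G} {x : GroupLieAlgebra 𝓘(ℝ, E) G} {s : Set ℝ}
    (h : IsMIntegralCurveOn γ (mulInvariantVectorField x) s) (g : G) :
    IsMIntegralCurveOn (fun t => g * γ t) (mulInvariantVectorField x) s := by
  intro t ht
  have hd : MDifferentiableAt 𝓘(ℝ, E) 𝓘(ℝ, E) (fun z : G => g * z) (γ t) :=
    (contMDiff_mul_left (I := 𝓘(ℝ, E)) (n := ∞) (a := g)).mdifferentiableAt (by simp)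
  have h1 := HasMFDerivAt.comp_hasMFDerivWithinAt t hd.hasMFDerivAt (h t ht)
  have e := hasMFDerivAt_mul_left g (γ t) x
  have e2 : (mfderiv 𝓘(ℝ, E) 𝓘(ℝ, E) (fun z : G => g * z) (γ t) : E →L[ℝ] E).comp
      ((1 : ℝ →L[ℝ] ℝ).smulRight (mulInvariantVectorField x (γ t) : E)) =
      (1 : ℝ →L[ℝ] ℝ).smulRight (mulInvariantVectorField x (g * γ t) : E) := by
    ext
    rw [← e]
    simp
  rw [← e2]
  exact h1

theorem mulInvariantVectorField_one (x : GroupLieAlgebra 𝓘(ℝ, E) G) :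
    (mulInvariantVectorField x (1 : G) : E) = x := by
  unfold mulInvariantVectorField
  have : (fun z : G => 1 * z) = id := by funext z; simp
  have h2 : HasMFDerivAt 𝓘(ℝ, E) 𝓘(ℝ, E) (fun z : G => 1 * z) 1 (ContinuousLinearMap.id ℝ E) := by
    rw [this]; exact hasMFDerivAt_id 1
  exact congrArg (fun L : E →L[ℝ] E => L x) h2.mfderiv

theorem IsOneParam.isMIntegralCurve {γ : ℝ → G} {x : GroupLieAlgebra 𝓘(ℝ, E) G}
    (h : IsOneParam γ x) : IsMIntegralCurve γ (mulInvariantVectorField x) := by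
  intro t
  have h0 : HasMFDerivAt 𝓘(ℝ, ℝ) 𝓘(ℝ, E) γ 0 ((1 : ℝ →L[ℝ] ℝ).smulRight (x : E)) := by
    have := (h.2.1.mdifferentiableAt (by simp) (x := (0 : ℝ))).hasMFDerivAt
    have e : (mfderiv 𝓘(ℝ, ℝ) 𝓘(ℝ, E) γ 0 : ℝ →L[ℝ] E) = (1 : ℝ →L[ℝ] ℝ).smulRight (x : E) := by
      ext
      refine h.2.2.trans ?_
      exact (one_smul ℝ (x : E)).symm
    rwa [e] at this
  have h1 : ∀ s, s = 0 → HasMFDerivAt 𝓘(ℝ, ℝ) 𝓘(ℝ, E) γ s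
      ((1 : ℝ →L[ℝ] ℝ).smulRight (x : E)) := by rintro _ rfl; exact h0
  have hs : HasMFDerivAt 𝓘(ℝ, ℝ) 𝓘(ℝ, ℝ) (fun s => s - t) t (ContinuousLinearMap.id ℝ ℝ) :=
    ((hasFDerivAt_id t).sub_const t).hasMFDerivAt
  have h2 := HasMFDerivAt.comp (f := fun s : ℝ => s - t) t (h1 (t - t) (sub_self t)) hs
  have hd : MDifferentiableAt 𝓘(ℝ, E) 𝓘(ℝ, E) (fun z : G => γ t * z) 1 :=
    (contMDiff_mul_left (I := 𝓘(ℝ, E)) (n := ∞) (a := γ t)).mdifferentiableAt (by simp)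
  have h3 : ∀ y, y = 1 → HasMFDerivAt 𝓘(ℝ, E) 𝓘(ℝ, E) (fun z : G => γ t * z) y
      (mfderiv 𝓘(ℝ, E) 𝓘(ℝ, E) (fun z : G => γ t * z) 1 : E →L[ℝ] E) := by
    rintro _ rfl; exact hd.hasMFDerivAt
  have h4 := HasMFDerivAt.comp t (h3 ((γ ∘ fun s => s - t) t)
    (by simp [h.map_zero (E := E)])) h2
  have e : (fun z : G => γ t * z) ∘ (γ ∘ fun s => s - t) = γ := by
    funext s
    simp only [Function.comp]
    rw [← h.1]; congr 1; ring
  rw [e] at h4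
  have e2 : (mfderiv 𝓘(ℝ, E) 𝓘(ℝ, E) (fun z : G => γ t * z) 1 : E →L[ℝ] E).comp
      (((1 : ℝ →L[ℝ] ℝ).smulRight (x : E)).comp (ContinuousLinearMap.id ℝ ℝ)) =
      (1 : ℝ →L[ℝ] ℝ).smulRight (mulInvariantVectorField x (γ t) : E) := by
    ext
    simp only [mulInvariantVectorField, ContinuousLinearMap.comp_apply,
      ContinuousLinearMap.smulRight_apply, one_apply_eq_self, one_smul,
      ContinuousLinearMap.id_apply]
    exact (one_smul ℝ _).symm
  rw [← e2]
  exact h4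

theorem IsOneParam.unique {γ γ' : ℝ → G} {x : GroupLieAlgebra 𝓘(ℝ, E) G}
    (h : IsOneParam γ x) (h' : IsOneParam γ' x) : γ = γ' := by
  have := t2Space_of_lieGroup E G
  have : IsManifold 𝓘(ℝ, E) 1 G := IsManifold.of_le (n := ∞) (by exact_mod_cast le_top)
  exact isMIntegralCurve_Ioo_eq_of_contMDiff_boundaryless (t₀ := 0)
    (contMDiff_one_mulInvariantVectorField x) h.isMIntegralCurve h'.isMIntegralCurve
    (by rw [h.map_zero (E := E), h'.map_zero (E := E)])

/-- A differentiable homomorphism from the real line to a Lie group is smooth. -/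
theorem contMDiff_of_hom [CompleteSpace E] {γ : ℝ → G} {x : E} (hc : Continuous γ)
    (h1 : ∀ s t, γ (s + t) = γ s * γ t)
    (h2 : HasDerivAt (fun t => φ (γ t)) x 0) : ContMDiff 𝓘(ℝ, ℝ) 𝓘(ℝ, E) ∞ γ := by
  have h0 : γ 0 = 1 := by
    have := h1 0 0
    simpa using this
  have hγ0 : Tendsto γ (𝓝 0) (𝓝 1) := by
    have := hc.tendsto 0
    rwa [h0] at this
  have hc0 : Tendsto (fun t => φ (γ t)) (𝓝 0) (𝓝 (φ 1)) := by
    have := h2.continuousAt.tendsto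
    simpa only [h0] using this
  -- By `γ s = γ t γ(s - t)` the derivative at `0` determines the one at `t`: the curve solves the
  -- autonomous equation of the left-invariant field. Solutions inherit the smoothness of the field,
  -- and translation carries smoothness from `0` to every time.
  have hode : ∀ᶠ t in 𝓝 (0 : ℝ), HasDerivAt (fun t => φ (γ t)) (chartField G x (φ (γ t))) t := by
    filter_upwards [hc0.eventually (eventually_contDiffAt_chartMul (E := E) (G := G)),
      hγ0.eventually (eventually_unitChart_symm_apply (E := E) (G := G))] with t ht1 ht2
    have hm : HasFDerivAt (fun q => chartMul E G (φ (γ t), q))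
        (fderiv ℝ (fun q => chartMul E G (φ (γ t), q)) (φ 1)) (φ (γ (t - t))) := by
      rw [sub_self, h0]
      apply DifferentiableAt.hasFDerivAt
      exact DifferentiableAt.comp (g := chartMul E G) (f := fun q : E => (φ (γ t), q)) _
        (ht1.differentiableAt (by simp)) (by fun_prop)
    have h3 : HasDerivAt (fun s => φ (γ (s - t))) x t := by
      rw [← sub_self t] at h2
      exact h2.comp_sub_const t t
    have h4 := hm.comp_hasDerivAt t h3
    refine h4.congr_of_eventuallyEq ?_
    have hs : Tendsto (fun s => γ (s - t)) (𝓝 t) (𝓝 1) := by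
      have : Tendsto (fun s : ℝ => s - t) (𝓝 t) (𝓝 0) := by
        have := (continuous_sub_right t).tendsto t
        rwa [sub_self] at this
      exact hγ0.comp this
    filter_upwards [hs.eventually (eventually_unitChart_symm_apply (E := E) (G := G))] with s hs
    simp only [Function.comp, chartMul, ht2, hs]
    rw [← h1]; congr 2; ring
  have hsm : ContMDiffAt 𝓘(ℝ, ℝ) 𝓘(ℝ, E) ∞ γ 0 := by
    have hcd : ContDiffAt ℝ ∞ (fun t => φ (γ t)) 0 := by
      rw [contDiffAt_infty]
      intro n
      have hf : ContDiffAt ℝ n (chartField G x) (φ 1) := by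
        have c1 : ContDiffAt ℝ n (fun p : E => fderiv ℝ (fun q => chartMul E G (p, q)) (φ 1))
            (φ 1) :=
          ContDiffAt.fderiv (n := ∞) (f := fun p q => chartMul E G (p, q)) contDiffAt_chartMul
            contDiffAt_const (by exact_mod_cast le_top)
        exact c1.clm_apply contDiffAt_const
      obtain ⟨u, hu, hfu⟩ := hf.contDiffOn (m := n) le_rfl (by simp)
      have := (hode.and (hc0.eventually hu))
      obtain ⟨ε, hε, hball⟩ := Metric.eventually_nhds_iff_ball.1 this
      have hsub : Icc (-(ε / 2)) (ε / 2) ⊆ Metric.ball (0 : ℝ) ε := by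
        intro t ht
        rw [mem_ball_zero_iff, Real.norm_eq_abs, abs_lt]
        constructor <;> linarith [ht.1, ht.2]
      have hmain := ODE.contDiffOn_enat_Icc_of_hasDerivWithinAt (n := n)
        (f := fun _ => chartField G x) (u := u) (α := fun t => φ (γ t))
        (tmin := -(ε / 2)) (tmax := ε / 2)
        (by
          have : ContDiffOn ℝ n (fun p : ℝ × E => chartField G x p.2)
              (Icc (-(ε / 2)) (ε / 2) ×ˢ u) :=
            hfu.comp contDiff_snd.contDiffOn (fun p hp => hp.2)
          exact this)
        (fun t ht => (hball t (hsub ht)).1.hasDerivWithinAt)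
        (fun t ht => (hball t (hsub ht)).2)
      exact hmain.contDiffAt (Icc_mem_nhds (by linarith) (by linarith))
    have hsymm : ContMDiffAt 𝓘(ℝ, E) 𝓘(ℝ, E) ∞ (φ).symm (φ (γ 0)) := by
      rw [h0]; exact contMDiffAt_unitChart_symm
    have hcomp := ContMDiffAt.comp (0 : ℝ) (g := (φ).symm) hsymm hcd.contMDiffAt
    refine hcomp.congr_of_eventuallyEq ?_
    filter_upwards [hγ0.eventually (eventually_unitChart_symm_apply (E := E) (G := G))] with t ht
    simp only [Function.comp, ht]
  intro t
  have hsub : ContMDiffAt 𝓘(ℝ, ℝ) 𝓘(ℝ, ℝ) ∞ (fun s => s - t) t :=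
    (contDiff_id.sub contDiff_const).contDiffAt.contMDiffAt
  have h5 : ContMDiffAt 𝓘(ℝ, ℝ) 𝓘(ℝ, E) ∞ (fun s => γ (s - t)) t := by
    refine ContMDiffAt.comp t (g := γ) ?_ hsub
    rw [sub_self]; exact hsm
  have h6 := (contMDiffAt_const (c := γ t)).mul h5
  refine h6.congr_of_eventuallyEq (Eventually.of_forall fun s => ?_)
  change γ s = γ t * γ (s - t)
  rw [← h1]; congr 1; ring

/-- Left translates of one local integral curve through `1` live for the same time `ε` at every
point, so the curve extends to all of `ℝ`. Uniqueness makes it a homomorphism, and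
`contMDiff_of_hom` supplies the smoothness. -/
theorem exists_isOneParam [CompleteSpace E] (x : GroupLieAlgebra 𝓘(ℝ, E) G) :
    ∃ γ : ℝ → G, IsOneParam γ x := by
  have := t2Space_of_lieGroup E G
  have : IsManifold 𝓘(ℝ, E) 1 G := IsManifold.of_le (n := ∞) (by exact_mod_cast le_top)
  have hX := contMDiff_one_mulInvariantVectorField (E := E) (G := G) x
  obtain ⟨γ₀, hγ₀, hint⟩ := exists_isMIntegralCurveAt_of_contMDiffAt_boundaryless 0
    (hX.contMDiffAt (x := (1 : G)))
  rw [isMIntegralCurveAt_iff'] at hint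
  obtain ⟨ε, hε, hint⟩ := hint
  rw [Real.ball_eq_Ioo, zero_sub, zero_add] at hint
  obtain ⟨γ, hγ, hγint⟩ := exists_isMIntegralCurve_of_isMIntegralCurveOn hX hε
    (fun g => ⟨fun t => g * γ₀ t, by simp [hγ₀], isMIntegralCurveOn_mul_left hint g⟩) (1 : G)
  have hhom : ∀ s t, γ (s + t) = γ s * γ t := by
    intro s t
    have a1 := hγint.comp_add s
    have a2 : IsMIntegralCurve (fun t => γ s * γ t) (mulInvariantVectorField x) := by
      rw [isMIntegralCurve_iff_isMIntegralCurveOn] at hγint ⊢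
      exact isMIntegralCurveOn_mul_left hγint _
    have := isMIntegralCurve_Ioo_eq_of_contMDiff_boundaryless (t₀ := 0) hX a1 a2
      (by simp [hγ])
    have := congrFun this t
    simpa [add_comm] using this
  have hder : HasDerivAt (fun t => φ (γ t)) x 0 := by
    have b1 := hγint 0
    have b2 : (mulInvariantVectorField x (γ 0) : E) = x := by
      rw [hγ]; exact mulInvariantVectorField_one x
    have hm : ∀ y : G, y = 1 → HasMFDerivAt 𝓘(ℝ, E) 𝓘(ℝ, E) (φ) y (ContinuousLinearMap.id ℝ E) := by
      rintro _ rfl; exact hasMFDerivAt_unitChart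
    have b3 := HasMFDerivAt.comp (0 : ℝ) (hm _ hγ) b1
    have b4 : HasFDerivAt (fun t => φ (γ t)) ((ContinuousLinearMap.id ℝ E).comp
      ((1 : ℝ →L[ℝ] ℝ).smulRight (mulInvariantVectorField x (γ 0) : E))) 0 := b3.hasFDerivAt
    rw [b2] at b4
    exact b4.hasDerivAt.congr_deriv (one_smul ℝ x)
  exact ⟨γ, IsOneParam.of_hasDerivAt hhom
    (contMDiff_of_hom hγint.continuous hhom hder) hder⟩

end OneParamExistence

/-! ### Ordered products and their logarithmic derivatives. -/

section OrderedProducts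

open Set Filter Topology

variable {E : Type*} [NormedAddCommGroup E] [NormedSpace ℝ E]
  {G : Type*} [TopologicalSpace G] [ChartedSpace E G] [Group G]
  {W : Type*} [NormedAddCommGroup W] [NormedSpace ℝ W]

/-- The ordered product `f₀(t₀) f₁(t₁) ⋯`. -/
def oprod {n : ℕ} (f : Fin n → W → G) (t : Fin n → W) : G := (List.ofFn fun i => f i (t i)).prod

theorem oprod_succ {n : ℕ} (f : Fin (n + 1) → W → G) (t : Fin (n + 1) → W) :
    oprod f t = f 0 (t 0) * oprod (fun i => f i.succ) (fun i => t i.succ) := by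
  simp [oprod, List.ofFn_succ]

theorem oprod_mem {n : ℕ} {f : Fin n → W → G} {B : Subgroup G} (h : ∀ i t, f i t ∈ B)
    (t : Fin n → W) : oprod f t ∈ B := by
  refine Subgroup.list_prod_mem _ ?_
  intro x hx
  obtain ⟨i, rfl⟩ := (List.mem_ofFn' _ _).1 hx
  exact h _ _

theorem oprod_eq_one {n : ℕ} {f : Fin n → W → G} {t : Fin n → W} (h : ∀ i, f i (t i) = 1) :
    oprod f t = 1 := by
  simp [oprod, h]

theorem oprod_single {n : ℕ} {f : Fin n → W → G} (h : ∀ i, f i 0 = 1) (i : Fin n) (w : W) :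
    oprod f (Pi.single i w) = f i w := by
  induction n with
  | zero => exact i.elim0
  | succ n ih =>
    rw [oprod_succ]
    refine Fin.cases ?_ (fun j => ?_) i
    · rw [oprod_eq_one (fun j => by simp [h])]
      simp
    · have e : (fun k : Fin n => (Pi.single j.succ w : Fin (n + 1) → W) k.succ) =
          Pi.single j w := by
        funext k
        by_cases hk : k = j
        · subst hk; simp
        · simp [hk]
      rw [e, ih (fun j => h _)]
      simp [h]

variable [LieGroup 𝓘(ℝ, E) ∞ G]

theorem contMDiff_oprod {n : ℕ} {f : Fin n → W → G}
    (h : ∀ i, ContMDiff 𝓘(ℝ, W) 𝓘(ℝ, E) ∞ (f i)) :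
    ContMDiff 𝓘(ℝ, Fin n → W) 𝓘(ℝ, E) ∞ (oprod f) := by
  induction n with
  | zero =>
    have : oprod f = fun _ => 1 := by funext t; simp [oprod]
    rw [this]; exact contMDiff_const
  | succ n ih =>
    have e : oprod f = fun t => f 0 (t 0) * oprod (fun i => f i.succ) (fun i => t i.succ) :=
      funext fun t => oprod_succ f t
    rw [e]
    refine ContMDiff.mul ?_ ?_
    · exact (h 0).comp (contDiff_apply ℝ W (0 : Fin (n + 1))).contMDiff
    · refine (ih fun i => h i.succ).comp (ContDiff.contMDiff ?_)
      exact contDiff_pi.2 fun i => contDiff_apply ℝ W i.succ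

theorem rlog_oprod_succ {n : ℕ} {f : Fin (n + 1) → W → G}
    (h : ∀ i, ContMDiff 𝓘(ℝ, W) 𝓘(ℝ, E) ∞ (f i)) (t v : Fin (n + 1) → W) :
    rlog E (oprod f) t v = rlog E (f 0) (t 0) (v 0) +
      Ad E (f 0 (t 0)) (rlog E (oprod fun i => f i.succ) (fun i => t i.succ)
        (fun i => v i.succ)) := by
  have e : oprod f = fun t => f 0 (t 0) * oprod (fun i => f i.succ) (fun i => t i.succ) :=
    funext fun t => oprod_succ f t
  have h1 : HasFDerivAt (fun t : Fin (n + 1) → W => t 0)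
    (ContinuousLinearMap.proj (R := ℝ) (φ := fun _ : Fin (n + 1) => W) 0) t :=
    (ContinuousLinearMap.proj (R := ℝ) (φ := fun _ : Fin (n + 1) => W) 0).hasFDerivAt
  have h2 : HasFDerivAt (fun (t : Fin (n + 1) → W) (i : Fin n) => t i.succ)
    (ContinuousLinearMap.pi fun i : Fin n =>
      ContinuousLinearMap.proj (R := ℝ) (φ := fun _ : Fin (n + 1) => W) i.succ) t :=
    (ContinuousLinearMap.pi fun i : Fin n =>
      ContinuousLinearMap.proj (R := ℝ) (φ := fun _ : Fin (n + 1) => W) i.succ).hasFDerivAt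
  have s1 := (contMDiff_oprod fun i : Fin n => h i.succ)
  rw [e, rlog_mul]
  · rw [rlog_comp (f := f 0) (c := fun t : Fin (n + 1) → W => t 0) (h 0).contMDiffAt
      h1.differentiableAt,
      rlog_comp (f := oprod fun i : Fin n => f i.succ)
        (c := fun (t : Fin (n + 1) → W) (i : Fin n) => t i.succ) s1.contMDiffAt
      h2.differentiableAt, h1.fderiv, h2.fderiv]
    rfl
  · exact ((h 0).comp (contDiff_apply ℝ W (0 : Fin (n + 1))).contMDiff).contMDiffAt
  · exact (s1.comp (ContDiff.contMDiff
      (contDiff_pi.2 fun i => contDiff_apply ℝ W i.succ))).contMDiffAt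

/-- The product rule twists each later factor by `Ad` of the earlier ones; `Ad`-invariance of `𝔟` is
what keeps products tangent to `𝔟` at every point, not only at the identity. -/
theorem rlog_oprod_mem {n : ℕ} {f : Fin n → W → G}
    (h : ∀ i, ContMDiff 𝓘(ℝ, W) 𝓘(ℝ, E) ∞ (f i)) {𝔟 : Submodule ℝ E}
    (hAd : ∀ g : G, ∀ y ∈ 𝔟, Ad E g y ∈ 𝔟) (hf : ∀ i p v, rlog E (f i) p v ∈ 𝔟)
    (t v : Fin n → W) : rlog E (oprod f) t v ∈ 𝔟 := by
  induction n with
  | zero => rw [Subsingleton.elim v 0, map_zero]; exact 𝔟.zero_mem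
  | succ n ih =>
    rw [rlog_oprod_succ h]
    exact 𝔟.add_mem (hf _ _ _) (hAd _ _ (ih (fun i => h _) (fun i => hf _) _ _))

theorem rlog_oprod_of_eq_one {n : ℕ} {f : Fin n → W → G}
    (h : ∀ i, ContMDiff 𝓘(ℝ, W) 𝓘(ℝ, E) ∞ (f i)) {t : Fin n → W} (h1 : ∀ i, f i (t i) = 1)
    (v : Fin n → W) : rlog E (oprod f) t v = ∑ i, rlog E (f i) (t i) (v i) := by
  induction n with
  | zero => rw [Subsingleton.elim v 0, map_zero]; simp
  | succ n ih =>
    rw [rlog_oprod_succ h, h1, Ad_one, Fin.sum_univ_succ, ih (fun i => h _) fun i => h1 _]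
    rfl

end OrderedProducts

/-! ### Local inverses of group-valued maps. -/

section LocalCoordinates

open Set Filter Topology

variable {E : Type*} [NormedAddCommGroup E] [NormedSpace ℝ E] [FiniteDimensional ℝ E]
  {G : Type*} [TopologicalSpace G] [ChartedSpace E G] [Group G] [LieGroup 𝓘(ℝ, E) ∞ G]
  {V : Type*} [NormedAddCommGroup V] [NormedSpace ℝ V] [FiniteDimensional ℝ V]
  {V₀ : Type*} [NormedAddCommGroup V₀] [NormedSpace ℝ V₀]

local notation "φ" => unitChart E G

theorem rlog_congr {f h : V₀ → G} {p : V₀} (e : f =ᶠ[𝓝 p] h) : rlog E f p = rlog E h p := by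
  unfold rlog
  rw [e.eq_of_nhds]
  exact Filter.EventuallyEq.fderiv_eq (e.mono fun q hq => by simp only [hq])

/-- Near `q` the map `φ ∘ Φ` is right translation by `Φ q`, read in the chart, after `φ (Φ · (Φ
q)⁻¹)`. A vector killed by `rlog` is thus killed by the ordinary derivative. -/
theorem rlog_injective_of_fderiv {Φ : V → G} (hΦ : ContMDiff 𝓘(ℝ, V) 𝓘(ℝ, E) ∞ Φ) {q : V}
    (hq : Φ q ∈ (φ).source) (hinj : Function.Injective (fderiv ℝ (fun q => φ (Φ q)) q)) :
    Function.Injective (rlog E Φ q) := by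
  rw [injective_iff_map_eq_zero] at hinj ⊢
  intro v hv
  apply hinj
  have h1 := contMDiffAt_mul_const hΦ.contMDiffAt (Φ q)⁻¹ (p := q)
  have hR : ContDiffAt ℝ ∞ (fun u => φ ((φ).symm u * Φ q)) (φ 1) :=
    contDiffAt_unitChart_comp (f := fun u => (φ).symm u * Φ q)
      (contMDiffAt_mul_const contMDiffAt_unitChart_symm _)
      (by simp only [unitChart_symm_one, one_mul]; exact hq)
  have hR' : DifferentiableAt ℝ (fun u => φ ((φ).symm u * Φ q)) (φ (Φ q * (Φ q)⁻¹)) := by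
    rw [mul_inv_cancel]; exact hR.differentiableAt (by simp)
  have hd : DifferentiableAt ℝ (fun q' => φ (Φ q' * (Φ q)⁻¹)) q :=
    (contDiffAt_unitChart_comp h1 (by rw [mul_inv_cancel]; exact
      one_mem_unitChart_source)).differentiableAt (by simp)
  have e : (fun q => φ (Φ q)) =ᶠ[𝓝 q]
      (fun u => φ ((φ).symm u * Φ q)) ∘ fun q' => φ (Φ q' * (Φ q)⁻¹) := by
    have : Tendsto (fun q' => Φ q' * (Φ q)⁻¹) (𝓝 q) (𝓝 1) := by
      have := h1.continuousAt.tendsto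
      rwa [mul_inv_cancel] at this
    filter_upwards [this.eventually (eventually_unitChart_symm_apply (E := E) (G := G))] with q' hq'
    simp [hq']
  rw [e.fderiv_eq, fderiv_comp q hR' hd]
  unfold rlog at hv
  simp [hv]

/-- A smooth map into `G` with invertible differential at `0` has a smooth local inverse. -/
theorem exists_local_coordinates {Φ : V → G} (hΦ : ContMDiff 𝓘(ℝ, V) 𝓘(ℝ, E) ∞ Φ) (h0 : Φ 0 = 1)
    (hbij : Function.Bijective (rlog E Φ 0)) :
    ∃ (σ : G → V) (U : Set G), IsOpen U ∧ 1 ∈ U ∧ σ 1 = 0 ∧ (∀ g ∈ U, Φ (σ g) = g) ∧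
      (∀ g ∈ U, Function.Injective (rlog E Φ (σ g))) ∧
      ∀ g ∈ U, ContMDiffAt 𝓘(ℝ, E) 𝓘(ℝ, V) 1 σ g := by
  have : CompleteSpace V := FiniteDimensional.complete ℝ V
  have hf : ContDiffAt ℝ ∞ (fun q => φ (Φ q)) 0 :=
    contDiffAt_unitChart_comp hΦ.contMDiffAt (by rw [h0]; exact one_mem_unitChart_source)
  have hr : rlog E Φ 0 = fderiv ℝ (fun q => φ (Φ q)) 0 := by
    unfold rlog; simp [h0]
  rw [hr] at hbij
  let e : V ≃L[ℝ] E := (LinearEquiv.ofBijective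
    ((fderiv ℝ (fun q => φ (Φ q)) 0 : V →L[ℝ] E) : V →ₗ[ℝ] E) hbij).toContinuousLinearEquiv
  have he : (e : V →L[ℝ] E) = fderiv ℝ (fun q => φ (Φ q)) 0 := by ext v; rfl
  have hfd : HasFDerivAt (fun q => φ (Φ q)) (e : V →L[ℝ] E) 0 := by
    rw [he]; exact (hf.differentiableAt (by simp)).hasFDerivAt
  have hn : (∞ : WithTop ℕ∞) ≠ 0 := by simp
  set inv := hf.localInverse hfd hn with hinv
  have hi0 : inv (φ 1) = 0 := by
    have := hf.localInverse_apply_image hfd hn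
    rwa [h0] at this
  have hic : ContDiffAt ℝ 1 inv (φ 1) := by
    have := hf.to_localInverse hfd hn
    rw [h0] at this
    exact this.of_le (by exact_mod_cast le_top)
  have hright : ∀ᶠ u in 𝓝 (φ 1), φ (Φ (inv u)) = u := by
    have := (hf.hasStrictFDerivAt' hfd hn).eventually_right_inverse
    rwa [h0] at this
  have hσ0 : Tendsto (fun g => inv (φ g)) (𝓝 1) (𝓝 0) := by
    have h1 := hic.continuousAt.tendsto
    rw [hi0] at h1
    exact h1.comp (continuousAt_unitChart (E := E) (G := G)).tendsto
  have hΦ0 : Tendsto Φ (𝓝 0) (𝓝 1) := by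
    have := hΦ.continuous.tendsto 0
    rwa [h0] at this
  have hφ : Tendsto φ (𝓝 (1 : G)) (𝓝 (φ 1)) := (continuousAt_unitChart (E := E) (G := G)).tendsto
  have hsrc : ∀ᶠ g in 𝓝 (1 : G), g ∈ (φ).source := extChartAt_source_mem_nhds (1 : G)
  have E1 : ∀ᶠ g in 𝓝 (1 : G), Φ (inv (φ g)) = g := by
    filter_upwards [hsrc, hφ.eventually hright, (hΦ0.comp hσ0).eventually hsrc] with g h1 h2 h3
    exact (φ).injOn h3 h1 h2
  have E2 : ∀ᶠ g in 𝓝 (1 : G), Function.Injective (rlog E Φ (inv (φ g))) := by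
    have hcd : ContinuousAt (fderiv ℝ (fun q => φ (Φ q))) 0 :=
      (hf.fderiv_right (m := 1) one_add_one_le_infty).continuousAt
    -- Invertible operators form an open set, so invertibility at `0` persists nearby.
    have h1 : ∀ᶠ q in 𝓝 (0 : V), fderiv ℝ (fun q => φ (Φ q)) q ∈
        range ((↑) : (V ≃L[ℝ] E) → V →L[ℝ] E) := by
      apply hcd.eventually
      rw [← he]
      exact ContinuousLinearEquiv.nhds e
    filter_upwards [hσ0.eventually h1, (hΦ0.comp hσ0).eventually hsrc] with g h2 h3
    obtain ⟨e', he'⟩ := h2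
    refine rlog_injective_of_fderiv hΦ h3 ?_
    rw [← he']
    exact e'.injective
  have E3 : ∀ᶠ g in 𝓝 (1 : G), ContMDiffAt 𝓘(ℝ, E) 𝓘(ℝ, V) 1 (fun g => inv (φ g)) g := by
    filter_upwards [hsrc, hφ.eventually (hic.eventually (by simp))] with g h1 h2
    exact ContMDiffAt.comp g h2.contMDiffAt ((contMDiffAt_unitChart h1).of_le
      (by exact_mod_cast le_top))
  obtain ⟨U, hU, hUo, h1U⟩ := eventually_nhds_iff.1 (E1.and (E2.and E3))
  exact ⟨fun g => inv (φ g), U, hUo, h1U, hi0, fun g hg => (hU g hg).1,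
    fun g hg => (hU g hg).2.1, fun g hg => (hU g hg).2.2⟩

end LocalCoordinates

/-! ### Coordinates adapted to an invariant subspace, and countability of transverse coordinates. -/

section Leaves

open Set Filter Topology

variable {E : Type*} [NormedAddCommGroup E] [NormedSpace ℝ E] [FiniteDimensional ℝ E]
  {G : Type*} [TopologicalSpace G] [ChartedSpace E G] [Group G] [LieGroup 𝓘(ℝ, E) ∞ G]
  {V₁ V₂ V₀ : Type*} [NormedAddCommGroup V₁] [NormedSpace ℝ V₁] [FiniteDimensional ℝ V₁]
  [NormedAddCommGroup V₂] [NormedSpace ℝ V₂] [FiniteDimensional ℝ V₂]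
  [NormedAddCommGroup V₀] [NormedSpace ℝ V₀]

/-- Smooth maps `ψ`, `χ` into `G` such that `ψ` is tangent to the `Ad`-invariant subspace `𝔟` and
`(s, t) ↦ ψ s * χ t` is a local diffeomorphism at `0`. -/
structure IsSplitting (ψ : V₁ → G) (χ : V₂ → G) (𝔟 : Submodule ℝ E) : Prop where
  smooth_left : ContMDiff 𝓘(ℝ, V₁) 𝓘(ℝ, E) ∞ ψ
  smooth_right : ContMDiff 𝓘(ℝ, V₂) 𝓘(ℝ, E) ∞ χ
  left_zero : ψ 0 = 1
  right_zero : χ 0 = 1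
  Ad_mem : ∀ g : G, ∀ y ∈ 𝔟, Ad E g y ∈ 𝔟
  rlog_mem : ∀ s v, rlog E ψ s v ∈ 𝔟
  bijective : Function.Bijective fun p : V₁ × V₂ => rlog E ψ 0 p.1 + rlog E χ 0 p.2
  finrank_eq : Module.finrank ℝ V₁ = Module.finrank ℝ 𝔟

/-- Local coordinates inverting `(s, t) ↦ ψ s * χ t` on a neighbourhood `U` of `1`. -/
structure SplitChart (ψ : V₁ → G) (χ : V₂ → G) (𝔟 : Submodule ℝ E) where
  toFun : G → V₁ × V₂
  U : Set G
  isOpen : IsOpen U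
  one_mem : 1 ∈ U
  map_one : toFun 1 = 0
  apply_eq : ∀ g ∈ U, ψ (toFun g).1 * χ (toFun g).2 = g
  injective : ∀ g ∈ U, Function.Injective (rlog E (fun p : V₁ × V₂ => ψ p.1 * χ p.2) (toFun g))
  smoothAt : ∀ g ∈ U, ContMDiffAt 𝓘(ℝ, E) 𝓘(ℝ, V₁ × V₂) 1 toFun g

variable {ψ : V₁ → G} {χ : V₂ → G} {𝔟 : Submodule ℝ E}

namespace IsSplitting

theorem smooth_mul (h : IsSplitting ψ χ 𝔟) :
    ContMDiff 𝓘(ℝ, V₁ × V₂) 𝓘(ℝ, E) ∞ (fun p : V₁ × V₂ => ψ p.1 * χ p.2) :=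
  (h.smooth_left.comp contDiff_fst.contMDiff).mul (h.smooth_right.comp contDiff_snd.contMDiff)

theorem rlog_mul_apply (h : IsSplitting ψ χ 𝔟) (p v : V₁ × V₂) :
    rlog E (fun p : V₁ × V₂ => ψ p.1 * χ p.2) p v =
      rlog E ψ p.1 v.1 + Ad E (ψ p.1) (rlog E χ p.2 v.2) := by
  rw [rlog_mul (f := fun p : V₁ × V₂ => ψ p.1) (h := fun p : V₁ × V₂ => χ p.2)
    (h.smooth_left.comp contDiff_fst.contMDiff).contMDiffAt
    (h.smooth_right.comp contDiff_snd.contMDiff).contMDiffAt,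
    rlog_comp (f := ψ) (c := Prod.fst) h.smooth_left.contMDiffAt differentiableAt_fst,
    rlog_comp (f := χ) (c := Prod.snd) h.smooth_right.contMDiffAt differentiableAt_snd,
    fderiv_fst, fderiv_snd]
  rfl

theorem nonempty_splitChart (h : IsSplitting ψ χ 𝔟) : Nonempty (SplitChart ψ χ 𝔟) := by
  obtain ⟨σ, U, h1, h2, h3, h4, h5, h6⟩ := exists_local_coordinates h.smooth_mul
    (by simp [h.left_zero, h.right_zero]) (by
      have : (rlog E (fun p : V₁ × V₂ => ψ p.1 * χ p.2) 0 : V₁ × V₂ → E) =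
          fun p : V₁ × V₂ => rlog E ψ 0 p.1 + rlog E χ 0 p.2 := by
        funext v
        rw [h.rlog_mul_apply]
        simp [h.left_zero, Ad_one]
      rw [this]; exact h.bijective)
  exact ⟨⟨σ, U, h1, h2, h3, h4, h5, h6⟩⟩

/-- The transverse coordinate is constant to first order along directions tangent to `𝔟`. -/
theorem fderiv_transverse (h : IsSplitting ψ χ 𝔟) (c : SplitChart ψ χ 𝔟) {F : V₀ → G} {p : V₀}
    (hF : ContMDiffAt 𝓘(ℝ, V₀) 𝓘(ℝ, E) ∞ F p) (hp : F p ∈ c.U) :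
    DifferentiableAt ℝ (fun q => c.toFun (F q)) p ∧
      ∀ v, rlog E F p v ∈ 𝔟 → fderiv ℝ (fun q => (c.toFun (F q)).2) p v = 0 := by
  have hd : DifferentiableAt ℝ (fun q => c.toFun (F q)) p := by
    have : ContMDiffAt 𝓘(ℝ, V₀) 𝓘(ℝ, V₁ × V₂) 1 (fun q => c.toFun (F q)) p :=
      (c.smoothAt _ hp).comp p (hF.of_le (by exact_mod_cast le_top))
    exact this.contDiffAt.differentiableAt (by simp)
  refine ⟨hd, fun v hv => ?_⟩
  have e : F =ᶠ[𝓝 p] fun q => (fun p : V₁ × V₂ => ψ p.1 * χ p.2) (c.toFun (F q)) := by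
    filter_upwards [hF.continuousAt.eventually (c.isOpen.mem_nhds hp)] with q hq
    exact (c.apply_eq _ hq).symm
  rw [rlog_congr e, rlog_comp (c := fun q => c.toFun (F q)) h.smooth_mul.contMDiffAt hd] at hv
  have h2 : fderiv ℝ (fun q => (c.toFun (F q)).2) p v =
      (fderiv ℝ (fun q => c.toFun (F q)) p v).2 := by
    rw [fderiv.snd hd]; rfl
  rw [h2]
  set w := fderiv ℝ (fun q => c.toFun (F q)) p v
  set q₀ := c.toFun (F p)
  have hv' : rlog E (fun p : V₁ × V₂ => ψ p.1 * χ p.2) q₀ w ∈ 𝔟 := hv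
  have hinj := c.injective _ hp
  -- The differential of `ψ` is injective into `𝔟` and the dimensions agree, so it is onto. The
  -- tangent vector in `𝔟` is therefore realised by some `(a, 0)`, and injectivity in the
  -- coordinates forces `w = (a, 0)`.
  let L : V₁ →ₗ[ℝ] 𝔟 := (rlog E ψ q₀.1 : V₁ →ₗ[ℝ] E).codRestrict 𝔟 (fun a => h.rlog_mem _ a)
  have hL : Function.Injective L := by
    intro a b hab
    have hab' : rlog E ψ q₀.1 a = rlog E ψ q₀.1 b := congrArg Subtype.val hab
    have : ((a, 0) : V₁ × V₂) = (b, 0) := hinj (by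
      rw [h.rlog_mul_apply, h.rlog_mul_apply]
      simp only [map_zero, add_zero]
      exact hab')
    exact (Prod.mk.inj this).1
  have hLs : Function.Surjective L :=
    (LinearMap.injective_iff_surjective_of_finrank_eq_finrank h.finrank_eq).1 hL
  obtain ⟨a, ha⟩ := hLs ⟨_, hv'⟩
  have ha' : rlog E ψ q₀.1 a = rlog E (fun p : V₁ × V₂ => ψ p.1 * χ p.2) q₀ w :=
    congrArg Subtype.val ha
  have : ((a, 0) : V₁ × V₂) = w := hinj (by
    rw [h.rlog_mul_apply]
    simp only [map_zero, add_zero]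
    exact ha')
  rw [← this]

/-- A map tangent to `𝔟` takes countably many transverse coordinates. -/
theorem countable_transverse [FiniteDimensional ℝ V₀] (h : IsSplitting ψ χ 𝔟)
    (c : SplitChart ψ χ 𝔟) {F : V₀ → G} (hF : ContMDiff 𝓘(ℝ, V₀) 𝓘(ℝ, E) ∞ F)
    (ht : ∀ p v, rlog E F p v ∈ 𝔟) :
    ((fun g => (c.toFun g).2) '' (range F ∩ c.U)).Countable := by
  have hprop : ProperSpace V₀ := FiniteDimensional.proper ℝ V₀
  -- The transverse coordinate is constant on every ball mapped into the chart domain, so its values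
  -- at points of a countable dense set are all its values.
  obtain ⟨D, hDc, hDd⟩ := TopologicalSpace.exists_countable_dense V₀
  refine (hDc.image fun q => (c.toFun (F q)).2).mono ?_
  rintro _ ⟨_, ⟨⟨q, rfl⟩, hq⟩, rfl⟩
  have hΩ : IsOpen (F ⁻¹' c.U) := c.isOpen.preimage hF.continuous
  obtain ⟨ε, hε, hball⟩ := Metric.isOpen_iff.1 hΩ q hq
  obtain ⟨d, hd, hdist⟩ := hDd.exists_dist_lt q hε
  refine ⟨d, hd, ?_⟩
  have hdb : d ∈ Metric.ball q ε := by rw [Metric.mem_ball, dist_comm]; exact hdist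
  refine Metric.isOpen_ball.is_const_of_fderiv_eq_zero (𝕜 := ℝ)
    (convex_ball q ε).isPreconnected (f := fun q => (c.toFun (F q)).2) ?_ ?_ hdb
    (Metric.mem_ball_self hε)
  · intro x hx
    exact ((h.fderiv_transverse c hF.contMDiffAt (hball hx)).1.snd).differentiableWithinAt
  · intro x hx
    ext v
    exact (h.fderiv_transverse c hF.contMDiffAt (hball hx)).2 v (ht x v)

/-- A one-parameter subgroup lies in any subgroup in which it starts. -/
theorem _root_.ConjInv.IsOneParam.mem_of_eventually {γ : ℝ → G} {x : E} (hγ : IsOneParam γ x)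
    {B : Subgroup G} (hB : ∀ᶠ t in 𝓝 0, γ t ∈ B) (t : ℝ) : γ t ∈ B := by
  obtain ⟨ε, hε, hb⟩ := Metric.eventually_nhds_iff.1 hB
  obtain ⟨n, hn⟩ := exists_nat_gt (|t| / ε)
  have hn0 : (0 : ℝ) < n := lt_of_le_of_lt (by positivity) hn
  have hpow : ∀ (m : ℕ) (s : ℝ), γ (m * s) = γ s ^ m := by
    intro m s
    induction m with
    | zero => simp [hγ.map_zero (E := E)]
    | succ m ih => rw [pow_succ, ← ih, ← hγ.1]; congr 1; push_cast; ring
  have h1 : γ t = γ (t / n) ^ n := by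
    rw [← hpow]; congr 1; field_simp
  rw [h1]
  refine B.pow_mem (hb ?_) n
  rw [dist_zero_right, Real.norm_eq_abs, abs_div, Nat.abs_cast, div_lt_iff₀ hn0]
  rwa [div_lt_iff₀ hε, mul_comm] at hn

theorem one_param_near (h : IsSplitting ψ χ 𝔟) (c : SplitChart ψ χ 𝔟) {γ : ℝ → G} {x : E}
    (hγ : IsOneParam γ x) : ∃ ε > 0, (∀ t ∈ Metric.ball (0 : ℝ) ε, γ t ∈ c.U) ∧
      DifferentiableOn ℝ (fun t => c.toFun (γ t)) (Metric.ball 0 ε) := by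
  have hU : ∀ᶠ t in 𝓝 (0 : ℝ), γ t ∈ c.U := by
    apply hγ.2.1.continuous.continuousAt.eventually
    rw [hγ.map_zero (E := E)]
    exact c.isOpen.mem_nhds c.one_mem
  obtain ⟨ε, hε, hb⟩ := Metric.eventually_nhds_iff_ball.1 hU
  refine ⟨ε, hε, hb, fun t ht => ?_⟩
  exact (h.fderiv_transverse c (hγ.2.1.contMDiffAt (x := t)) (hb t ht)).1.differentiableWithinAt

/-- The transverse coordinate has zero derivative along `γ` and starts at `0`; hence `γ` runs in the
image of `ψ` for small times, and the group law does the rest. -/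
theorem one_param_mem (h : IsSplitting ψ χ 𝔟) {γ : ℝ → G} {x : E}
    (hγ : IsOneParam γ x) (hx : x ∈ 𝔟) {B : Subgroup G} (hB : ∀ s, ψ s ∈ B) (t : ℝ) : γ t ∈ B := by
  obtain ⟨c⟩ := h.nonempty_splitChart
  obtain ⟨ε, hε, hb, hd⟩ := h.one_param_near c hγ
  refine hγ.mem_of_eventually ?_ t
  filter_upwards [Metric.ball_mem_nhds (0 : ℝ) hε] with t ht
  have hconst : (c.toFun (γ t)).2 = (c.toFun (γ 0)).2 := by
    refine Metric.isOpen_ball.is_const_of_fderiv_eq_zero (𝕜 := ℝ)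
      (convex_ball 0 ε).isPreconnected (f := fun t => (c.toFun (γ t)).2) ?_ ?_ ht
      (Metric.mem_ball_self hε)
    · exact hd.snd
    · intro s hs
      ext
      refine (h.fderiv_transverse c hγ.2.1.contMDiffAt (hb s hs)).2 _ ?_
      rw [hγ.rlog_apply (E := E), one_smul]; exact hx
  rw [hγ.map_zero (E := E), c.map_one] at hconst
  have := c.apply_eq _ (hb t ht)
  rw [hconst] at this
  rw [← this, Prod.snd_zero, h.right_zero, mul_one]
  exact hB _

/-- A countable set is totally disconnected, so the continuous transverse coordinate of `γ` is
constant near `0`. Thus `γ` factors through `ψ` there and its generator is a value of `rlog E ψ`. -/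
theorem mem_of_one_param_mem (h : IsSplitting ψ χ 𝔟) {B : Set G}
    (hB : ∀ c : SplitChart ψ χ 𝔟, ((fun g => (c.toFun g).2) '' (B ∩ c.U)).Countable)
    {γ : ℝ → G} {x : E} (hγ : IsOneParam γ x) (hmem : ∀ t, γ t ∈ B) : x ∈ 𝔟 := by
  obtain ⟨c⟩ := h.nonempty_splitChart
  obtain ⟨ε, hε, hb, hd⟩ := h.one_param_near c hγ
  have hcount : ((fun t => (c.toFun (γ t)).2) '' Metric.ball 0 ε).Countable := by
    refine (hB c).mono ?_
    rintro _ ⟨t, ht, rfl⟩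
    exact ⟨γ t, ⟨hmem t, hb t ht⟩, rfl⟩
  have hsub := hcount.isTotallyDisconnected _ Subset.rfl
    ((convex_ball (0 : ℝ) ε).isPreconnected.image _ hd.snd.continuousOn)
  have hψ : ∀ᶠ t in 𝓝 (0 : ℝ), γ t = ψ (c.toFun (γ t)).1 := by
    filter_upwards [Metric.ball_mem_nhds (0 : ℝ) hε] with t ht
    have h1 : (c.toFun (γ t)).2 = (c.toFun (γ 0)).2 :=
      hsub ⟨t, ht, rfl⟩ ⟨0, Metric.mem_ball_self hε, rfl⟩
    rw [hγ.map_zero (E := E), c.map_one] at h1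
    have := c.apply_eq _ (hb t ht)
    rw [h1] at this
    rw [Prod.snd_zero, h.right_zero, mul_one] at this
    exact this.symm
  have h0 := hγ.rlog_apply (E := E) 0 1
  have hd0 : DifferentiableAt ℝ (fun t => (c.toFun (γ t)).1) 0 :=
    (hd.fst).differentiableAt (Metric.ball_mem_nhds (0 : ℝ) hε)
  rw [rlog_congr hψ, rlog_comp (f := ψ) (c := fun t => (c.toFun (γ t)).1)
    h.smooth_left.contMDiffAt hd0, one_smul] at h0
  rw [← h0]
  exact h.rlog_mem _ _

theorem eventually_eq_mul (h : IsSplitting ψ χ 𝔟) : ∀ᶠ g in 𝓝 (1 : G), ∃ s t, g = ψ s * χ t := by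
  obtain ⟨c⟩ := h.nonempty_splitChart
  filter_upwards [c.isOpen.mem_nhds c.one_mem] with g hg
  exact ⟨_, _, (c.apply_eq g hg).symm⟩

/-- Words in the values of `ψ` take countably many transverse coordinates. -/
theorem countable_words (h : IsSplitting ψ χ 𝔟) (c : SplitChart ψ χ 𝔟) :
    ((fun g => (c.toFun g).2) ''
      ({g | ∃ n, ∃ s : Fin n → V₁, g = oprod (fun _ => ψ) s} ∩ c.U)).Countable := by
  -- For each length the words are the image of a single smooth map on a finite-dimensional space,
  -- tangent to `𝔟`.
  have : ({g | ∃ n, ∃ s : Fin n → V₁, g = oprod (fun _ => ψ) s} ∩ c.U) =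
      ⋃ n : ℕ, (range (oprod (n := n) (fun _ => ψ)) ∩ c.U) := by
    ext g
    simp only [mem_inter_iff, mem_ofPred_eq, mem_iUnion, mem_range]
    constructor
    · rintro ⟨⟨n, s, rfl⟩, hg⟩
      exact ⟨n, ⟨s, rfl⟩, hg⟩
    · rintro ⟨n, ⟨s, rfl⟩, hg⟩
      exact ⟨⟨n, s, rfl⟩, hg⟩
  rw [this, image_iUnion]
  exact countable_iUnion fun n => h.countable_transverse c
    (contMDiff_oprod fun _ => h.smooth_left)
    (rlog_oprod_mem (fun _ => h.smooth_left) h.Ad_mem fun _ => h.rlog_mem)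

end IsSplitting

/-- A single `γ i t` is the value of `oprod γ` at a point of a coordinate axis, and inverses come
from `-t`. So the uncountably many generators need only countably many parametrised families of
words. -/
theorem mem_closure_iff_oprod {k : ℕ} {γ : Fin k → ℝ → G} {w : Fin k → E}
    (hγ : ∀ i, IsOneParam (γ i) (w i)) {g : G}
    (hg : g ∈ Subgroup.closure (⋃ i, range (γ i))) :
    ∃ n, ∃ s : Fin n → Fin k → ℝ, g = oprod (fun _ => oprod γ) s := by
  rw [← Subgroup.mem_toSubmonoid, Subgroup.closure_toSubmonoid] at hg
  obtain ⟨l, hl, rfl⟩ := Submonoid.exists_list_of_mem_closure hg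
  have key : ∀ x ∈ l, ∃ s, oprod γ s = x := by
    intro x hx
    have : ∃ i t, x = γ i t := by
      rcases hl x hx with hx | hx
      · obtain ⟨i, t, rfl⟩ := mem_iUnion.1 hx
        exact ⟨i, t, rfl⟩
      · obtain ⟨i, t, ht⟩ := mem_iUnion.1 hx
        refine ⟨i, -t, ?_⟩
        rw [(hγ i).map_neg (E := E), ht, inv_inv]
    obtain ⟨i, t, rfl⟩ := this
    exact ⟨Pi.single i t, oprod_single (fun i => (hγ i).map_zero (E := E)) i t⟩
  refine ⟨l.length, fun i => (key (l.get i) (List.get_mem l i)).choose, ?_⟩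
  have e : (fun i => oprod γ (key (l.get i) (List.get_mem l i)).choose) = l.get :=
    funext fun i => (key (l.get i) (List.get_mem l i)).choose_spec
  change l.prod = (List.ofFn fun i => oprod γ (key (l.get i) (List.get_mem l i)).choose).prod
  rw [e, List.ofFn_get]

/-- Coordinates of the second kind. -/
theorem isSplitting_oprod {k m : ℕ} (b : Module.Basis (Fin k ⊕ Fin m) ℝ E)
    {γ : Fin k → ℝ → G} {δ : Fin m → ℝ → G} (hγ : ∀ i, IsOneParam (γ i) (b (Sum.inl i)))
    (hδ : ∀ j, IsOneParam (δ j) (b (Sum.inr j)))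
    (hAd : ∀ g : G, ∀ y ∈ Submodule.span ℝ (range (b ∘ Sum.inl)),
      Ad E g y ∈ Submodule.span ℝ (range (b ∘ Sum.inl))) :
    IsSplitting (oprod γ) (oprod δ) (Submodule.span ℝ (range (b ∘ Sum.inl))) where
  smooth_left := contMDiff_oprod fun i => (hγ i).2.1
  smooth_right := contMDiff_oprod fun i => (hδ i).2.1
  left_zero := oprod_eq_one fun i => (hγ i).map_zero (E := E)
  right_zero := oprod_eq_one fun i => (hδ i).map_zero (E := E)
  Ad_mem := hAd
  rlog_mem := rlog_oprod_mem (fun i => (hγ i).2.1) hAd fun i p v => by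
    rw [(hγ i).rlog_apply (E := E)]
    exact Submodule.smul_mem _ _ (Submodule.subset_span ⟨i, rfl⟩)
  bijective := by
    have e : (fun p : (Fin k → ℝ) × (Fin m → ℝ) => rlog E (oprod γ) 0 p.1 + rlog E (oprod δ) 0 p.2)
        = fun p => b.equivFun.symm ((LinearEquiv.sumArrowLequivProdArrow _ _ ℝ ℝ).symm p) := by
      funext p
      rw [rlog_oprod_of_eq_one (t := 0) (fun i => (hγ i).2.1) (fun i => (hγ i).map_zero (E := E)),
        rlog_oprod_of_eq_one (t := 0) (fun i => (hδ i).2.1) (fun i => (hδ i).map_zero (E := E)),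
        Module.Basis.equivFun_symm_apply, Fintype.sum_sum_type]
      simp only [(hγ _).rlog_apply (E := E), (hδ _).rlog_apply (E := E)]
      rfl
    rw [e]
    exact b.equivFun.symm.bijective.comp (LinearEquiv.bijective _)
  finrank_eq := by
    rw [finrank_span_eq_card (b.linearIndependent.comp _ Sum.inl_injective)]
    simp

end Leaves

/-! ### Adapted bases and invariance of ideals under the adjoint action. -/

section AdInvariance

open Set Filter Topology

variable {E : Type*} [NormedAddCommGroup E] [NormedSpace ℝ E] [FiniteDimensional ℝ E]

/-- Membership in `𝔟` becomes the equation `P x = 0` for a continuous linear `P`, which is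
compatible with derivatives and with uniqueness for differential equations. -/
theorem exists_projection (𝔟 : Submodule ℝ E) : ∃ P : E →L[ℝ] E,
    (∀ x, P x = 0 ↔ x ∈ 𝔟) ∧ ∀ x, x - P x ∈ 𝔟 := by
  obtain ⟨q, hq⟩ := 𝔟.exists_isCompl
  refine ⟨LinearMap.toContinuousLinearMap (q.projection 𝔟 hq.symm), fun x => ?_, fun x => ?_⟩
  · exact Submodule.projection_apply_eq_zero_iff hq.symm
  · rw [← Submodule.projection_apply_eq_zero_iff hq.symm]
    have := Submodule.projection_apply_of_mem_left hq.symm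
      (Submodule.projection_apply_mem hq.symm x)
    simp [map_sub, this]

theorem hasDerivAt_mem {𝔟 : Submodule ℝ E} {f : ℝ → E} {f' : E} {t : ℝ}
    (hf : HasDerivAt f f' t) (hmem : ∀ s, f s ∈ 𝔟) : f' ∈ 𝔟 := by
  obtain ⟨P, hP, -⟩ := exists_projection 𝔟
  have h1 := P.hasFDerivAt.comp_hasDerivAt t hf
  have h2 : (P ∘ f) = fun _ => 0 := funext fun s => (hP _).2 (hmem s)
  rw [h2] at h1
  exact (hP _).1 (h1.unique (hasDerivAt_const t (0 : E)))

/-- A linear flow whose generator preserves `𝔟` preserves `𝔟`. -/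
theorem mem_of_hasDerivAt {𝔟 : Submodule ℝ E} {A : E →ₗ[ℝ] E} (hA : ∀ y ∈ 𝔟, A y ∈ 𝔟)
    {f : ℝ → E} (hf : ∀ t, HasDerivAt f (A (f t)) t) (h0 : f 0 ∈ 𝔟) (t : ℝ) : f t ∈ 𝔟 := by
  obtain ⟨P, hP, hP'⟩ := exists_projection 𝔟
  -- As `P A` kills `𝔟`, it factors through `P`. So `P ∘ f` solves the linear equation `y' = Q y`
  -- with initial value `0`.
  let Q : E →L[ℝ] E := P.comp (LinearMap.toContinuousLinearMap A)
  have hQ : ∀ x, Q x = Q (P x) := by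
    intro x
    rw [← sub_eq_zero, ← map_sub]
    exact (hP _).2 (hA _ (hP' x))
  have h1 : (P ∘ f) = fun _ => 0 := by
    refine ODE_solution_unique_univ (v := fun _ => Q) (s := fun _ => univ) (t₀ := 0)
      (K := ‖Q‖₊) (fun _ => Q.lipschitz.lipschitzOnWith) (fun t => ⟨?_, mem_univ _⟩)
      (fun t => ⟨?_, mem_univ _⟩) ?_
    · have := P.hasFDerivAt.comp_hasDerivAt t (hf t)
      simp only [Function.comp]
      rw [← hQ]
      exact this
    · simpa using hasDerivAt_const t (0 : E)
    · exact (hP _).2 h0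
  exact (hP _).1 (congrFun h1 t)

/-- The basis vectors must be taken from `S` and `T` themselves, not only from their spans: the
generators of the one-parameter factors have to be conjugates of elements of `V`, respectively fixed
vectors of `τ`. -/
theorem exists_adapted_basis {S T : Set E} (h : Submodule.span ℝ (S ∪ T) = ⊤) :
    ∃ (k m : ℕ) (b : Module.Basis (Fin k ⊕ Fin m) ℝ E), (∀ i, b (Sum.inl i) ∈ S) ∧
      Submodule.span ℝ (range (b ∘ Sum.inl)) = Submodule.span ℝ S ∧ ∀ j, b (Sum.inr j) ∈ T := by
  obtain ⟨s, hsS, hspan, hs⟩ := exists_linearIndependent ℝ S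
  obtain ⟨u, huT, hsu, hu, hli⟩ := exists_linearIndepOn_id_extension (K := ℝ) (s := s) (t := s ∪ T)
    hs subset_union_left
  have hfu : u.Finite := hli.linearIndependent.setFinite
  have hfs : s.Finite := hfu.subset hsu
  have hfd : (u \ s).Finite := hfu.subset sdiff_subset
  classical
  have := hfs.fintype
  have := hfd.fintype
  let e : (Fin (Fintype.card s) ⊕ Fin (Fintype.card ↑(u \ s))) ≃ u :=
    ((Fintype.equivFin s).symm.sumCongr (Fintype.equivFin ↑(u \ s)).symm).trans
      (Equiv.Set.sumDiffSubset hsu)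
  have hli' : LinearIndependent ℝ (fun x : u => (x : E)) := hli.linearIndependent
  have htop : ⊤ ≤ Submodule.span ℝ (range fun x : u => (x : E)) := by
    rw [Subtype.range_coe, ← h]
    refine Submodule.span_le.2 (union_subset ?_ (subset_union_right.trans hu))
    have : S ⊆ Submodule.span ℝ s := by rw [hspan]; exact Submodule.subset_span
    exact this.trans (Submodule.span_mono hsu)
  let b := (Module.Basis.mk hli' htop).reindex e.symm
  have hb : ∀ i, b i = e i := by intro i; simp [b]
  refine ⟨_, _, b, fun i => ?_, ?_, fun j => ?_⟩
  · rw [hb]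
    exact hsS (by simp [e])
  · have hr : range (b ∘ Sum.inl) = s := by
      ext x
      constructor
      · rintro ⟨i, rfl⟩
        simp [hb, e]
      · intro hx
        refine ⟨Fintype.equivFin s ⟨x, hx⟩, ?_⟩
        simp [hb, e]
    rw [hr, hspan]
  · rw [hb]
    have h1 : ((e (Sum.inr j) : u) : E) ∈ u \ s := by simp [e]
    exact (huT h1.1).resolve_left h1.2

theorem subgroup_eq_top_of_mem_nhds {G : Type*} [TopologicalSpace G] [Group G]
    [IsTopologicalGroup G] [ConnectedSpace G] {H : Subgroup G}
    (h : ∀ᶠ g in 𝓝 (1 : G), g ∈ H) : H = ⊤ := by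
  have ho : IsOpen (H : Set G) := Subgroup.isOpen_of_mem_nhds H h
  have hc : IsClopen (H : Set G) := (⟨H, ho⟩ : OpenSubgroup G).isClopen
  exact SetLike.coe_injective (hc.eq_univ ⟨1, H.one_mem⟩)

variable {G : Type*} [TopologicalSpace G] [ChartedSpace E G] [Group G] [LieGroup 𝓘(ℝ, E) ∞ G]

variable (G) in
/-- The adjoint representation of the Lie algebra. -/
def adE (x : E) : E →ₗ[ℝ] E where
  toFun := bracketE G x
  map_add' a b := by
    have := lieGroup_minSmoothness E G
    exact lie_add (L := GroupLieAlgebra 𝓘(ℝ, E) G) (M := GroupLieAlgebra 𝓘(ℝ, E) G) x a b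
  map_smul' c a := by
    have := lieGroup_minSmoothness E G
    exact lie_smul (R := ℝ) (L := GroupLieAlgebra 𝓘(ℝ, E) G) (M := GroupLieAlgebra 𝓘(ℝ, E) G) c x a

theorem Ad_oneParam_mem {𝔟 : Submodule ℝ E} {γ : ℝ → G} {x : E} (hγ : IsOneParam γ x)
    (h : ∀ y ∈ 𝔟, bracketE G x y ∈ 𝔟) {y : E} (hy : y ∈ 𝔟) (t : ℝ) : Ad E (γ t) y ∈ 𝔟 :=
  mem_of_hasDerivAt (A := adE G x) h (f := fun t => Ad E (γ t) y) (hasDerivAt_Ad hγ y)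
    (by simpa [hγ.map_zero (E := E), Ad_one] using hy) t

theorem bracketE_mem_of_Ad {𝔟 : Submodule ℝ E} {γ : ℝ → G} {x : E} (hγ : IsOneParam γ x) {y : E}
    (h : ∀ t, Ad E (γ t) y ∈ 𝔟) : bracketE G x y ∈ 𝔟 :=
  hasDerivAt_mem (hasDerivAt_Ad_zero hγ y) h

/-- A connected Lie group is generated by its one-parameter subgroups. -/
theorem eq_top_of_oneParam_mem [ConnectedSpace G] {H : Subgroup G}
    (h : ∀ (x : E) (γ : ℝ → G), IsOneParam γ x → γ 1 ∈ H) : H = ⊤ := by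
  have : CompleteSpace E := FiniteDimensional.complete ℝ E
  -- With `S = ∅` the subspace `𝔟` is zero and trivially invariant; only the local surjectivity of
  -- the coordinates is used.
  obtain ⟨k, m, b, hS, hspan, hT⟩ := exists_adapted_basis (E := E) (S := ∅) (T := univ) (by simp)
  choose γ hγ using fun i => exists_isOneParam (G := G) (b (Sum.inl i))
  choose δ hδ using fun i => exists_isOneParam (G := G) (b (Sum.inr i))
  have hH : ∀ (x : E) (γ : ℝ → G), IsOneParam γ x → ∀ t, γ t ∈ H := by
    intro x γ hγ t
    have := h _ _ (hγ.smul t)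
    rwa [mul_one] at this
  have hs := isSplitting_oprod b hγ hδ (by
    rw [hspan, Submodule.span_empty]
    intro g y hy
    rw [(Submodule.mem_bot ℝ).1 hy, map_zero]
    exact Submodule.zero_mem _)
  have : IsTopologicalGroup G := topologicalGroup_of_lieGroup 𝓘(ℝ, E) ∞
  refine subgroup_eq_top_of_mem_nhds ?_
  filter_upwards [hs.eventually_eq_mul] with g hg
  obtain ⟨s, t, rfl⟩ := hg
  exact H.mul_mem (oprod_mem (fun i t => hH _ _ (hγ i) t) s)
    (oprod_mem (fun i t => hH _ _ (hδ i) t) t)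

/-- Ideals are invariant under the adjoint action of a connected group. -/
theorem Ad_mem_of_ideal [ConnectedSpace G] {𝔟 : Submodule ℝ E}
    (h : ∀ x, ∀ y ∈ 𝔟, bracketE G x y ∈ 𝔟) (g : G) {y : E} (hy : y ∈ 𝔟) : Ad E g y ∈ 𝔟 := by
  let H : Subgroup G :=
    { carrier := {g | (∀ y ∈ 𝔟, Ad E g y ∈ 𝔟) ∧ ∀ y ∈ 𝔟, Ad E g⁻¹ y ∈ 𝔟}
      mul_mem' := by
        rintro a b ⟨ha, ha'⟩ ⟨hb, hb'⟩
        refine ⟨fun y hy => ?_, fun y hy => ?_⟩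
        · rw [Ad_mul]; exact ha _ (hb _ hy)
        · rw [mul_inv_rev, Ad_mul]; exact hb' _ (ha' _ hy)
      one_mem' := by
        refine ⟨fun y hy => ?_, fun y hy => ?_⟩ <;> simpa [Ad_one] using hy
      inv_mem' := by
        rintro a ⟨ha, ha'⟩
        exact ⟨ha', by rwa [inv_inv]⟩ }
  have hH : H = ⊤ := by
    refine eq_top_of_oneParam_mem (E := E) fun x γ hγ => ⟨fun y hy => ?_, fun y hy => ?_⟩
    · exact Ad_oneParam_mem hγ (h x) hy 1
    · rw [← hγ.map_neg (E := E)]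
      exact Ad_oneParam_mem hγ (h x) hy (-1)
  have : g ∈ H := hH ▸ Subgroup.mem_top g
  exact this.1 y hy

end AdInvariance

/-! ### The ideal generated by the anti-fixed vectors of an involution. -/

section InvolutionAlgebra

variable {L : Type*} [LieRing L] [LieAlgebra ℝ L] {D : Module.End ℝ L}

open Module.End

/-- The span of the brackets of `(-1)`-eigenvectors of `D`. -/
abbrev bracketSpan (D : Module.End ℝ L) : Submodule ℝ L :=
  Submodule.span ℝ {z | ∃ x ∈ eigenspace D (-1), ∃ y ∈ eigenspace D (-1), z = ⁅x, y⁆}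

theorem mem_eigenspace_neg_one {x : L} : x ∈ eigenspace D (-1) ↔ D x = -x := by
  rw [mem_eigenspace_iff, neg_one_smul]

theorem mem_eigenspace_one {x : L} : x ∈ eigenspace D 1 ↔ D x = x := by
  rw [mem_eigenspace_iff, one_smul]

theorem bracketSpan_le (hD : ∀ x y, D ⁅x, y⁆ = ⁅D x, D y⁆) : bracketSpan D ≤ eigenspace D 1 := by
  refine Submodule.span_le.2 ?_
  rintro _ ⟨x, hx, y, hy, rfl⟩
  rw [mem_eigenspace_neg_one] at hx hy
  rw [SetLike.mem_coe, mem_eigenspace_one, hD, hx, hy]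
  simp

theorem eigenspace_sup_eq_top (hDD : ∀ x, D (D x) = x) :
    eigenspace D (-1) ⊔ eigenspace D 1 = ⊤ := by
  rw [eq_top_iff]
  intro x _
  have e : x = (2 : ℝ)⁻¹ • (x - D x) + (2 : ℝ)⁻¹ • (x + D x) := by
    rw [← smul_add]
    have : x - D x + (x + D x) = (2 : ℝ) • x := by rw [two_smul]; abel
    rw [this, smul_smul]; norm_num
  rw [e]
  refine Submodule.add_mem_sup (Submodule.smul_mem _ _ ?_) (Submodule.smul_mem _ _ ?_)
  · rw [mem_eigenspace_neg_one, map_sub, hDD]; abel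
  · rw [mem_eigenspace_one, map_add, hDD]; abel

/-- Let `V`, `F` be the eigenspaces for `-1`, `1` and `K = [V, V] ⊆ F`. Then `[F, V] ⊆ V`, hence
`[V, K] ⊆ V`, and `[F, K] ⊆ K` by the Jacobi identity; since `V + F` is the whole algebra, `V + K`
is an ideal. -/
theorem lie_mem_sup_bracketSpan (hDD : ∀ x, D (D x) = x) (hD : ∀ x y, D ⁅x, y⁆ = ⁅D x, D y⁆)
    (x y : L) (hy : y ∈ eigenspace D (-1) ⊔ bracketSpan D) :
    ⁅x, y⁆ ∈ eigenspace D (-1) ⊔ bracketSpan D := by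
  have hVV : ∀ {a b}, a ∈ eigenspace D (-1) → b ∈ eigenspace D (-1) → ⁅a, b⁆ ∈ bracketSpan D :=
    fun ha hb => Submodule.subset_span ⟨_, ha, _, hb, rfl⟩
  have hFV : ∀ {a b}, a ∈ eigenspace D 1 → b ∈ eigenspace D (-1) → ⁅a, b⁆ ∈ eigenspace D (-1) := by
    intro a b ha hb
    rw [mem_eigenspace_neg_one] at hb ⊢
    rw [mem_eigenspace_one] at ha
    rw [hD, ha, hb, lie_neg]
  have hFK : ∀ {a b}, a ∈ eigenspace D 1 → b ∈ bracketSpan D → ⁅a, b⁆ ∈ bracketSpan D := by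
    intro a b ha hb
    induction hb using Submodule.span_induction with
    | mem z hz =>
      obtain ⟨u, hu, v, hv, rfl⟩ := hz
      rw [leibniz_lie]
      exact add_mem (hVV (hFV ha hu) hv) (hVV hu (hFV ha hv))
    | zero => rw [lie_zero]; exact zero_mem _
    | add u v _ _ h1 h2 => rw [lie_add]; exact add_mem h1 h2
    | smul c u _ h1 => rw [lie_smul]; exact Submodule.smul_mem _ _ h1
  have hVK : ∀ {a b}, a ∈ eigenspace D (-1) → b ∈ bracketSpan D → ⁅a, b⁆ ∈ eigenspace D (-1) := by
    intro a b ha hb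
    rw [← lie_skew]
    exact neg_mem (hFV (bracketSpan_le hD hb) ha)
  have hx : x ∈ eigenspace D (-1) ⊔ eigenspace D 1 := by
    rw [eigenspace_sup_eq_top hDD]; trivial
  obtain ⟨a, ha, c, hc, rfl⟩ := Submodule.mem_sup.1 hx
  obtain ⟨u, hu, v, hv, rfl⟩ := Submodule.mem_sup.1 hy
  rw [lie_add, add_lie, add_lie]
  refine add_mem (add_mem ?_ ?_) (add_mem ?_ ?_)
  · exact Submodule.mem_sup_right (hVV ha hu)
  · exact Submodule.mem_sup_left (hFV hc hu)
  · exact Submodule.mem_sup_left (hVK ha hv)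
  · exact Submodule.mem_sup_right (hFK hc hv)

theorem sup_bracketSpan_eq_top_iff (hDD : ∀ x, D (D x) = x) (hD : ∀ x y, D ⁅x, y⁆ = ⁅D x, D y⁆) :
    eigenspace D (-1) ⊔ bracketSpan D = ⊤ ↔ eigenspace D 1 = bracketSpan D := by
  constructor
  · intro h
    refine le_antisymm (fun x hx => ?_) (bracketSpan_le hD)
    have hx' : x ∈ eigenspace D (-1) ⊔ bracketSpan D := by rw [h]; trivial
    obtain ⟨v, hv, k, hk, rfl⟩ := Submodule.mem_sup.1 hx'
    rw [mem_eigenspace_one, map_add, mem_eigenspace_one.1 (bracketSpan_le hD hk),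
      mem_eigenspace_neg_one.1 hv] at hx
    have h2 : (2 : ℝ) • v = 0 := by
      rw [two_smul]
      nth_rewrite 1 [← add_right_cancel hx]
      exact neg_add_cancel v
    have : v = 0 := (smul_eq_zero.1 h2).resolve_left two_ne_zero
    rwa [this, zero_add]
  · intro h
    rw [← h, eigenspace_sup_eq_top hDD]

end InvolutionAlgebra

/-! ### Conjugates of the involution in the semidirect product. -/

section SemidirectConjugates

variable {G : Type*} [Group G] {τ : MulAut G}

theorem zpowers_eq_one_or (hτ : τ * τ = 1) (z : Subgroup.zpowers τ) :
    z = 1 ∨ z = ⟨τ, Subgroup.mem_zpowers τ⟩ := by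
  obtain ⟨_, n, rfl⟩ := z
  have h2 : τ ^ (2 : ℤ) = 1 := by rw [zpow_two, hτ]
  rcases Int.even_or_odd' n with ⟨k, rfl | rfl⟩
  · left; ext1; simp [zpow_mul, h2]
  · right; ext1; simp [zpow_add, zpow_mul, h2]

theorem invElt_mul_self (hτ : τ * τ = 1) : invElt τ * invElt τ = 1 := by
  unfold invElt
  rw [← map_mul, ← map_one SemidirectProduct.inr]
  congr 1
  ext1
  exact hτ

theorem invElt_mul_inl (g : G) :
    invElt τ * SemidirectProduct.inl g = SemidirectProduct.inl (τ g) * invElt τ := by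
  ext <;> simp [invElt]

theorem inl_mul_invElt_mul_inv (g : G) :
    SemidirectProduct.inl g * invElt τ * (SemidirectProduct.inl g)⁻¹ =
      SemidirectProduct.inl (g * (τ g)⁻¹) * invElt τ := by
  rw [← map_inv, mul_assoc, invElt_mul_inl, ← mul_assoc, ← map_mul, map_inv]

theorem mem_inl_mul_iff {B : Subgroup G} {y : InvSemidirect τ} :
    y ∈ ((SemidirectProduct.inl : G →* InvSemidirect τ) '' (B : Set G)) * {1, invElt τ} ↔
      ∃ b ∈ B, y = SemidirectProduct.inl b ∨ y = SemidirectProduct.inl b * invElt τ := by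
  constructor
  · rintro ⟨_, ⟨b, hb, rfl⟩, t, ht, rfl⟩
    rcases ht with rfl | rfl
    · exact ⟨b, hb, Or.inl (mul_one _)⟩
    · exact ⟨b, hb, Or.inr rfl⟩
  · rintro ⟨b, hb, rfl | rfl⟩
    · exact ⟨_, ⟨b, hb, rfl⟩, 1, by simp, mul_one _⟩
    · exact ⟨_, ⟨b, hb, rfl⟩, _, by simp, rfl⟩

/-- The subgroup generated by the conjugacy class of the involution. -/
theorem coe_closure_conjugatesOf_invElt (hτ : τ * τ = 1) {B : Subgroup G}
    (hBτ : ∀ b ∈ B, τ b ∈ B) (hcoc : ∀ g, g * (τ g)⁻¹ ∈ B)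
    (hgen : B ≤ Subgroup.closure {x | ∃ g, x = g * (τ g)⁻¹}) :
    (Subgroup.closure (conjugatesOf (invElt τ)) : Set (InvSemidirect τ)) =
      ((SemidirectProduct.inl : G →* InvSemidirect τ) '' (B : Set G)) * {1, invElt τ} := by
  have htt := invElt_mul_self hτ
  have hinv : (invElt τ)⁻¹ = invElt τ := inv_eq_of_mul_eq_one_left htt
  apply Set.Subset.antisymm
  -- Stability of `B` under `τ` makes `B{1, τ}` a subgroup; it contains the conjugates because these
  -- are `g τ(g)⁻¹ · τ`.
  · let M : Subgroup (InvSemidirect τ) :=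
      { carrier := ((SemidirectProduct.inl : G →* InvSemidirect τ) '' (B : Set G)) * {1, invElt τ}
        mul_mem' := by
          intro x y hx hy
          rw [mem_inl_mul_iff] at hx hy ⊢
          obtain ⟨a, ha, rfl | rfl⟩ := hx <;> obtain ⟨b, hb, rfl | rfl⟩ := hy
          · exact ⟨a * b, B.mul_mem ha hb, Or.inl (map_mul _ _ _).symm⟩
          · exact ⟨a * b, B.mul_mem ha hb, Or.inr (by rw [map_mul, mul_assoc])⟩
          · refine ⟨a * τ b, B.mul_mem ha (hBτ _ hb), Or.inr ?_⟩
            rw [mul_assoc, invElt_mul_inl, ← mul_assoc, map_mul]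
          · refine ⟨a * τ b, B.mul_mem ha (hBτ _ hb), Or.inl ?_⟩
            rw [mul_assoc, ← mul_assoc (invElt τ), invElt_mul_inl, mul_assoc _ (invElt τ), htt,
              mul_one, map_mul]
        one_mem' := by
          rw [mem_inl_mul_iff]
          exact ⟨1, B.one_mem, Or.inl (map_one _).symm⟩
        inv_mem' := by
          intro x hx
          rw [mem_inl_mul_iff] at hx ⊢
          obtain ⟨a, ha, rfl | rfl⟩ := hx
          · exact ⟨a⁻¹, B.inv_mem ha, Or.inl (map_inv _ _).symm⟩
          · refine ⟨τ a⁻¹, hBτ _ (B.inv_mem ha), Or.inr ?_⟩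
            rw [mul_inv_rev, hinv, ← map_inv, invElt_mul_inl] }
    change Subgroup.closure (conjugatesOf (invElt τ)) ≤ M
    rw [Subgroup.closure_le]
    intro y hy
    obtain ⟨c, rfl⟩ := isConj_iff.1 (show IsConj (invElt τ) y from hy)
    refine mem_inl_mul_iff.2 ⟨c.left * (τ c.left)⁻¹, hcoc _, Or.inr ?_⟩
    rw [← inl_mul_invElt_mul_inv]
    have hc : c = SemidirectProduct.inl c.left * SemidirectProduct.inr c.right :=
      (SemidirectProduct.inl_left_mul_inr_right c).symm
    have hcomm : (SemidirectProduct.inr c.right : InvSemidirect τ) * invElt τ *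
        (SemidirectProduct.inr c.right)⁻¹ = invElt τ := by
      unfold invElt
      rcases zpowers_eq_one_or hτ c.right with h | h <;> rw [h] <;> simp
    calc c * invElt τ * c⁻¹ = SemidirectProduct.inl c.left * (SemidirectProduct.inr c.right *
          invElt τ * (SemidirectProduct.inr c.right)⁻¹) * (SemidirectProduct.inl c.left)⁻¹ := by
          rw [hc]; simp only [mul_inv_rev, mul_assoc]
          simp
      _ = _ := by rw [hcomm]
  · have ht : invElt τ ∈ Subgroup.closure (conjugatesOf (invElt τ)) :=
      Subgroup.subset_closure mem_conjugatesOf_self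
    have hB : ∀ b ∈ B, (SemidirectProduct.inl b : InvSemidirect τ) ∈
        Subgroup.closure (conjugatesOf (invElt τ)) := by
      intro b hb
      have h1 : Subgroup.closure {x | ∃ g, x = g * (τ g)⁻¹} ≤
          (Subgroup.closure (conjugatesOf (invElt τ))).comap SemidirectProduct.inl := by
        rw [Subgroup.closure_le]
        rintro _ ⟨g, rfl⟩
        have h2 : SemidirectProduct.inl g * invElt τ * (SemidirectProduct.inl g)⁻¹ ∈
            Subgroup.closure (conjugatesOf (invElt τ)) :=
          Subgroup.subset_closure (show IsConj _ _ from isConj_iff.2 ⟨_, rfl⟩)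
        rw [inl_mul_invElt_mul_inv] at h2
        exact (Subgroup.mul_mem_cancel_right _ ht).1 h2
      exact h1 (hgen hb)
    intro y hy
    obtain ⟨b, hb, rfl | rfl⟩ := mem_inl_mul_iff.1 hy
    · exact hB b hb
    · exact Subgroup.mul_mem _ (hB b hb) ht

/-- Only first components are compared, so `τ = 1`, where the cosets of `1` and `τ` coincide, needs
no separate case. -/
theorem closure_eq_top_iff_of_coe_eq (hτ : τ * τ = 1) {B : Subgroup G}
    {N : Subgroup (InvSemidirect τ)}
    (h : (N : Set (InvSemidirect τ)) =
      ((SemidirectProduct.inl : G →* InvSemidirect τ) '' (B : Set G)) * {1, invElt τ}) :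
    N = ⊤ ↔ B = ⊤ := by
  have hmem : ∀ y, y ∈ N ↔ ∃ b ∈ B, y = SemidirectProduct.inl b ∨
      y = SemidirectProduct.inl b * invElt τ := by
    intro y
    rw [← mem_inl_mul_iff, ← h]; rfl
  constructor
  · intro hN
    rw [eq_top_iff]
    intro g _
    have hg : (SemidirectProduct.inl g : InvSemidirect τ) ∈ N := by rw [hN]; trivial
    obtain ⟨b, hb, hgb | hgb⟩ := (hmem _).1 hg
    · rwa [SemidirectProduct.inl_injective hgb]
    · have := congrArg SemidirectProduct.left hgb
      simp [invElt] at this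
      rwa [this]
  · intro hB
    rw [eq_top_iff]
    intro y _
    rw [hmem]
    refine ⟨y.left, by rw [hB]; trivial, ?_⟩
    have hc : y = SemidirectProduct.inl y.left * SemidirectProduct.inr y.right :=
      (SemidirectProduct.inl_left_mul_inr_right y).symm
    rcases zpowers_eq_one_or hτ y.right with hr | hr
    · left; rw [hr, map_one, mul_one] at hc; exact hc
    · right; rw [hr] at hc; exact hc

end SemidirectConjugates

/-! ### Integral subgroups and part (A). -/

section InvolutiveAutomorphisms

open Set Filter Topology

variable {E : Type*} [NormedAddCommGroup E] [NormedSpace ℝ E] [FiniteDimensional ℝ E]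
  {G : Type*} [TopologicalSpace G] [ChartedSpace E G] [Group G] [LieGroup 𝓘(ℝ, E) ∞ G]

/-- The bracket is the derivative of `Ad` along a one-parameter group, and the differential of `C`
intertwines the adjoint actions along `γ` and `C ∘ γ`. -/
theorem diffOne_bracketE (C : MulAut G) (hC : ContMDiff 𝓘(ℝ, E) 𝓘(ℝ, E) ∞ (fun g => C g))
    (x y : E) : diffOne E (fun g => C g) (bracketE G x y) =
      bracketE G (diffOne E (fun g => C g) x) (diffOne E (fun g => C g) y) := by
  have : CompleteSpace E := FiniteDimensional.complete ℝ E
  obtain ⟨γ, hγ⟩ := exists_isOneParam (G := G) x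
  have h1 := (diffOne E (fun g => C g)).hasFDerivAt.comp_hasDerivAt 0 (hasDerivAt_Ad_zero hγ y)
  have h2 := hasDerivAt_Ad_zero (hγ.comp_diffOne C hC) (diffOne E (fun g => C g) y)
  refine h1.unique (h2.congr_of_eventuallyEq (Eventually.of_forall fun t => ?_))
  exact diffOne_Ad C hC _ _

/-- The integral subgroup is generated by one-parameter subgroups. -/
theorem oneParam_mem_integralSubgroup {𝔟 : Submodule ℝ E} {γ : ℝ → G} {x : E}
    (hγ : IsOneParam γ x) (hx : x ∈ 𝔟) (t : ℝ) : γ t ∈ integralSubgroup (E := E) (G := G) 𝔟 := by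
  refine Subgroup.subset_closure ⟨t • x, 𝔟.smul_mem t hx, _, hγ.smul t, ?_⟩
  simp

/-- If `V` generates the `Ad`-invariant subspace `𝔟` under the adjoint action of `⟨exp V⟩`, then
the subgroups generated by `exp V` and by `exp 𝔟` coincide; moreover the Lie algebra of this
subgroup is `𝔟`, and it has a local complement given by one-parameter subgroups in `T`. -/
theorem integralSubgroup_properties {𝔟 V : Submodule ℝ E} {T : Set E}
    (hAd : ∀ g : G, ∀ y ∈ 𝔟, Ad E g y ∈ 𝔟)
    (hspan : Submodule.span ℝ {y | ∃ a ∈ integralSubgroup (E := E) (G := G) V, ∃ v ∈ V,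
      y = Ad E a v} = 𝔟)
    (hT : 𝔟 ⊔ Submodule.span ℝ T = ⊤) :
    integralSubgroup (E := E) (G := G) 𝔟 ≤ integralSubgroup (E := E) (G := G) V ∧
    subgroupLieAlgebra E (integralSubgroup (E := E) (G := G) 𝔟) = (𝔟 : Set E) ∧
    ∃ (m : ℕ) (δ : Fin m → ℝ → G), (∀ j, ∃ z ∈ T, IsOneParam (δ j) (z : E)) ∧
      ∀ᶠ g in 𝓝 (1 : G), ∃ b ∈ integralSubgroup (E := E) (G := G) 𝔟, ∃ t, g = b * oprod δ t := by
  have : CompleteSpace E := FiniteDimensional.complete ℝ E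
  obtain ⟨k, m, b, hS, hb, hbT⟩ := exists_adapted_basis (E := E)
    (S := {y | ∃ a ∈ integralSubgroup (E := E) (G := G) V, ∃ v ∈ V, y = Ad E a v}) (T := T)
    (by rw [Submodule.span_union, hspan, hT])
  rw [hspan] at hb
  -- The one-parameter group of `Ad a v` is the conjugate by `a` of that of `v`. So the factors of
  -- `ψ` lie in `⟨exp V⟩` although their generators form a basis of `𝔟`.
  have hγ' : ∀ i, ∃ γ : ℝ → G, IsOneParam γ (b (Sum.inl i)) ∧
      ∀ t, γ t ∈ integralSubgroup (E := E) (G := G) V := by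
    intro i
    obtain ⟨a, ha, v, hv, he⟩ := hS i
    obtain ⟨γ, hγ⟩ := exists_isOneParam (G := G) v
    refine ⟨fun t => a * γ t * a⁻¹, ?_, fun t => ?_⟩
    · rw [he]; exact hγ.conj a
    · exact Subgroup.mul_mem _ (Subgroup.mul_mem _ ha (oneParam_mem_integralSubgroup hγ hv t))
        (Subgroup.inv_mem _ ha)
  choose γ hγ hγV using hγ'
  choose δ hδ using fun i => exists_isOneParam (G := G) (b (Sum.inr i))
  have hbi : ∀ i, b (Sum.inl i) ∈ 𝔟 := fun i => by
    rw [← hb]; exact Submodule.subset_span ⟨i, rfl⟩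
  have hs := isSplitting_oprod b hγ hδ (by rw [hb]; exact hAd)
  rw [hb] at hs
  have hle : integralSubgroup (E := E) (G := G) 𝔟 ≤ Subgroup.closure (⋃ i, range (γ i)) := by
    refine (Subgroup.closure_le _).2 ?_
    rintro _ ⟨x, hx, η, hη, rfl⟩
    refine hs.one_param_mem hη hx (fun s => oprod_mem (fun i t => ?_) s) 1
    exact Subgroup.subset_closure (mem_iUnion.2 ⟨i, mem_range_self t⟩)
  refine ⟨?_, ?_, m, δ, fun j => ⟨_, hbT j, hδ j⟩, ?_⟩
  · refine hle.trans ((Subgroup.closure_le _).2 (iUnion_subset fun i => ?_))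
    rintro _ ⟨t, rfl⟩
    exact hγV i t
  · apply Subset.antisymm
    · rintro x ⟨η, hη, hmem⟩
      refine hs.mem_of_one_param_mem
        (B := {g | ∃ n, ∃ s : Fin n → Fin k → ℝ, g = oprod (fun _ => oprod γ) s})
        hs.countable_words hη fun t => ?_
      exact mem_closure_iff_oprod hγ (hle (hmem t))
    · intro x hx
      obtain ⟨η, hη⟩ := exists_isOneParam (G := G) x
      exact ⟨η, hη, oneParam_mem_integralSubgroup hη hx⟩
  · filter_upwards [hs.eventually_eq_mul] with g hg
    obtain ⟨s, t, rfl⟩ := hg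
    exact ⟨_, oprod_mem (fun i t => oneParam_mem_integralSubgroup (hγ i) (hbi i) t) s, t, rfl⟩

/-- For `x, y ∈ V` the curve `t ↦ Ad (γ t) y` along the one-parameter group of `x` stays in the
span, and so does its derivative `[x, y]` at `0`. -/
theorem span_Ad_eq {𝔟 V : Submodule ℝ E} (hVb : V ≤ 𝔟)
    (hbV : 𝔟 = V ⊔ Submodule.span ℝ {z | ∃ x ∈ V, ∃ y ∈ V, z = bracketE G x y})
    (hAd : ∀ g : G, ∀ y ∈ 𝔟, Ad E g y ∈ 𝔟) :
    Submodule.span ℝ {y | ∃ a ∈ integralSubgroup (E := E) (G := G) V, ∃ v ∈ V,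
      y = Ad E a v} = 𝔟 := by
  have : CompleteSpace E := FiniteDimensional.complete ℝ E
  set 𝔠 := Submodule.span ℝ {y | ∃ a ∈ integralSubgroup (E := E) (G := G) V, ∃ v ∈ V,
      y = Ad E a v}
  have hV : V ≤ 𝔠 := fun v hv =>
    Submodule.subset_span ⟨1, Subgroup.one_mem _, v, hv, by rw [Ad_one]; rfl⟩
  apply le_antisymm
  · refine Submodule.span_le.2 ?_
    rintro _ ⟨a, -, v, hv, rfl⟩
    exact hAd _ _ (hVb hv)
  · rw [hbV]
    refine sup_le hV (Submodule.span_le.2 ?_)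
    rintro _ ⟨x, hx, y, hy, rfl⟩
    obtain ⟨γ, hγ⟩ := exists_isOneParam (G := G) x
    exact bracketE_mem_of_Ad hγ fun t => by
      exact Submodule.subset_span ⟨_, oneParam_mem_integralSubgroup hγ hx t, y, hy, rfl⟩

theorem IsOneParam.neg_one {γ : ℝ → G} {x : E} (hγ : IsOneParam γ x) :
    IsOneParam (fun t => γ (-1 * t)) (-x : E) := by
  rw [← neg_one_smul ℝ x]
  exact hγ.smul (-1)

theorem integralSubgroup_conj_mem {𝔟 : Submodule ℝ E} (C : MulAut G)
    (hC : ContMDiff 𝓘(ℝ, E) 𝓘(ℝ, E) ∞ (fun g => C g))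
    (h𝔟 : ∀ x ∈ 𝔟, diffOne E (fun g => C g) x ∈ 𝔟) {b : G}
    (hb : b ∈ integralSubgroup (E := E) (G := G) 𝔟) :
    C b ∈ integralSubgroup (E := E) (G := G) 𝔟 := by
  have : integralSubgroup (E := E) (G := G) 𝔟 ≤
      (integralSubgroup (E := E) (G := G) 𝔟).comap C.toMonoidHom := by
    refine (Subgroup.closure_le _).2 ?_
    rintro _ ⟨x, hx, γ, hγ, rfl⟩
    exact oneParam_mem_integralSubgroup (hγ.comp_diffOne C hC) (h𝔟 x hx) 1
  exact this hb

theorem closure_conjugatesOf_invElt_of_ideal [ConnectedSpace G] {τ : MulAut G}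
    (hsm : ContMDiff 𝓘(ℝ, E) 𝓘(ℝ, E) ∞ (fun g : G => τ g)) (hτ : τ * τ = 1)
    {𝔟 V F : Submodule ℝ E} (hVmem : ∀ x : E, x ∈ V ↔ diffOne E (fun g => τ g) x = -x)
    (hFmem : ∀ x : E, x ∈ F ↔ diffOne E (fun g => τ g) x = x) (hVb : V ≤ 𝔟)
    (hbV : 𝔟 = V ⊔ Submodule.span ℝ {z | ∃ x ∈ V, ∃ y ∈ V, z = bracketE G x y})
    (hAd : ∀ g : G, ∀ y ∈ 𝔟, Ad E g y ∈ 𝔟) (hVF : V ⊔ F = ⊤)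
    (h𝔟τ : ∀ x ∈ 𝔟, diffOne E (fun g => τ g) x ∈ 𝔟) :
    subgroupLieAlgebra E (integralSubgroup (E := E) (G := G) 𝔟) = (𝔟 : Set E) ∧
      (Subgroup.closure (conjugatesOf (invElt τ)) : Set (InvSemidirect τ)) =
        ((SemidirectProduct.inl : G →* InvSemidirect τ) ''
          (integralSubgroup (E := E) (G := G) 𝔟 : Set G)) *
          ({1, invElt τ} : Set (InvSemidirect τ)) ∧
      (Subgroup.closure (conjugatesOf (invElt τ)) = ⊤ ↔ 𝔟 = ⊤) := by
  have : CompleteSpace E := FiniteDimensional.complete ℝ E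
  -- The complement of `𝔟` is taken among the fixed vectors of `τ`, so that the transverse factors
  -- `δ j` are fixed by `τ`.
  obtain ⟨hBA, hLie, m, δ, hδ, hnear⟩ := integralSubgroup_properties (G := G) (T := F) hAd
    (span_Ad_eq hVb hbV hAd) (by
      rw [Submodule.span_eq, eq_top_iff, ← hVF]
      exact sup_le_sup_right hVb F)
  set B := integralSubgroup (E := E) (G := G) 𝔟 with hB
  have hBτ : ∀ b ∈ B, τ b ∈ B := fun b hb => integralSubgroup_conj_mem τ hsm h𝔟τ hb
  have hBn : ∀ g : G, ∀ b ∈ B, g * b * g⁻¹ ∈ B := fun g b hb =>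
    integralSubgroup_conj_mem (MulAut.conj g) (contMDiff_conj g) (hAd g) hb
  have hcoc : ∀ g, g * (τ g)⁻¹ ∈ B := by
    let H : Subgroup G :=
      { carrier := {g | g * (τ g)⁻¹ ∈ B}
        mul_mem' := by
          intro a b ha hb
          have h1 := B.mul_mem (hBn a _ hb) ha
          have h2 : a * b * (τ (a * b))⁻¹ = a * (b * (τ b)⁻¹) * a⁻¹ * (a * (τ a)⁻¹) := by
            rw [map_mul]; group
          change a * b * (τ (a * b))⁻¹ ∈ B
          rwa [h2]
        one_mem' := by simp
        inv_mem' := by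
          intro a ha
          have h1 := hBn a⁻¹ _ (B.inv_mem ha)
          have h2 : a⁻¹ * (τ a⁻¹)⁻¹ = a⁻¹ * (a * (τ a)⁻¹)⁻¹ * a⁻¹⁻¹ := by
            rw [map_inv]; group
          change a⁻¹ * (τ a⁻¹)⁻¹ ∈ B
          rwa [h2] }
    have hIG : IsTopologicalGroup G := topologicalGroup_of_lieGroup 𝓘(ℝ, E) ∞
    have hH : H = ⊤ := by
      refine subgroup_eq_top_of_mem_nhds ?_
      filter_upwards [hnear] with g hg
      obtain ⟨b, hb, t, rfl⟩ := hg
      have hfix : τ (oprod δ t) = oprod δ t := by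
        have : ∀ j s, τ (δ j s) = δ j s := by
          intro j s
          obtain ⟨z, hz, hzδ⟩ := hδ j
          have h1 := hzδ.comp_diffOne τ hsm
          rw [(hFmem z).1 hz] at h1
          exact congrFun (h1.unique hzδ) s
        unfold oprod
        rw [map_list_prod, List.map_ofFn]
        congr 2
        funext i
        exact this _ _
      change b * oprod δ t * (τ (b * oprod δ t))⁻¹ ∈ B
      rw [map_mul, hfix, mul_inv_rev, mul_assoc, mul_inv_cancel_left]
      exact B.mul_mem hb (B.inv_mem (hBτ b hb))
    intro g
    have : g ∈ H := hH ▸ Subgroup.mem_top g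
    exact this
  have hgen : B ≤ Subgroup.closure {x | ∃ g, x = g * (τ g)⁻¹} := by
    refine hBA.trans ((Subgroup.closure_le _).2 ?_)
    rintro _ ⟨x, hx, γ, hγ, rfl⟩
    -- Since `τ` inverts `γ`, the element `g = γ (1/2)` satisfies `g τ(g)⁻¹ = γ (1/2) γ (1/2) = γ
    -- 1`.
    refine Subgroup.subset_closure ⟨γ (1 / 2), ?_⟩
    have h1 := hγ.comp_diffOne τ hsm
    rw [(hVmem x).1 hx] at h1
    have h2 := hγ.neg_one
    have h3 : τ (γ (1 / 2)) = γ (-1 * (1 / 2)) := congrFun (h1.unique h2) (1 / 2)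
    rw [h3, neg_one_mul, hγ.map_neg (E := E), inv_inv, ← hγ.1]
    norm_num
  have hclos := coe_closure_conjugatesOf_invElt hτ hBτ hcoc hgen
  refine ⟨hLie, hclos, ?_⟩
  rw [closure_eq_top_iff_of_coe_eq hτ hclos]
  constructor
  · intro htop
    rw [eq_top_iff]
    intro x _
    have hx : (x : E) ∈ subgroupLieAlgebra E B := by
      obtain ⟨γ, hγ⟩ := exists_isOneParam (G := G) x
      exact ⟨γ, hγ, fun t => by rw [htop]; trivial⟩
    rw [hLie] at hx
    exact hx
  · intro h𝔟
    refine eq_top_of_oneParam_mem (E := E) fun x γ hγ => ?_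
    exact oneParam_mem_integralSubgroup hγ (h𝔟 ▸ Submodule.mem_top) 1

theorem mem_antiPart_iff {τ : MulAut G} {x : GroupLieAlgebra 𝓘(ℝ, E) G} :
    x ∈ antiPart E τ ↔ dAut E τ x = -x := by
  unfold antiPart; rw [Module.End.mem_eigenspace_iff, neg_one_smul]

theorem mem_fixedPart_iff {τ : MulAut G} {x : GroupLieAlgebra 𝓘(ℝ, E) G} :
    x ∈ fixedPart E τ ↔ dAut E τ x = x := by
  unfold fixedPart; rw [Module.End.mem_eigenspace_iff, one_smul]

theorem mem_antiPart_iff_diffOne {τ : MulAut G} (hsm : ContMDiff 𝓘(ℝ, E) 𝓘(ℝ, E) ∞ (fun g : G => τ g)) (x : E) :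
    x ∈ (antiPart E τ : Submodule ℝ E) ↔ diffOne E (fun g => τ g) x = -x := by
  refine Iff.trans (mem_antiPart_iff (x := x)) ?_
  have h := dAut_apply τ hsm x
  constructor
  · intro h1; rw [h] at h1; exact h1
  · intro h1; rw [h]; exact h1

theorem mem_fixedPart_iff_diffOne {τ : MulAut G} (hsm : ContMDiff 𝓘(ℝ, E) 𝓘(ℝ, E) ∞ (fun g : G => τ g)) (x : E) :
    x ∈ (fixedPart E τ : Submodule ℝ E) ↔ diffOne E (fun g => τ g) x = x := by
  refine Iff.trans (mem_fixedPart_iff (x := x)) ?_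
  have h := dAut_apply τ hsm x
  constructor
  · intro h1; rw [h] at h1; exact h1
  · intro h1; rw [h]; exact h1

theorem involutive_automorphism_subgroup [ConnectedSpace G] {τ : MulAut G}
    (hsm : ContMDiff 𝓘(ℝ, E) 𝓘(ℝ, E) ∞ (fun g : G => τ g)) (hτ : τ * τ = 1) :
    (∀ x : GroupLieAlgebra 𝓘(ℝ, E) G, ∀ y ∈ bPart E τ, ⁅x, y⁆ ∈ bPart E τ) ∧
      subgroupLieAlgebra E (integralSubgroup (bPart E τ)) =
        (bPart E τ : Set (GroupLieAlgebra 𝓘(ℝ, E) G)) ∧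
      (Subgroup.closure (conjugatesOf (invElt τ)) : Set (InvSemidirect τ)) =
        ((SemidirectProduct.inl : G →* InvSemidirect τ) ''
          (integralSubgroup (bPart E τ) : Set G)) *
          ({1, invElt τ} : Set (InvSemidirect τ)) ∧
      (Subgroup.closure (conjugatesOf (invElt τ)) = ⊤ ↔ fixedPart E τ = antiBracket E τ) := by
  have : CompleteSpace E := FiniteDimensional.complete ℝ E
  have := lieGroup_minSmoothness E G
  have hττ : ∀ g, τ (τ g) = g := fun g => congrArg (fun f : MulAut G => f g) hτ
  have hDapp : ∀ x, dAut E τ x = diffOne E (fun g => τ g) x := dAut_apply τ hsm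
  have hDD : ∀ x, dAut E τ (dAut E τ x) = x := by
    intro x
    rw [hDapp, hDapp]
    have h1 := diffOne_comp hsm (map_one τ) hsm (map_one τ)
    simp only [hττ, diffOne_id] at h1
    exact (congrArg (fun L : E →L[ℝ] E => L x) h1).symm
  have hD : ∀ x y : GroupLieAlgebra 𝓘(ℝ, E) G, dAut E τ ⁅x, y⁆ = ⁅dAut E τ x, dAut E τ y⁆ := by
    intro x y
    rw [hDapp, hDapp, hDapp]
    exact diffOne_bracketE τ hsm x y
  have hideal : ∀ x : GroupLieAlgebra 𝓘(ℝ, E) G, ∀ y ∈ bPart E τ, ⁅x, y⁆ ∈ bPart E τ :=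
    lie_mem_sup_bracketSpan hDD hD
  let 𝔟 : Submodule ℝ E := bPart E τ
  let V : Submodule ℝ E := antiPart E τ
  let F : Submodule ℝ E := fixedPart E τ
  have hVmem := fun x => mem_antiPart_iff_diffOne hsm x
  have hFmem := fun x => mem_fixedPart_iff_diffOne hsm x
  let K : Submodule ℝ E := antiBracket E τ
  have hVb : V ≤ 𝔟 := (show antiPart E τ ≤ bPart E τ from le_sup_left)
  have hKb : K ≤ 𝔟 := (show antiBracket E τ ≤ bPart E τ from le_sup_right)
  have hAd : ∀ g : G, ∀ y ∈ 𝔟, Ad E g y ∈ 𝔟 := fun g y hy =>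
    Ad_mem_of_ideal (E := E) (𝔟 := 𝔟) hideal g hy
  have h𝔟τ : ∀ x ∈ 𝔟, diffOne E (fun g => τ g) x ∈ 𝔟 := by
    intro x hx
    obtain ⟨v, hv, k, hk, rfl⟩ : ∃ v : E, v ∈ V ∧ ∃ k : E, k ∈ K ∧ v + k = x :=
      Submodule.mem_sup.1 hx
    have hv' : diffOne E (fun g => τ g) v = -v := (hVmem v).1 hv
    have hk' : diffOne E (fun g => τ g) k = k := (hFmem k).1 (bracketSpan_le hD hk)
    rw [map_add, hv', hk']
    exact 𝔟.add_mem (𝔟.neg_mem (hVb hv)) (hKb hk)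
  obtain ⟨hLie, hclos, hiff⟩ := closure_conjugatesOf_invElt_of_ideal hsm hτ hVmem hFmem hVb rfl
    hAd (eigenspace_sup_eq_top hDD) h𝔟τ
  exact ⟨hideal, hLie, hclos, hiff.trans (sup_bracketSpan_eq_top_iff hDD hD)⟩

end InvolutiveAutomorphisms

/-! ### Reflections and the Cartan–Dieudonné theorem. -/

section Reflections

variable {V : Type*} [AddCommGroup V] [Module ℝ V] (B : LinearMap.BilinForm ℝ V)

/-- The isometry group of a bilinear form. -/
def isometries : Subgroup (V ≃ₗ[ℝ] V) where
  carrier := {g | ∀ x y, B (g x) (g y) = B x y}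
  mul_mem' := fun {a b} ha hb x y => (ha (b x) (b y)).trans (hb x y)
  one_mem' := fun _ _ => rfl
  inv_mem' := by
    intro a ha x y
    have h := ha (a⁻¹ x) (a⁻¹ y)
    rw [← LinearEquiv.mul_apply, ← LinearEquiv.mul_apply, mul_inv_cancel] at h
    exact h.symm

/-- The isometries of determinant one. -/
def properIsometries : Subgroup (V ≃ₗ[ℝ] V) := isometries B ⊓ LinearEquiv.det.ker

/-- The reflection in the hyperplane orthogonal to `a`; it is the identity if `a` is isotropic. -/
def refl (a : V) : V ≃ₗ[ℝ] V :=
  LinearEquiv.ofInvolutive (LinearMap.id - ((2 / B a a) • B a).smulRight a) (by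
    intro x
    by_cases h : B a a = 0
    · simp [h]
    · simp only [LinearMap.sub_apply, LinearMap.id_apply, LinearMap.smulRight_apply,
        LinearMap.smul_apply, map_sub, map_smul, smul_eq_mul]
      rw [div_mul_cancel₀ _ h, two_smul, sub_add_cancel_left, smul_neg]
      abel)

variable {B}

theorem refl_apply (a x : V) : refl B a x = x - (2 / B a a * B a x) • a := rfl

theorem refl_mul_self (a : V) : refl B a * refl B a = 1 := by
  ext x
  exact LinearEquiv.symm_apply_apply (refl B a) x

theorem refl_inv (a : V) : (refl B a)⁻¹ = refl B a := inv_eq_of_mul_eq_one_left (refl_mul_self a)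

theorem refl_apply_self {a : V} (h : B a a ≠ 0) : refl B a a = -a := by
  rw [refl_apply, div_mul_cancel₀ _ h, two_smul]
  abel

theorem refl_apply_of_orthogonal {a x : V} (h : B a x = 0) : refl B a x = x := by
  simp [refl_apply, h]

theorem refl_smul (a : V) {c : ℝ} (hc : c ≠ 0) : refl B (c • a) = refl B a := by
  ext x
  simp only [refl_apply, map_smul, LinearMap.smul_apply, smul_eq_mul, smul_smul]
  congr 2
  by_cases h : B a a = 0
  · simp [h]
  · field_simp

theorem refl_neg_form (a : V) : refl (-B) a = refl B a := by
  ext x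
  simp [refl_apply, div_neg]

theorem isometries_neg : isometries (-B) = isometries B := by
  ext g
  change (∀ x y, -B (g x) (g y) = -B x y) ↔ ∀ x y, B (g x) (g y) = B x y
  simp only [neg_inj]

theorem properIsometries_neg : properIsometries (-B) = properIsometries B := by
  unfold properIsometries; rw [isometries_neg]

theorem refl_mem (hB : ∀ x y, B x y = B y x) (a : V) : refl B a ∈ isometries B := by
  intro x y
  by_cases h : B a a = 0
  · simp [refl_apply, h]
  · simp only [refl_apply, map_sub, map_smul, LinearMap.sub_apply, LinearMap.smul_apply,
      smul_eq_mul]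
    rw [hB x a]
    field_simp
    ring

theorem conj_refl {g : V ≃ₗ[ℝ] V} (hg : g ∈ isometries B) (a : V) :
    g * refl B a * g⁻¹ = refl B (g a) := by
  rw [mul_inv_eq_iff_eq_mul]
  ext x
  simp only [LinearEquiv.mul_apply, refl_apply, map_sub, map_smul]
  rw [hg a a, hg a x]

theorem refl_comm (hB : ∀ x y, B x y = B y x) {a b : V} (h : B a b = 0) :
    refl B a * refl B b = refl B b * refl B a := by
  have := conj_refl (refl_mem hB a) b
  rwa [refl_apply_of_orthogonal h, mul_inv_eq_iff_eq_mul] at this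

theorem det_refl [FiniteDimensional ℝ V] {a : V} (h : B a a ≠ 0) :
    LinearEquiv.det (refl B a) = -1 := by
  ext
  rw [LinearEquiv.coe_det]
  have h1 : ((refl B a : V ≃ₗ[ℝ] V) : V →ₗ[ℝ] V) =
      LinearMap.transvection (-(2 / B a a) • B a) a := by
    ext x
    simp [refl_apply, LinearMap.transvection.apply, sub_eq_add_neg]
  rw [h1, LinearMap.transvection.det]
  simp only [LinearMap.smul_apply, smul_eq_mul, Units.val_neg, Units.val_one]
  field_simp
  norm_num

/-- A vector can be moved by reflections to any other one of the same nonzero length, in such a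
way that everything orthogonal to both is fixed. -/
theorem exists_mem_closure_refl (hB : ∀ x y, B x y = B y x) {x y : V} (hxy : B x x = B y y)
    (hx : B x x ≠ 0) : ∃ g ∈ Subgroup.closure {s | ∃ a, B a a ≠ 0 ∧ s = refl B a},
      g x = y ∧ ∀ z, B x z = 0 → B y z = 0 → g z = z := by
  by_cases h : B (x - y) (x - y) = 0
  -- The lengths of `x + y` and `x - y` add up to `4 B x x ≠ 0`, so not both vectors are isotropic.
  -- If `x - y` is, then `s_{x+y}` sends `x` to `-y` and `s_y` corrects the sign.
  · have h' : B (x + y) (x + y) ≠ 0 := by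
      simp only [map_sub, map_add, LinearMap.sub_apply, LinearMap.add_apply] at h ⊢
      rw [hB y x] at *
      intro h2
      apply hx
      linarith
    refine ⟨refl B y * refl B (x + y), Subgroup.mul_mem _
      (Subgroup.subset_closure ⟨y, hxy ▸ hx, rfl⟩) (Subgroup.subset_closure ⟨_, h', rfl⟩), ?_, ?_⟩
    · have h1 : refl B (x + y) x = -y := by
        have h3 : B (x + y) (x + y) = 2 * B (x + y) x := by
          simp only [map_add, LinearMap.add_apply]
          rw [hB y x]; linarith
        rw [refl_apply, div_mul_eq_mul_div, ← h3, div_self h', one_smul]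
        abel
      rw [LinearEquiv.mul_apply, h1, map_neg, refl_apply_self (hxy ▸ hx), neg_neg]
    · intro z hz hz'
      rw [LinearEquiv.mul_apply, refl_apply_of_orthogonal (a := x + y) (by simp [hz, hz']),
        refl_apply_of_orthogonal hz']
  · refine ⟨refl B (x - y), Subgroup.subset_closure ⟨_, h, rfl⟩, ?_, ?_⟩
    · have h3 : B (x - y) (x - y) = 2 * B (x - y) x := by
        simp only [map_sub, LinearMap.sub_apply]
        rw [hB y x]; linarith
      rw [refl_apply, div_mul_eq_mul_div, ← h3, div_self h, one_smul]
      abel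
    · intro z hz hz'
      exact refl_apply_of_orthogonal (by simp [hz, hz'])

theorem closure_refl_le (hB : ∀ x y, B x y = B y x) :
    Subgroup.closure {s | ∃ a, B a a ≠ 0 ∧ s = refl B a} ≤ isometries B := by
  refine (Subgroup.closure_le _).2 ?_
  rintro _ ⟨a, -, rfl⟩
  exact refl_mem hB a

/-- The isometry group of a nondegenerate form is generated by reflections. -/
theorem isometries_le_closure_refl (hB : ∀ x y, B x y = B y x) {n : ℕ}
    (e : Module.Basis (Fin n) ℝ V) (he : ∀ i j, i ≠ j → B (e i) (e j) = 0)
    (hne : ∀ i, B (e i) (e i) ≠ 0) :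
    isometries B ≤ Subgroup.closure {s | ∃ a, B a a ≠ 0 ∧ s = refl B a} := by
  -- Induction on the number `m` of basis vectors not yet known to be fixed. The correcting element
  -- fixes the earlier ones, as they are orthogonal both to `e k` and to its image.
  have key : ∀ m k, k + m = n → ∀ g ∈ isometries B, (∀ i : Fin n, i.val < k → g (e i) = e i) →
      g ∈ Subgroup.closure {s | ∃ a, B a a ≠ 0 ∧ s = refl B a} := by
    intro m
    induction m with
    | zero =>
      intro k hk g hg h
      have : g = 1 := by
        refine LinearEquiv.toLinearMap_injective (e.ext fun i => ?_)
        exact h i (by omega)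
      rw [this]
      exact Subgroup.one_mem _
    | succ m ih =>
      intro k hk g hg h
      obtain ⟨s, hs, hse, hsf⟩ := exists_mem_closure_refl hB (x := g (e ⟨k, by omega⟩))
        (y := e ⟨k, by omega⟩) (hg _ _) (by rw [hg]; exact hne _)
      have h1 := ih (k + 1) (by omega) (s * g)
        (Subgroup.mul_mem _ (closure_refl_le hB hs) hg) (by
          intro i hi
          rcases Nat.lt_succ_iff_lt_or_eq.1 hi with hi | hi
          · rw [LinearEquiv.mul_apply, h i hi]
            have hik : (⟨k, by omega⟩ : Fin n) ≠ i := fun hh => by simp [← hh] at hi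
            refine hsf _ ?_ (he _ _ hik)
            rw [← h i hi, hg]
            exact he _ _ hik
          · have : i = ⟨k, by omega⟩ := Fin.ext hi
            rw [LinearEquiv.mul_apply, this, hse])
      exact (Subgroup.mul_mem_cancel_left _ hs).1 h1
  intro g hg
  exact key n 0 (by omega) g hg (by simp)

end Reflections

/-! ### Orthogonal vectors of prescribed sign, and products of two reflections. -/

section Generation

variable {V : Type*} [AddCommGroup V] [Module ℝ V] {B : LinearMap.BilinForm ℝ V}

/-- Projecting along the negative vector `v` only increases lengths, so the plane of `p` and `q`
stays positive. Orthogonality to `v'` is one linear condition on a plane and has a nonzero solution;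
this is where two positive directions are needed. -/
theorem exists_pos_orthogonal (hB : ∀ x y, B x y = B y x) {p q v v' : V} (hp : 0 < B p p)
    (hq : 0 < B q q) (hpq : B p q = 0) (hv : B v v < 0) :
    ∃ u, 0 < B u u ∧ B u v = 0 ∧ B u v' = 0 := by
  have hlen : ∀ x, 0 < B x x → 0 < B (x - (B x v / B v v) • v) (x - (B x v / B v v) • v) := by
    intro x hx
    have : B (x - (B x v / B v v) • v) (x - (B x v / B v v) • v) =
        B x x + (B x v) ^ 2 / -B v v := by
      simp only [map_sub, map_smul, LinearMap.sub_apply, LinearMap.smul_apply, smul_eq_mul]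
      rw [hB v x]
      have := hv.ne
      field_simp
      ring
    rw [this]
    have : 0 ≤ (B x v) ^ 2 / -B v v := div_nonneg (sq_nonneg _) (by linarith)
    linarith
  have horth : ∀ x, B (x - (B x v / B v v) • v) v = 0 := by
    intro x
    simp only [map_sub, map_smul, LinearMap.sub_apply, LinearMap.smul_apply, smul_eq_mul]
    rw [div_mul_cancel₀ _ hv.ne, sub_self]
  set f : V →ₗ[ℝ] ℝ := LinearMap.flip B v' - (B v v' / B v v) • LinearMap.flip B v with hf
  have hfx : ∀ x, B (x - (B x v / B v v) • v) v' = f x := by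
    intro x
    simp only [hf, map_sub, map_smul, LinearMap.sub_apply, LinearMap.smul_apply, smul_eq_mul,
      LinearMap.flip_apply]
    ring
  by_cases h0 : f p = 0
  · exact ⟨_, hlen p hp, horth p, by rw [hfx, h0]⟩
  · refine ⟨_, hlen (f p • q - f q • p) ?_, horth _, ?_⟩
    · have : B (f p • q - f q • p) (f p • q - f q • p) =
          f p ^ 2 * B q q + f q ^ 2 * B p p := by
        simp only [map_sub, map_smul, LinearMap.sub_apply, LinearMap.smul_apply, smul_eq_mul]
        rw [hB q p, hpq]
        ring
      rw [this]
      have : 0 ≤ f q ^ 2 * B p p := by positivity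
      have : 0 < f p ^ 2 * B q q := by positivity
      linarith
    · rw [hfx]
      simp only [map_sub, map_smul, smul_eq_mul]
      ring

theorem exists_neg_orthogonal (hB : ∀ x y, B x y = B y x) {q u : V} (hq : B q q < 0)
    (hu : 0 < B u u) : ∃ v, B v v < 0 ∧ B u v = 0 := by
  refine ⟨q - (B q u / B u u) • u, ?_, ?_⟩
  · have : B (q - (B q u / B u u) • u) (q - (B q u / B u u) • u) =
        B q q - (B q u) ^ 2 / B u u := by
      simp only [map_sub, map_smul, LinearMap.sub_apply, LinearMap.smul_apply, smul_eq_mul]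
      rw [hB u q]
      field_simp
      ring
    rw [this]
    have : 0 ≤ (B q u) ^ 2 / B u u := by positivity
    linarith
  · simp only [map_sub, map_smul, smul_eq_mul]
    rw [div_mul_cancel₀ _ hu.ne', hB, sub_self]

theorem det_isometry (hB : ∀ x y, B x y = B y x) {n : ℕ} (e : Module.Basis (Fin n) ℝ V)
    (he : ∀ i j, i ≠ j → B (e i) (e j) = 0) (hne : ∀ i, B (e i) (e i) ≠ 0) {g : V ≃ₗ[ℝ] V}
    (hg : g ∈ isometries B) :
    LinearEquiv.det g = 1 ∨ LinearEquiv.det g = -1 := by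
  have : FiniteDimensional ℝ V := e.finiteDimensional_of_finite
  have h : Subgroup.closure {s | ∃ a, B a a ≠ 0 ∧ s = refl B a} ≤
      ((powMonoidHom 2).comp (LinearEquiv.det (R := ℝ) (M := V))).ker := by
    refine (Subgroup.closure_le _).2 ?_
    rintro _ ⟨a, ha, rfl⟩
    simp [MonoidHom.mem_ker, det_refl ha]
  have h2 := h (isometries_le_closure_refl hB e he hne hg)
  have h3 : LinearEquiv.det g ^ 2 = 1 := h2
  have h4 : ((LinearEquiv.det g : ℝˣ) : ℝ) ^ 2 = 1 := by rw [← Units.val_pow_eq_pow_val, h3]; rfl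
  rcases sq_eq_one_iff.1 h4 with h | h
  · left; ext; simpa using h
  · right; ext; simpa using h

theorem det_refl_mul_refl [FiniteDimensional ℝ V] {a b : V} (ha : B a a ≠ 0) (hb : B b b ≠ 0) :
    LinearEquiv.det (refl B a * refl B b) = 1 := by
  rw [map_mul, det_refl ha, det_refl hb]
  norm_num

theorem refl_mul_refl_mem [FiniteDimensional ℝ V] (hB : ∀ x y, B x y = B y x) {a b : V}
    (ha : B a a ≠ 0) (hb : B b b ≠ 0) : refl B a * refl B b ∈ properIsometries B :=
  ⟨Subgroup.mul_mem _ (refl_mem hB a) (refl_mem hB b), det_refl_mul_refl ha hb⟩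

/-- A subgroup of the proper isometry group that contains all products of two reflections is the
whole proper isometry group. -/
theorem properIsometries_le_of_refl_mul_refl_mem (hB : ∀ x y, B x y = B y x) {n : ℕ}
    (e : Module.Basis (Fin n) ℝ V) (he : ∀ i j, i ≠ j → B (e i) (e j) = 0)
    (hne : ∀ i, B (e i) (e i) ≠ 0) {a₀ : V} (ha₀ : B a₀ a₀ ≠ 0) {N : Subgroup (V ≃ₗ[ℝ] V)}
    (hN : N ≤ properIsometries B)
    (hab : ∀ a b, B a a ≠ 0 → B b b ≠ 0 → refl B a * refl B b ∈ N) :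
    properIsometries B ≤ N := by
  have : FiniteDimensional ℝ V := e.finiteDimensional_of_finite
  intro g hg
  have hg1 := isometries_le_closure_refl hB e he hne hg.1
  -- Words in reflections are followed by parity, with the fixed reflection `refl B a₀` marking odd
  -- length; the determinant then excludes the odd case.
  have key : g ∈ N ∨ g * refl B a₀ ∈ N := by
    have step : ∀ (x : V ≃ₗ[ℝ] V) (a : V), B a a ≠ 0 → (x ∈ N ∨ x * refl B a₀ ∈ N) →
        x * refl B a ∈ N ∨ x * refl B a * refl B a₀ ∈ N := by
      rintro x a ha (h | h)
      · right
        rw [mul_assoc]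
        exact N.mul_mem h (hab a a₀ ha ha₀)
      · left
        have h2 := N.mul_mem h (hab a₀ a ha₀ ha)
        rwa [mul_assoc, ← mul_assoc (refl B a₀), refl_mul_self, one_mul] at h2
    clear hg
    induction hg1 using Subgroup.closure_induction_right with
    | one => exact Or.inl N.one_mem
    | mul_right x hx y hy ih =>
      obtain ⟨a, ha, rfl⟩ := hy
      exact step x a ha ih
    | mul_inv_cancel x hx y hy ih =>
      obtain ⟨a, ha, rfl⟩ := hy
      rw [refl_inv]
      exact step x a ha ih
  rcases key with h | h
  · exact h
  · exfalso
    have h1 : LinearEquiv.det (g * refl B a₀) = 1 := (hN h).2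
    have h2 : LinearEquiv.det g = 1 := hg.2
    rw [map_mul, h2, det_refl ha₀, one_mul] at h1
    have h3 := congrArg Units.val h1
    norm_num at h3

/-- All pairs of orthogonal vectors of the given lengths give conjugate products. -/
theorem exists_isometry_pair (hB : ∀ x y, B x y = B y x) {u₀ v₀ u v : V} (hu₀ : 0 < B u₀ u₀)
    (hv₀ : B v₀ v₀ < 0) (h₀ : B u₀ v₀ = 0) (hu : 0 < B u u) (hv : B v v < 0) (h : B u v = 0) :
    ∃ g ∈ isometries B, refl B (g u₀) = refl B u ∧ refl B (g v₀) = refl B v := by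
  set c := √(B u₀ u₀ / B u u) with hc
  set d := √(B v₀ v₀ / B v v) with hd
  have hcp : 0 < c := Real.sqrt_pos.2 (div_pos hu₀ hu)
  have hdp : 0 < d := Real.sqrt_pos.2 (div_pos_of_neg_of_neg hv₀ hv)
  have hc2 : c * c * B u u = B u₀ u₀ := by
    rw [hc, Real.mul_self_sqrt (div_pos hu₀ hu).le, div_mul_cancel₀ _ hu.ne']
  have hd2 : d * d * B v v = B v₀ v₀ := by
    rw [hd, Real.mul_self_sqrt (div_pos_of_neg_of_neg hv₀ hv).le, div_mul_cancel₀ _ hv.ne]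
  obtain ⟨g₁, hg₁, hgu, -⟩ := exists_mem_closure_refl hB (x := u₀) (y := c • u)
    (by simp only [map_smul, LinearMap.smul_apply, smul_eq_mul]; rw [← hc2]; ring) hu₀.ne'
  have hg₁' := closure_refl_le hB hg₁
  -- The second move fixes `c • u`, which is orthogonal to `g₁ v₀` and to `d • v`, and so does not
  -- undo the first.
  obtain ⟨g₂, hg₂, hgv, hfix⟩ := exists_mem_closure_refl hB (x := g₁ v₀) (y := d • v)
    (by rw [hg₁']; simp only [map_smul, LinearMap.smul_apply, smul_eq_mul]; rw [← hd2]; ring)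
    (by rw [hg₁']; exact hv₀.ne)
  refine ⟨g₂ * g₁, Subgroup.mul_mem _ (closure_refl_le hB hg₂) hg₁', ?_, ?_⟩
  · rw [LinearEquiv.mul_apply, hgu, hfix, refl_smul _ hcp.ne']
    · rw [← hgu, hg₁', hB, h₀]
    · simp only [map_smul, LinearMap.smul_apply, smul_eq_mul]
      rw [hB, h]; ring
  · rw [LinearEquiv.mul_apply, hgv, refl_smul _ hdp.ne']

end Generation

/-! ### Generation of the proper isometry group by conjugates of a signed pair of reflections. -/

section ConjugatesOfReflectionPairs

variable {V : Type*} [AddCommGroup V] [Module ℝ V] {B : LinearMap.BilinForm ℝ V}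

/-- For negative `v`, `v'` take a positive `u` orthogonal to both: in the quotient of `c s_u s_v`
and `c s_u s_{v'}` both `c` and `s_u` cancel. For positive `u`, `u'`, take negative vectors
orthogonal to each and link them by the negative pair just obtained. -/
theorem refl_mul_refl_mem_of_same_sign (hB : ∀ x y, B x y = B y x) {p q k : V} (hp : 0 < B p p)
    (hq : 0 < B q q) (hpq : B p q = 0) (hk : B k k < 0) {c : V ≃ₗ[ℝ] V}
    (hc : ∀ x, c * x = x * c) {N : Subgroup (V ≃ₗ[ℝ] V)}
    (hN : ∀ u v, 0 < B u u → B v v < 0 → B u v = 0 → c * (refl B u * refl B v) ∈ N) :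
    (∀ v v', B v v < 0 → B v' v' < 0 → refl B v * refl B v' ∈ N) ∧
      (∀ u u', 0 < B u u → 0 < B u' u' → refl B u * refl B u' ∈ N) := by
  have h1 : ∀ v v', B v v < 0 → B v' v' < 0 → refl B v * refl B v' ∈ N := by
    intro v v' hv hv'
    obtain ⟨u, hu, huv, huv'⟩ := exists_pos_orthogonal hB (v' := v') hp hq hpq hv
    have h := N.mul_mem (N.inv_mem (hN u v hu hv huv)) (hN u v' hu hv' huv')
    rwa [mul_inv_rev, mul_inv_rev, mul_assoc, inv_mul_cancel_left, mul_assoc,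
      inv_mul_cancel_left, refl_inv] at h
  refine ⟨h1, fun u u' hu hu' => ?_⟩
  obtain ⟨v, hv, huv⟩ := exists_neg_orthogonal hB hk hu
  obtain ⟨v', hv', huv'⟩ := exists_neg_orthogonal hB hk hu'
  have h := N.mul_mem (N.mul_mem (hN u v hu hv huv) (h1 v v' hv hv'))
    (N.inv_mem (hN u' v' hu' hv' huv'))
  have h2 : c * (refl B u * refl B v) * (refl B v * refl B v') *
      (c * (refl B u' * refl B v'))⁻¹ = refl B u * refl B u' := by
    simp only [mul_inv_rev, refl_inv, mul_assoc]
    rw [← mul_assoc (refl B v) (refl B v), refl_mul_self, one_mul,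
      ← mul_assoc (refl B v') (refl B v'), refl_mul_self, one_mul, ← mul_assoc (refl B u),
      ← mul_assoc c, hc, mul_assoc, mul_inv_cancel, mul_one]
  rwa [h2] at h

/-- If exactly two basis vectors are positive, `-1` is a product of pairs of reflections of the
same sign, provided that its determinant is `1`. -/
theorem neg_mem_of_refl_mul_refl_mem {n : ℕ}
    (e : Module.Basis (Fin n) ℝ V) (he : ∀ i j, i ≠ j → B (e i) (e j) = 0)
    (hne : ∀ i, B (e i) (e i) ≠ 0) {i₀ i₁ k : Fin n} (hi : i₀ ≠ i₁)
    (h₀ : 0 < B (e i₀) (e i₀)) (h₁ : 0 < B (e i₁) (e i₁)) (hk : B (e k) (e k) < 0)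
    (htwo : ∀ i, 0 < B (e i) (e i) → i = i₀ ∨ i = i₁)
    (hdet : LinearEquiv.det (LinearEquiv.neg ℝ : V ≃ₗ[ℝ] V) = 1)
    {N : Subgroup (V ≃ₗ[ℝ] V)} (hN : N ≤ properIsometries B)
    (hneg : ∀ v v', B v v < 0 → B v' v' < 0 → refl B v * refl B v' ∈ N)
    (hpos : ∀ u u', 0 < B u u → 0 < B u' u' → refl B u * refl B u' ∈ N) :
    (LinearEquiv.neg ℝ : V ≃ₗ[ℝ] V) ∈ N := by
  have : FiniteDimensional ℝ V := e.finiteDimensional_of_finite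
  -- Sign changes on negative basis vectors lie in `N` up to one factor `s_{e k}`, which records the
  -- parity of `S`. Adding the two positive sign changes gives `-1`, and its determinant `1` forces
  -- even parity.
  have flip : ∀ S : Finset (Fin n), (∀ i ∈ S, B (e i) (e i) < 0) → ∃ g : V ≃ₗ[ℝ] V,
      (∀ i ∈ S, g (e i) = -e i) ∧ (∀ i ∉ S, g (e i) = e i) ∧ (g ∈ N ∨ g * refl B (e k) ∈ N) := by
    intro S
    induction S using Finset.induction_on with
    | empty => exact fun _ => ⟨1, by simp, fun _ _ => rfl, Or.inl N.one_mem⟩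
    | insert j S hj ih =>
      intro hS
      obtain ⟨g, hg, hg', hgN⟩ := ih fun i hi => hS i (Finset.mem_insert_of_mem hi)
      have hjn := hS j (Finset.mem_insert_self j S)
      refine ⟨g * refl B (e j), ?_, ?_, ?_⟩
      · intro i hi
        rw [LinearEquiv.mul_apply]
        rcases Finset.mem_insert.1 hi with rfl | hi
        · rw [refl_apply_self hjn.ne, map_neg, hg' _ hj]
        · rw [refl_apply_of_orthogonal (he j i fun h => hj (h.symm ▸ hi)), hg i hi]
      · intro i hi
        rw [Finset.mem_insert, not_or] at hi
        rw [LinearEquiv.mul_apply, refl_apply_of_orthogonal (he _ _ (Ne.symm hi.1)), hg' i hi.2]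
      · rcases hgN with h | h
        · right
          rw [mul_assoc]
          exact N.mul_mem h (hneg _ _ hjn hk)
        · left
          have h2 := N.mul_mem h (hneg _ _ hk hjn)
          rwa [mul_assoc, ← mul_assoc (refl B (e k)), refl_mul_self, one_mul] at h2
  obtain ⟨g, hg, hg', hgN⟩ := flip ({i₀, i₁}ᶜ) (by
    intro i hi
    refine (hne i).lt_or_gt.resolve_right fun h => ?_
    rw [Finset.mem_compl, Finset.mem_insert, Finset.mem_singleton] at hi
    exact hi (htwo i h))
  have hgneg : (LinearEquiv.neg ℝ : V ≃ₗ[ℝ] V) = g * (refl B (e i₀) * refl B (e i₁)) := by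
    refine LinearEquiv.toLinearMap_injective (e.ext fun i => ?_)
    change -e i = g (refl B (e i₀) (refl B (e i₁) (e i)))
    by_cases h1 : i = i₁
    · rw [h1, refl_apply_self h₁.ne', map_neg, refl_apply_of_orthogonal (he _ _ hi), map_neg,
        hg' _ (by simp)]
    · rw [refl_apply_of_orthogonal (a := e i₁) (he _ _ (Ne.symm h1))]
      by_cases h2 : i = i₀
      · rw [h2, refl_apply_self h₀.ne', map_neg, hg' _ (by simp)]
      · rw [refl_apply_of_orthogonal (he _ _ (Ne.symm h2)), hg _ (by simp [h1, h2])]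
  rcases hgN with h | h
  · rw [hgneg]
    exact N.mul_mem h (hpos _ _ h₀ h₁)
  · exfalso
    have h1 : LinearEquiv.det (g * refl B (e k)) = 1 := (hN h).2
    rw [hgneg, map_mul, det_refl_mul_refl h₀.ne' h₁.ne', mul_one] at hdet
    rw [map_mul, hdet, det_refl hk.ne, one_mul] at h1
    have h3 := congrArg Units.val h1
    norm_num at h3

/-- The conjugates of `± s_u s_v`, with `u` positive and `v` negative and orthogonal to `u`,
generate the proper isometry group of an indefinite form with at least two positive directions;
for the sign `-` exactly two positive directions are required. -/
theorem properIsometries_le_closure (hB : ∀ x y, B x y = B y x) {n : ℕ}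
    (e : Module.Basis (Fin n) ℝ V) (he : ∀ i j, i ≠ j → B (e i) (e j) = 0)
    (hne : ∀ i, B (e i) (e i) ≠ 0) {i₀ i₁ k : Fin n} (hi : i₀ ≠ i₁)
    (h₀ : 0 < B (e i₀) (e i₀)) (h₁ : 0 < B (e i₁) (e i₁)) (hk : B (e k) (e k) < 0)
    {u₀ v₀ : V} (hu₀ : 0 < B u₀ u₀) (hv₀ : B v₀ v₀ < 0) (huv₀ : B u₀ v₀ = 0) {c : V ≃ₗ[ℝ] V}
    (hc : c = 1 ∨ c = LinearEquiv.neg ℝ ∧ ∀ i, 0 < B (e i) (e i) → i = i₀ ∨ i = i₁)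
    (hdet : LinearEquiv.det c = 1) :
    properIsometries B ≤ Subgroup.closure {x | ∃ g ∈ properIsometries B,
      x = g * (c * (refl B u₀ * refl B v₀)) * g⁻¹} := by
  have : FiniteDimensional ℝ V := e.finiteDimensional_of_finite
  set N := Subgroup.closure {x | ∃ g ∈ properIsometries B,
      x = g * (c * (refl B u₀ * refl B v₀)) * g⁻¹} with hNdef
  have hcc : ∀ x, c * x = x * c := by
    rcases hc with rfl | ⟨rfl, -⟩
    · intro x; rw [one_mul, mul_one]
    · intro x; ext y
      exact (map_neg x y).symm
  have hcO : c ∈ isometries B := by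
    rcases hc with rfl | ⟨rfl, -⟩
    · exact Subgroup.one_mem _
    · intro x y
      change B (-x) (-y) = B x y
      simp
  have hcP : c ∈ properIsometries B := ⟨hcO, hdet⟩
  have hNP : N ≤ properIsometries B := by
    refine (Subgroup.closure_le _).2 ?_
    rintro _ ⟨g, hg, rfl⟩
    exact Subgroup.mul_mem _ (Subgroup.mul_mem _ hg (Subgroup.mul_mem _ hcP
      (refl_mul_refl_mem hB hu₀.ne' hv₀.ne))) (Subgroup.inv_mem _ hg)
  have hconj : ∀ g ∈ isometries B, g * (c * (refl B u₀ * refl B v₀)) * g⁻¹ ∈ N := by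
    intro g hg
    rcases det_isometry hB e he hne hg with h | h
    · exact Subgroup.subset_closure ⟨g, ⟨hg, h⟩, rfl⟩
    -- As `s_{u₀}` commutes with `c s_{u₀} s_{v₀}`, a conjugator of determinant `-1` may be
    -- multiplied by it. So conjugation by the full isometry group stays in `N`.
    · refine Subgroup.subset_closure ⟨g * refl B u₀, ⟨Subgroup.mul_mem _ hg (refl_mem hB _), ?_⟩, ?_⟩
      · change LinearEquiv.det (g * refl B u₀) = 1
        rw [map_mul, h, det_refl hu₀.ne']
        norm_num
      · simp only [mul_inv_rev, refl_inv, mul_assoc]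
        rw [← mul_assoc (refl B v₀) (refl B u₀), ← refl_comm hB huv₀, ← mul_assoc (refl B u₀) c,
          ← hcc, mul_assoc c, ← mul_assoc (refl B u₀) (refl B u₀), refl_mul_self, one_mul, mul_assoc]
  have hN : ∀ u v, 0 < B u u → B v v < 0 → B u v = 0 → c * (refl B u * refl B v) ∈ N := by
    intro u v hu hv huv
    obtain ⟨g, hg, hgu, hgv⟩ := exists_isometry_pair hB hu₀ hv₀ huv₀ hu hv huv
    have h := hconj g hg
    rwa [← mul_assoc g, ← hcc, mul_assoc c, mul_assoc c, ← conj_mul, conj_refl hg, conj_refl hg,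
      hgu, hgv] at h
  obtain ⟨hnn, hpp⟩ := refl_mul_refl_mem_of_same_sign hB h₀ h₁ (he _ _ hi) hk hcc hN
  have hcN : c ∈ N := by
    rcases hc with rfl | ⟨rfl, htwo⟩
    · exact N.one_mem
    · exact neg_mem_of_refl_mul_refl_mem e he hne hi h₀ h₁ hk htwo hdet hNP hnn hpp
  -- Once `c ∈ N`, orthogonality can be dropped: with `w ⊥ u` negative, `s_u s_v = (s_u s_w)(s_w
  -- s_v)`.
  have hpn : ∀ u v, 0 < B u u → B v v < 0 → refl B u * refl B v ∈ N := by
    intro u v hu hv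
    obtain ⟨w, hw, huw⟩ := exists_neg_orthogonal hB hk hu
    have h := N.mul_mem (N.mul_mem (N.inv_mem hcN) (hN u w hu hw huw)) (hnn w v hw hv)
    rwa [inv_mul_cancel_left, mul_assoc, ← mul_assoc (refl B w), refl_mul_self, one_mul] at h
  refine properIsometries_le_of_refl_mul_refl_mem hB e he hne h₀.ne' hNP fun a b ha hb => ?_
  rcases ha.lt_or_gt with ha | ha <;> rcases hb.lt_or_gt with hb | hb
  · exact hnn a b ha hb
  · have h := N.inv_mem (hpn b a hb ha)
    rwa [mul_inv_rev, refl_inv, refl_inv] at h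
  · exact hpn a b ha hb
  · exact hpp a b ha hb

end ConjugatesOfReflectionPairs

theorem closure_conjugatesOf_eq_top {G : Type*} [Group G] {S : Subgroup G} (ρ : S)
    (h : S ≤ Subgroup.closure {x | ∃ g ∈ S, x = g * (ρ : G) * g⁻¹}) :
    Subgroup.closure (conjugatesOf ρ) = ⊤ := by
  have h2 : Subgroup.closure {x | ∃ g ∈ S, x = g * (ρ : G) * g⁻¹} ≤
      (Subgroup.closure (conjugatesOf ρ)).map S.subtype := by
    refine (Subgroup.closure_le _).2 ?_
    rintro _ ⟨g, hg, rfl⟩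
    exact ⟨⟨g, hg⟩ * ρ * ⟨g, hg⟩⁻¹, Subgroup.subset_closure
      (show IsConj ρ _ from isConj_iff.2 ⟨_, rfl⟩), rfl⟩
  rw [eq_top_iff]
  intro x _
  obtain ⟨y, hy, hyx⟩ := h2 (h x.2)
  rwa [← Subtype.ext hyx]

/-! ### The groups `SO_{2,d}` and `SO_{1,d-1}`. -/

section PseudoEuclidean

/-- The bilinear form underlying `form`. -/
def bform (p n : ℕ) : LinearMap.BilinForm ℝ (Fin n → ℝ) :=
  LinearMap.mk₂ ℝ (form p)
    (fun x y z => by simp only [form, Pi.add_apply, add_mul, mul_add, Finset.sum_add_distrib])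
    (fun c x y => by
      simp only [form, Pi.smul_apply, smul_eq_mul, Finset.mul_sum]
      exact Finset.sum_congr rfl fun i _ => by ring)
    (fun x y z => by simp only [form, Pi.add_apply, mul_add, Finset.sum_add_distrib])
    (fun c x y => by
      simp only [form, Pi.smul_apply, smul_eq_mul, Finset.mul_sum]
      exact Finset.sum_congr rfl fun i _ => by ring)

theorem bform_apply (p : ℕ) {n : ℕ} (x y : Fin n → ℝ) : bform p n x y = form p x y := rfl

theorem bform_comm (p : ℕ) {n : ℕ} (x y : Fin n → ℝ) : bform p n x y = bform p n y x := by
  simp only [bform_apply, form]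
  exact Finset.sum_congr rfl fun i _ => by rw [mul_comm (x i)]

theorem bform_single (p : ℕ) {n : ℕ} (i : Fin n) (y : Fin n → ℝ) :
    bform p n (Pi.single i 1) y = (if i.val < p then 1 else -1) * y i := by
  rw [bform_apply, form, Finset.sum_eq_single i]
  · simp
  · intro j _ hj
    simp [hj]
  · simp

theorem bform_single_ne (p : ℕ) {n : ℕ} {i j : Fin n} (h : i ≠ j) :
    bform p n (Pi.single i 1) (Pi.single j 1) = 0 := by
  rw [bform_single, Pi.single_eq_of_ne h, mul_zero]

theorem bform_single_self (p : ℕ) {n : ℕ} (i : Fin n) :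
    bform p n (Pi.single i 1) (Pi.single i 1) = if i.val < p then 1 else -1 := by
  rw [bform_single, Pi.single_eq_same, mul_one]

theorem bform_basis_ne (p n : ℕ) (i j : Fin n) (h : i ≠ j) :
    bform p n (Pi.basisFun ℝ (Fin n) i) (Pi.basisFun ℝ (Fin n) j) = 0 := by
  rw [Pi.basisFun_apply, Pi.basisFun_apply, bform_single_ne p h]

theorem bform_basis_self (p n : ℕ) (i : Fin n) :
    bform p n (Pi.basisFun ℝ (Fin n) i) (Pi.basisFun ℝ (Fin n) i) =
      if i.val < p then 1 else -1 := by
  rw [Pi.basisFun_apply, bform_single_self]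

theorem bform_basis_self_ne (p n : ℕ) (i : Fin n) :
    bform p n (Pi.basisFun ℝ (Fin n) i) (Pi.basisFun ℝ (Fin n) i) ≠ 0 := by
  rw [bform_basis_self]; split_ifs <;> norm_num

/-- Conjugates of `± s_u s_v` generate `SO_{2,d}(ℝ)`. -/
theorem SO_two_le_closure {d : ℕ} (hd : 1 ≤ d) {u v : Fin (d + 2) → ℝ}
    (hu : 0 < bform 2 (d + 2) u u) (hv : bform 2 (d + 2) v v < 0) (huv : bform 2 (d + 2) u v = 0)
    {c : (Fin (d + 2) → ℝ) ≃ₗ[ℝ] (Fin (d + 2) → ℝ)} (hc : c = 1 ∨ c = LinearEquiv.neg ℝ)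
    (hdet : LinearEquiv.det c = 1) :
    SO 2 (d + 2) ≤ Subgroup.closure {x | ∃ g ∈ SO 2 (d + 2),
      x = g * (c * (refl (bform 2 (d + 2)) u * refl (bform 2 (d + 2)) v)) * g⁻¹} := by
  refine properIsometries_le_closure (B := bform 2 (d + 2)) (bform_comm 2)
    (Pi.basisFun ℝ (Fin (d + 2))) (bform_basis_ne 2 _) (bform_basis_self_ne 2 _)
    (i₀ := ⟨0, by omega⟩) (i₁ := ⟨1, by omega⟩) (k := ⟨2, by omega⟩) (by simp) ?_ ?_ ?_ hu hv huv
    (hc.imp_right fun h => ⟨h, fun i hi => ?_⟩) hdet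
  · rw [bform_basis_self]; norm_num
  · rw [bform_basis_self]; norm_num
  · rw [bform_basis_self]; norm_num
  · rw [bform_basis_self] at hi
    have : i.val < 2 := by
      by_contra h
      rw [if_neg h] at hi
      norm_num at hi
    simp only [Fin.ext_iff]
    omega

/-- Conjugates of `s_u s_v` generate `SO_{1,d-1}(ℝ)` for `d > 2`. -/
theorem SO_one_le_closure {d : ℕ} (hd : 2 < d) {u v : Fin d → ℝ}
    (hu : 0 < bform 1 d u u) (hv : bform 1 d v v < 0) (huv : bform 1 d u v = 0) :
    SO 1 d ≤ Subgroup.closure {x | ∃ g ∈ SO 1 d,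
      x = g * (refl (bform 1 d) u * refl (bform 1 d) v) * g⁻¹} := by
  -- The Lorentzian form has a single positive direction; its negative has `d - 1 ≥ 2` of them and
  -- the same isometries and reflections, with `u` and `v` exchanging roles.
  have h := properIsometries_le_closure (B := -bform 1 d) (c := 1) (u₀ := v) (v₀ := u)
    (fun x y => congrArg Neg.neg (bform_comm 1 x y))
    (Pi.basisFun ℝ (Fin d)) (fun i j hij => neg_eq_zero.2 (bform_basis_ne 1 _ i j hij))
    (fun i => neg_ne_zero.2 (bform_basis_self_ne 1 _ i))
    (i₀ := ⟨1, by omega⟩) (i₁ := ⟨2, by omega⟩) (k := ⟨0, by omega⟩) (by simp)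
    (neg_pos.2 (by rw [bform_basis_self]; norm_num))
    (neg_pos.2 (by rw [bform_basis_self]; norm_num))
    (neg_lt_zero.2 (by rw [bform_basis_self]; norm_num))
    (neg_pos.2 hv) (neg_lt_zero.2 hu) (neg_eq_zero.2 (by rw [bform_comm, huv])) (Or.inl rfl)
    (map_one _)
  rw [properIsometries_neg, refl_neg_form, refl_neg_form, one_mul,
    ← refl_comm (bform_comm 1) huv] at h
  exact h

end PseudoEuclidean

/-! ### Null vectors of `ℝ^{2,d}` over points of Minkowski space. -/

section NullLift

/-- The vector `(a, x, b)` of `ℝ^{2,d}`. -/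
def embVec {d : ℕ} (a : ℝ) (x : Fin d → ℝ) (b : ℝ) : Fin (d + 2) → ℝ :=
  Fin.cons a (Fin.snoc (α := fun _ => ℝ) x b : Fin (d + 1) → ℝ)

theorem nullLift_eq {d : ℕ} (x : Fin d → ℝ) :
    nullLift x = embVec ((1 - form 1 x x) / 2) x ((1 + form 1 x x) / 2) := rfl

theorem embVec_ext {d : ℕ} {z : Fin (d + 2) → ℝ} {a b : ℝ} {x : Fin d → ℝ} (h0 : z 0 = a)
    (hx : ∀ i : Fin d, z i.castSucc.succ = x i) (h1 : z (Fin.last d).succ = b) :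
    z = embVec a x b := by
  funext i
  refine Fin.cases ?_ (fun j => ?_) i
  · exact h0
  · refine Fin.lastCases ?_ (fun k => ?_) j
    · rw [h1]; simp [embVec, -Fin.succ_last]
    · simp [embVec, hx]

theorem smul_embVec {d : ℕ} (c a b : ℝ) (x : Fin d → ℝ) :
    c • embVec a x b = embVec (c * a) (c • x) (c * b) :=
  embVec_ext (by simp [embVec]) (by simp [embVec]) (by simp [embVec])

theorem embVec_sub {d : ℕ} (a b a' b' : ℝ) (x x' : Fin d → ℝ) :
    embVec a x b - embVec a' x' b' = embVec (a - a') (x - x') (b - b') :=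
  embVec_ext (by simp [embVec]) (by simp [embVec]) (by simp [embVec])

theorem bform_embVec {d : ℕ} (hd : 1 ≤ d) (a b a' b' : ℝ) (x x' : Fin d → ℝ) :
    bform 2 (d + 2) (embVec a x b) (embVec a' x' b') = a * a' + bform 1 d x x' - b * b' := by
  have h : d ≠ 0 := by omega
  simp only [bform_apply, form]
  rw [Fin.sum_univ_succ, Fin.sum_univ_castSucc]
  simp [embVec, h]
  ring

/-- Products of lifts recover Lorentzian squared distances, which is how an isometry of `ℝ^{2,d}`
constrains its scale factors on null lines. -/
theorem bform_nullLift {d : ℕ} (hd : 1 ≤ d) (x y : Fin d → ℝ) :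
    bform 2 (d + 2) (nullLift x) (nullLift y) = -(1 / 2) * bform 1 d (x - y) (x - y) := by
  rw [nullLift_eq, nullLift_eq, bform_embVec hd, ← bform_apply, ← bform_apply]
  simp only [map_sub, LinearMap.sub_apply]
  rw [bform_comm 1 y x]
  ring

end NullLift

/-! ### Conformal transformations with a given action. -/

section Conformal

variable {d : ℕ}

/-- An isometry of `ℝ^{2,d}` that fixes all the null lines of points of `ℝ^{1,d-1}` is `± 1`. -/
theorem eq_one_or_neg_of_nullLift (hd : 1 ≤ d) {κ : (Fin (d + 2) → ℝ) ≃ₗ[ℝ] (Fin (d + 2) → ℝ)}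
    (hκ : κ ∈ isometries (bform 2 (d + 2)))
    (h : ∀ x : Fin d → ℝ, ∃ c : ℝ, κ (nullLift x) = c • nullLift x) :
    κ = 1 ∨ κ = LinearEquiv.neg ℝ := by
  choose c hc using h
  -- The scale factors at two points with non-null difference are mutually inverse. Applied to `0`,
  -- `e_i` and `-e_i`, this makes them all equal to one sign `c 0 = ± 1`; the lifts of these points
  -- span `ℝ^{2,d}`.
  have hmul : ∀ x y, bform 1 d (x - y) (x - y) ≠ 0 → c x * c y = 1 := by
    intro x y hxy
    have h1 := hκ (nullLift x) (nullLift y)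
    rw [hc, hc] at h1
    simp only [map_smul, LinearMap.smul_apply, smul_eq_mul] at h1
    rw [bform_nullLift hd] at h1
    have h2 : (c x * c y - 1) * (-(1 / 2) * bform 1 d (x - y) (x - y)) = 0 := by linarith
    rcases mul_eq_zero.1 h2 with h3 | h3
    · linarith
    · exact absurd h3 (mul_ne_zero (by norm_num) hxy)
  have hq : ∀ i : Fin d, bform 1 d (Pi.single i 1) (Pi.single i 1) ≠ 0 := by
    intro i
    rw [bform_single_self]; split_ifs <;> norm_num
  have h1 : ∀ i : Fin d, c 0 * c (Pi.single i 1) = 1 := fun i => hmul _ _ (by simpa using hq i)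
  have h2 : ∀ i : Fin d, c 0 * c (-Pi.single i 1) = 1 := fun i => hmul _ _ (by simpa using hq i)
  have h3 : ∀ i : Fin d, c (Pi.single i 1) * c (-Pi.single i 1) = 1 := fun i =>
    hmul _ _ (by
      rw [sub_neg_eq_add, ← two_smul ℝ]
      simp only [map_smul, LinearMap.smul_apply, smul_eq_mul]
      have := hq i
      positivity)
  have h0 : c 0 ≠ 0 := left_ne_zero_of_mul_eq_one (h1 ⟨0, hd⟩)
  have h12 : ∀ i : Fin d, c (Pi.single i 1) = c (-Pi.single i 1) := fun i =>
    mul_left_cancel₀ h0 ((h1 i).trans (h2 i).symm)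
  have hc1 : ∀ i : Fin d, c (Pi.single i 1) = c 0 := fun i => by
    have h4 := h3 i
    rw [← h12] at h4
    exact mul_right_cancel₀ (right_ne_zero_of_mul_eq_one (h1 i)) (h4.trans (h1 i).symm)
  have hc2 : ∀ i : Fin d, c (-Pi.single i 1) = c 0 := fun i => (h12 i).symm.trans (hc1 i)
  have hsq : c 0 * c 0 = 1 := by rw [← h1 ⟨0, hd⟩, hc1]
  let W : Submodule ℝ (Fin (d + 2) → ℝ) :=
    LinearMap.eqLocus (κ : (Fin (d + 2) → ℝ) →ₗ[ℝ] (Fin (d + 2) → ℝ)) (c 0 • LinearMap.id)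
  have hW0 : nullLift (0 : Fin d → ℝ) ∈ W := hc 0
  have hWp : ∀ i : Fin d, nullLift (Pi.single i 1) ∈ W := fun i => by
    have := hc (Pi.single i 1)
    rw [hc1] at this
    exact this
  have hWm : ∀ i : Fin d, nullLift (-Pi.single i 1) ∈ W := fun i => by
    have := hc (-Pi.single i 1)
    rw [hc2] at this
    exact this
  have hWe : ∀ i : Fin d, embVec 0 (Pi.single i 1) 0 ∈ W := fun i => by
    have := W.smul_mem (1 / 2) (W.sub_mem (hWp i) (hWm i))
    rw [nullLift_eq, nullLift_eq, embVec_sub, smul_embVec] at this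
    have hf : form 1 (-Pi.single i 1) (-Pi.single i 1) = form 1 (Pi.single i 1 : Fin d → ℝ)
        (Pi.single i 1) := by
      rw [← bform_apply, ← bform_apply]; simp
    rw [hf] at this
    convert this using 2
    · ring
    · ext j; simp
      ring
    · ring
  have hW1 : embVec 0 (0 : Fin d → ℝ) 1 ∈ W := by
    have := W.sub_mem (hWp ⟨0, hd⟩) (hWe ⟨0, hd⟩)
    rw [nullLift_eq, embVec_sub, ← bform_apply, bform_single_self] at this
    convert this using 2 <;> norm_num
  have hW2 : embVec 1 (0 : Fin d → ℝ) 0 ∈ W := by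
    have := W.sub_mem (W.smul_mem 2 hW0) hW1
    rw [nullLift_eq, smul_embVec, embVec_sub, ← bform_apply] at this
    convert this using 2 <;> simp
  have hall : ∀ v, κ v = c 0 • v := by
    have : (κ : (Fin (d + 2) → ℝ) →ₗ[ℝ] (Fin (d + 2) → ℝ)) = c 0 • LinearMap.id := by
      refine (Pi.basisFun ℝ (Fin (d + 2))).ext fun i => ?_
      rw [Pi.basisFun_apply]
      change Pi.single i 1 ∈ W
      refine Fin.cases ?_ (fun j => ?_) i
      · convert hW2
        refine embVec_ext (by simp) (fun i => ?_) ?_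
        · rw [Pi.single_eq_of_ne (Fin.succ_ne_zero _)]; rfl
        · rw [Pi.single_eq_of_ne (Fin.succ_ne_zero _)]
      · refine Fin.lastCases ?_ (fun k => ?_) j
        · convert hW1
          refine embVec_ext (Pi.single_eq_of_ne (Fin.succ_ne_zero _).symm _) (fun i => ?_)
            (Pi.single_eq_same _ _)
          rw [Pi.single_eq_of_ne]
          · rfl
          · exact fun h => (Fin.castSucc_lt_last i).ne (Fin.succ_injective _ h)
        · convert hWe k
          refine embVec_ext (Pi.single_eq_of_ne (Fin.succ_ne_zero _).symm _) (fun i => ?_) ?_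
          · by_cases hik : i = k
            · rw [hik, Pi.single_eq_same, Pi.single_eq_same]
            · rw [Pi.single_eq_of_ne hik, Pi.single_eq_of_ne]
              exact fun h => hik (Fin.castSucc_injective _ (Fin.succ_injective _ h))
          · rw [Pi.single_eq_of_ne]
            exact fun h => (Fin.castSucc_lt_last k).ne' (Fin.succ_injective _ h)
    exact fun v => LinearMap.congr_fun this v
  rcases mul_self_eq_one_iff.1 hsq with h | h
  · left; ext1 v; rw [hall, h, one_smul]; rfl
  · right; ext1 v; rw [hall, h, neg_one_smul]; rfl

/-- If some product of two reflections acts as `f` then the conjugacy class of every conformal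
transformation acting as `f` generates `SO_{2,d}(ℝ)`. -/
theorem closure_conjugatesOf_of_actsAs (hd : 1 ≤ d) {f : (Fin d → ℝ) → (Fin d → ℝ)}
    {u v : Fin (d + 2) → ℝ} (hu : 0 < bform 2 (d + 2) u u) (hv : bform 2 (d + 2) v v < 0)
    (huv : bform 2 (d + 2) u v = 0)
    (hf : ∀ x, ∃ c : ℝ, c ≠ 0 ∧
      (refl (bform 2 (d + 2)) u * refl (bform 2 (d + 2)) v) (nullLift x) = c • nullLift (f x)) :
    (∃ ρ : SO 2 (d + 2), ActsAs ρ f) ∧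
      ∀ ρ : SO 2 (d + 2), ActsAs ρ f → Subgroup.closure (conjugatesOf ρ) = ⊤ := by
  set σ := refl (bform 2 (d + 2)) u * refl (bform 2 (d + 2)) v with hσ
  have hσS : σ ∈ SO 2 (d + 2) := refl_mul_refl_mem (bform_comm 2) hu.ne' hv.ne
  refine ⟨⟨⟨σ, hσS⟩, hf⟩, fun ρ hρ => closure_conjugatesOf_eq_top ρ ?_⟩
  -- The quotient fixes every null line of a point, so it is `± 1`. Its membership in `SO` also
  -- gives determinant `1`, which generation needs for the sign `-`.
  have hκS : σ⁻¹ * ρ ∈ SO 2 (d + 2) := Subgroup.mul_mem _ (Subgroup.inv_mem _ hσS) ρ.2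
  have hκ := eq_one_or_neg_of_nullLift hd hκS.1 fun x => by
    obtain ⟨a, ha, hax⟩ := hf x
    obtain ⟨b, hb, hbx⟩ := hρ x
    refine ⟨b * a⁻¹, ?_⟩
    have h1 : σ⁻¹ (nullLift (f x)) = a⁻¹ • nullLift x := by
      have h2 : σ (a⁻¹ • nullLift x) = nullLift (f x) := by
        rw [map_smul, hax, inv_smul_smul₀ ha]
      rw [← h2]
      exact LinearEquiv.symm_apply_apply σ _
    rw [LinearEquiv.mul_apply, hbx, map_smul, h1, smul_smul]
  have hρ' : (ρ : (Fin (d + 2) → ℝ) ≃ₗ[ℝ] (Fin (d + 2) → ℝ)) = (σ⁻¹ * ρ) * σ := by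
    rcases hκ with h | h
    · rw [h, one_mul]; exact (inv_mul_eq_one.1 h).symm
    · rw [h]
      have h2 := inv_mul_eq_iff_eq_mul.1 h
      rw [h2]
      ext x
      simp
  rw [hρ']
  exact SO_two_le_closure hd hu hv huv hκ hκS.2

/-- The reflection in the affine hyperplane through `c` orthogonal to `u` lifts to a reflection
of `ℝ^{2,d}`. -/
theorem refl_nullLift (hd : 1 ≤ d) {u : Fin d → ℝ} (hu : bform 1 d u u ≠ 0) (c y : Fin d → ℝ) :
    refl (bform 2 (d + 2)) (embVec (-bform 1 d u c) u (bform 1 d u c)) (nullLift y) =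
      nullLift (refl (bform 1 d) u (y - c) + c) := by
  -- The vector `(-[u,c], u, [u,c])` is the image of `(0, u, 0)` under the isometry inducing
  -- translation by `c`.
  rw [refl_apply, nullLift_eq, nullLift_eq, bform_embVec hd, bform_embVec hd, smul_embVec,
    embVec_sub, ← bform_apply, ← bform_apply, refl_apply]
  simp only [map_sub, map_add, map_smul, LinearMap.sub_apply, LinearMap.add_apply,
    LinearMap.smul_apply, smul_eq_mul]
  rw [bform_comm 1 c u, bform_comm 1 y u, bform_comm 1 c y]
  generalize bform 1 d u u = q at hu
  generalize bform 1 d u c = a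
  rw [show -a * -a + q - a * a = q by ring]
  congr 1
  · field_simp
    ring
  · ext i
    simp
    field_simp
    ring
  · field_simp
    ring

end Conformal

/-! ### Wedge reflections, the proper Poincaré group, and point reflections. -/

section Wedges

variable {d : ℕ}

theorem affineEquiv_eq_linear_add (g : (Fin d → ℝ) ≃ᵃ[ℝ] (Fin d → ℝ)) (x c : Fin d → ℝ) :
    g (x + c) = g.linear x + g c := AffineEquiv.map_vadd g c x

theorem R01_apply (hd : 2 ≤ d) (x : Fin d → ℝ) :
    R01 d x = refl (bform 1 d) (Pi.single ⟨0, by omega⟩ 1)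
      (refl (bform 1 d) (Pi.single ⟨1, by omega⟩ 1) x) := by
  funext i
  have h : R01 d x i = if i.val < 2 then -x i else x i := by
    change (if i.val < 2 then LinearEquiv.neg ℝ else LinearEquiv.refl ℝ ℝ : ℝ ≃ₗ[ℝ] ℝ) (x i) = _
    split_ifs <;> rfl
  rw [h]
  simp only [refl_apply, bform_single]
  by_cases h0 : i = ⟨0, by omega⟩
  · subst h0; simp; ring
  · by_cases h1 : i = ⟨1, by omega⟩
    · subst h1; simp; ring
    · have h2 : ¬ i.val < 2 := by
        simp only [Fin.ext_iff] at h0 h1; omega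
      simp [h0, h1, h2]

/-- A wedge reflection is the product of two affine reflections in orthogonal directions. -/
theorem wedgeReflection_apply (hd : 2 ≤ d) {g : (Fin d → ℝ) ≃ᵃ[ℝ] (Fin d → ℝ)} (hg : g ∈ P d) :
    ∃ u v c : Fin d → ℝ, 0 < bform 1 d u u ∧ bform 1 d v v < 0 ∧ bform 1 d u v = 0 ∧
      ∀ y, (g * R01 d * g⁻¹) y = refl (bform 1 d) u (refl (bform 1 d) v (y - c)) + c := by
  have hA : g.linear ∈ isometries (bform 1 d) := hg
  refine ⟨g.linear (Pi.single ⟨0, by omega⟩ 1), g.linear (Pi.single ⟨1, by omega⟩ 1), g 0,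
    ?_, ?_, ?_, fun y => ?_⟩
  · rw [hA, bform_single_self]; norm_num
  · rw [hA, bform_single_self]; norm_num
  · rw [hA, bform_single_ne]; simp
  · obtain ⟨z, rfl⟩ := g.surjective y
    have h1 : g⁻¹ (g z) = z := g.symm_apply_apply z
    have h2 : ∀ z, g z = g.linear z + g 0 := fun z => by
      rw [← affineEquiv_eq_linear_add, add_zero]
    have h3 : ∀ a x, refl (bform 1 d) (g.linear a) (g.linear x) =
        g.linear (refl (bform 1 d) a x) := by
      intro a x
      rw [← conj_refl hA, LinearEquiv.mul_apply, LinearEquiv.mul_apply]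
      congr 2
      exact g.linear.symm_apply_apply x
    rw [show (g * R01 d * g⁻¹) (g z) = g (R01 d (g⁻¹ (g z))) from rfl, h1, h2 (R01 d z), h2 z,
      add_sub_cancel_right, h3, h3, R01_apply hd]

theorem linear_eq_of_apply {r : (Fin d → ℝ) ≃ᵃ[ℝ] (Fin d → ℝ)}
    {σ : (Fin d → ℝ) ≃ₗ[ℝ] (Fin d → ℝ)} {c : Fin d → ℝ} (h : ∀ y, r y = σ (y - c) + c) :
    r.linear = σ := by
  ext1 x
  have h1 := affineEquiv_eq_linear_add r x c
  rw [h, h c, add_sub_cancel_right, sub_self, map_zero, zero_add] at h1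
  exact (add_right_cancel h1).symm

theorem conj_mem_closure_conj {G : Type*} [Group G] {S : Subgroup G} {ρ g x : G} (hg : g ∈ S)
    (hx : x ∈ Subgroup.closure {x | ∃ g ∈ S, x = g * ρ * g⁻¹}) :
    g * x * g⁻¹ ∈ Subgroup.closure {x | ∃ g ∈ S, x = g * ρ * g⁻¹} := by
  have h : Subgroup.closure {x | ∃ g ∈ S, x = g * ρ * g⁻¹} ≤
      (Subgroup.closure {x | ∃ g ∈ S, x = g * ρ * g⁻¹}).comap (MulAut.conj g).toMonoidHom := by
    refine (Subgroup.closure_le _).2 ?_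
    rintro _ ⟨k, hk, rfl⟩
    refine Subgroup.subset_closure ⟨g * k, S.mul_mem hg hk, ?_⟩
    change g * (k * ρ * k⁻¹) * g⁻¹ = _
    group
  exact h hx

theorem constVAdd_mem_Pplus (v : Fin d → ℝ) : AffineEquiv.constVAdd ℝ (Fin d → ℝ) v ∈ Pplus d :=
  (SO 1 d).one_mem

/-- For `d > 2`, the conjugates of a wedge reflection generate the proper Poincaré group. -/
theorem Pplus_le_closure (hd : 2 < d) {r : (Fin d → ℝ) ≃ᵃ[ℝ] (Fin d → ℝ)}
    {u v : Fin d → ℝ} (hu : 0 < bform 1 d u u) (hv : bform 1 d v v < 0)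
    (huv : bform 1 d u v = 0) (hlin : r.linear = refl (bform 1 d) u * refl (bform 1 d) v) :
    Pplus d ≤ Subgroup.closure {x | ∃ g ∈ Pplus d, x = g * r * g⁻¹} := by
  set N := Subgroup.closure {x | ∃ g ∈ Pplus d, x = g * r * g⁻¹} with hN
  -- The linear parts of `N` exhaust `SO_{1,d-1}`; what remains is to find all translations in `N`.
  have hlinN : ∀ A ∈ SO 1 d, ∃ h ∈ N, h.linear = A := by
    have h1 : SO 1 d ≤ N.map AffineEquiv.linearHom := by
      refine (SO_one_le_closure hd hu hv huv).trans ((Subgroup.closure_le _).2 ?_)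
      rintro _ ⟨A, hA, rfl⟩
      refine ⟨A.toAffineEquiv * r * A.toAffineEquiv⁻¹,
        Subgroup.subset_closure ⟨A.toAffineEquiv, hA, rfl⟩, ?_⟩
      rw [map_mul, map_mul, map_inv, ← hlin]
      rfl
    exact fun A hA => h1 hA
  let T : AddSubgroup (Fin d → ℝ) :=
    { carrier := {v | AffineEquiv.constVAdd ℝ (Fin d → ℝ) v ∈ N}
      zero_mem' := by
        change AffineEquiv.constVAdd ℝ (Fin d → ℝ) 0 ∈ N
        rw [AffineEquiv.constVAdd_zero]
        exact N.one_mem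
      add_mem' := by
        intro a b ha hb
        change AffineEquiv.constVAdd ℝ (Fin d → ℝ) (a + b) ∈ N
        rw [AffineEquiv.constVAdd_add]
        exact N.mul_mem ha hb
      neg_mem' := by
        intro a ha
        change AffineEquiv.constVAdd ℝ (Fin d → ℝ) (-a) ∈ N
        rw [← AffineEquiv.constVAdd_symm]
        exact N.inv_mem ha }
  -- The commutator of the translation by `x` with an element of linear part `A` is the translation
  -- by `x - A x`, and `N` is normalised by translations.
  have hcomm : ∀ A ∈ SO 1 d, ∀ x, x - A x ∈ T := by
    intro A hA x
    obtain ⟨h, hh, rfl⟩ := hlinN A hA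
    have h1 := N.mul_mem (conj_mem_closure_conj (constVAdd_mem_Pplus x) hh) (N.inv_mem hh)
    have h2 : AffineEquiv.constVAdd ℝ (Fin d → ℝ) (x - h.linear x) =
        AffineEquiv.constVAdd ℝ (Fin d → ℝ) x * h * (AffineEquiv.constVAdd ℝ (Fin d → ℝ) x)⁻¹ *
          h⁻¹ := by
      rw [eq_mul_inv_iff_mul_eq, eq_mul_inv_iff_mul_eq]
      ext1 y
      change x - h.linear x + h (x + y) = x + h y
      rw [affineEquiv_eq_linear_add]
      abel
    change AffineEquiv.constVAdd ℝ (Fin d → ℝ) (x - h.linear x) ∈ N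
    rw [h2]
    exact h1
  have hsingle : ∀ (i : Fin d) (a : ℝ), Pi.single i a ∈ T := by
    intro i a
    have : Nontrivial (Fin d) := Fin.nontrivial_iff_two_le.2 (by omega)
    obtain ⟨j, hj⟩ := exists_ne i
    have hne : ∀ i : Fin d, bform 1 d (Pi.single i 1) (Pi.single i 1) ≠ 0 := by
      intro i; rw [bform_single_self]; split_ifs <;> norm_num
    -- The product `s_{e_i} s_{e_j}` maps `e_i` to `-e_i`, so `x = (a/2) e_i` yields the translation
    -- by `a e_i`.
    have h1 := hcomm _ (refl_mul_refl_mem (bform_comm 1) (hne i) (hne j))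
      ((a / 2) • Pi.single i 1)
    rw [map_smul, LinearEquiv.mul_apply, refl_apply_of_orthogonal (bform_single_ne 1 hj),
      refl_apply_self (hne i), smul_neg, sub_neg_eq_add, ← add_smul, add_halves] at h1
    rwa [← Pi.single_smul, smul_eq_mul, mul_one] at h1
  have hT : ∀ v, v ∈ T := by
    intro v
    rw [← Finset.univ_sum_single v]
    exact T.sum_mem fun i _ => hsingle i _
  intro g hg
  obtain ⟨h, hh, hgh⟩ := hlinN g.linear hg
  have h1 : g = AffineEquiv.constVAdd ℝ (Fin d → ℝ) (g 0 - h 0) * h := by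
    ext1 x
    change g x = g 0 - h 0 + h x
    have h2 := affineEquiv_eq_linear_add g x 0
    have h3 := affineEquiv_eq_linear_add h x 0
    rw [add_zero] at h2 h3
    rw [h2, h3, hgh]
    abel
  rw [h1]
  exact N.mul_mem (hT _) hh

/-- For `d = 2` the linear part of a wedge reflection is central, so its conjugates do not
generate the proper Poincaré group. -/
theorem closure_conjugatesOf_ne_top {r : Pplus 2}
    (hr : (r : (Fin 2 → ℝ) ≃ᵃ[ℝ] (Fin 2 → ℝ)).linear ∈
      Subgroup.center ((Fin 2 → ℝ) ≃ₗ[ℝ] (Fin 2 → ℝ))) :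
    Subgroup.closure (conjugatesOf r) ≠ ⊤ := by
  intro htop
  have hle : Subgroup.closure (conjugatesOf r) ≤
      (Subgroup.center ((Fin 2 → ℝ) ≃ₗ[ℝ] (Fin 2 → ℝ))).comap
        (AffineEquiv.linearHom.comp (Pplus 2).subtype) := by
    refine (Subgroup.closure_le _).2 ?_
    intro x hx
    obtain ⟨g, rfl⟩ := isConj_iff.1 (show IsConj r x from hx)
    change AffineEquiv.linearHom.comp (Pplus 2).subtype (g * r * g⁻¹) ∈
      Subgroup.center ((Fin 2 → ℝ) ≃ₗ[ℝ] (Fin 2 → ℝ))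
    rw [map_mul, map_mul, map_inv]
    exact (inferInstance : (Subgroup.center ((Fin 2 → ℝ) ≃ₗ[ℝ] (Fin 2 → ℝ))).Normal).conj_mem
      _ hr _
  -- Every generated element has central linear part. The product of the reflections in `e₀` and
  -- `(2, 1)`, of lengths `1` and `3`, is proper but does not commute with the reflection in `e₁`.
  have h0 : bform 1 2 (Pi.single 0 1) (Pi.single 0 1) ≠ 0 := by
    rw [bform_single_self]; norm_num
  have h1 : bform 1 2 ![2, 1] ![2, 1] ≠ 0 := by
    norm_num [bform_apply, form, Fin.sum_univ_two]
  have hb := refl_mul_refl_mem (bform_comm 1) h0 h1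
  rw [htop] at hle
  have hc := hle (Subgroup.mem_top
    (⟨(refl (bform 1 2) (Pi.single 0 1) * refl (bform 1 2) ![2, 1]).toAffineEquiv, hb⟩ : Pplus 2))
  have hc2 := Subgroup.mem_center_iff.1 hc (refl (bform 1 2) (Pi.single 1 1))
  have hc3 := congrFun (congrArg (fun A : (Fin 2 → ℝ) ≃ₗ[ℝ] (Fin 2 → ℝ) => A (Pi.single 0 1)) hc2) 1
  change refl (bform 1 2) (Pi.single 1 1) (refl (bform 1 2) (Pi.single 0 1)
      (refl (bform 1 2) ![2, 1] (Pi.single 0 1))) 1 =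
    refl (bform 1 2) (Pi.single 0 1) (refl (bform 1 2) ![2, 1]
      (refl (bform 1 2) (Pi.single 1 1) (Pi.single 0 1))) 1 at hc3
  have he0 : (Pi.single 0 1 : Fin 2 → ℝ) = ![1, 0] := by ext i; fin_cases i <;> simp
  have he1 : (Pi.single 1 1 : Fin 2 → ℝ) = ![0, 1] := by ext i; fin_cases i <;> simp
  rw [he0, he1] at hc3
  simp [refl_apply, bform_apply, form, Fin.sum_univ_two] at hc3
  norm_num at hc3

theorem linear_R01_two_mem_center {g : (Fin 2 → ℝ) ≃ᵃ[ℝ] (Fin 2 → ℝ)} :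
    (g * R01 2 * g⁻¹).linear ∈ Subgroup.center ((Fin 2 → ℝ) ≃ₗ[ℝ] (Fin 2 → ℝ)) := by
  change AffineEquiv.linearHom (g * R01 2 * g⁻¹) ∈
    Subgroup.center ((Fin 2 → ℝ) ≃ₗ[ℝ] (Fin 2 → ℝ))
  rw [map_mul, map_mul, map_inv]
  refine (inferInstance : (Subgroup.center ((Fin 2 → ℝ) ≃ₗ[ℝ] (Fin 2 → ℝ))).Normal).conj_mem
    _ ?_ _
  rw [Subgroup.mem_center_iff]
  have h : ∀ x, AffineEquiv.linearHom (R01 2) x = -x := by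
    intro x
    change R01 2 x = -x
    funext i
    fin_cases i <;> rfl
  intro A
  ext1 x
  rw [LinearEquiv.mul_apply, LinearEquiv.mul_apply, h, h, map_neg]

theorem wedge_reflection_generates (hd : 2 ≤ d) {W : Set (Fin d → ℝ)}
    {r : (Fin d → ℝ) ≃ᵃ[ℝ] (Fin d → ℝ)} (hr : IsWedgeReflection d hd W r) :
    (∃ hr : r ∈ Pplus d,
        Subgroup.closure (conjugatesOf (⟨r, hr⟩ : Pplus d)) = ⊤ ↔ 2 < d) ∧
      (∃ ρ : SO 2 (d + 2), ActsAs ρ r) ∧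
      (∀ ρ : SO 2 (d + 2), ActsAs ρ r → Subgroup.closure (conjugatesOf ρ) = ⊤) := by
  obtain ⟨g, hg, -, rfl⟩ := hr
  obtain ⟨u, v, c, hu, hv, huv, hr⟩ := wedgeReflection_apply hd hg
  have hlin : (g * R01 d * g⁻¹).linear = refl (bform 1 d) u * refl (bform 1 d) v :=
    linear_eq_of_apply hr
  have hP : g * R01 d * g⁻¹ ∈ Pplus d := by
    change (g * R01 d * g⁻¹).linear ∈ SO 1 d
    rw [hlin]
    exact refl_mul_refl_mem (bform_comm 1) hu.ne' hv.ne
  have hd1 : 1 ≤ d := by omega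
  refine ⟨⟨hP, fun h => ?_, fun h => ?_⟩, ?_⟩
  · by_contra h2
    obtain rfl : d = 2 := by omega
    exact closure_conjugatesOf_ne_top (r := ⟨_, hP⟩) linear_R01_two_mem_center h
  · exact closure_conjugatesOf_eq_top (⟨_, hP⟩ : Pplus d) (Pplus_le_closure h hu hv huv hlin)
  · have hform : ∀ x y, bform 2 (d + 2) (embVec (-bform 1 d x c) x (bform 1 d x c))
        (embVec (-bform 1 d y c) y (bform 1 d y c)) = bform 1 d x y := by
      intro x y
      rw [bform_embVec hd1]; ring
    refine closure_conjugatesOf_of_actsAs hd1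
      (u := embVec (-bform 1 d u c) u (bform 1 d u c))
      (v := embVec (-bform 1 d v c) v (bform 1 d v c)) (by rwa [hform]) (by rwa [hform])
      (by rwa [hform]) fun x => ⟨1, one_ne_zero, ?_⟩
    rw [LinearEquiv.mul_apply, refl_nullLift hd1 hv.ne, refl_nullLift hd1 hu.ne',
      add_sub_cancel_right, one_smul, hr]

theorem point_reflection_generates {r : (Fin 1 → ℝ) ≃ᵃ[ℝ] (Fin 1 → ℝ)}
    (hr : ∃ c : Fin 1 → ℝ, r = AffineEquiv.pointReflection ℝ c) :
    (∃ ρ : SO 2 (1 + 2), ActsAs ρ r) ∧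
      (∀ ρ : SO 2 (1 + 2), ActsAs ρ r → Subgroup.closure (conjugatesOf ρ) = ⊤) := by
  obtain ⟨c, rfl⟩ := hr
  have hf : ∀ x y : Fin 1 → ℝ, form 1 x y = x 0 * y 0 := by
    intro x y
    simp [form]
  have hq : ∀ a b a' b' : ℝ, ∀ x x' : Fin 1 → ℝ,
      bform 2 (1 + 2) (embVec a x b) (embVec a' x' b') = a * a' + x 0 * x' 0 - b * b' := by
    intro a b a' b' x x'
    rw [bform_embVec le_rfl, bform_apply, hf]
  -- The two normals are the images of `(1, 0, 0)` and `(0, 0, 1)` under the isometry inducing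
  -- translation by `c`. For `c = 0` the product changes the signs of both outer coordinates and
  -- sends the lift of `x` to minus the lift of `-x`; hence the scale factor `-1`.
  have huu : bform 2 (1 + 2) (embVec (1 - c 0 ^ 2 / 2) c (c 0 ^ 2 / 2))
      (embVec (1 - c 0 ^ 2 / 2) c (c 0 ^ 2 / 2)) = 1 := by rw [hq]; ring
  have hvv : bform 2 (1 + 2) (embVec (-(c 0 ^ 2 / 2)) c (1 + c 0 ^ 2 / 2))
      (embVec (-(c 0 ^ 2 / 2)) c (1 + c 0 ^ 2 / 2)) = -1 := by rw [hq]; ring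
  refine closure_conjugatesOf_of_actsAs le_rfl
    (u := embVec (1 - c 0 ^ 2 / 2) c (c 0 ^ 2 / 2))
    (v := embVec (-(c 0 ^ 2 / 2)) c (1 + c 0 ^ 2 / 2)) (by rw [huu]; norm_num)
    (by rw [hvv]; norm_num) (by rw [hq]; ring) fun x => ⟨-1, by norm_num, ?_⟩
  rw [LinearEquiv.mul_apply, refl_apply, refl_apply, huu, hvv, nullLift_eq, nullLift_eq, hq,
    smul_embVec, embVec_sub, hq, smul_embVec, embVec_sub, smul_embVec, hf, hf]
  have hpr : (AffineEquiv.pointReflection ℝ c) x 0 = 2 * c 0 - x 0 := by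
    rw [AffineEquiv.pointReflection_apply]
    simp
    ring
  rw [hpr]
  congr 1
  · simp; ring
  · ext i
    obtain rfl := Subsingleton.elim 0 i
    simp only [Pi.sub_apply, Pi.smul_apply, smul_eq_mul, hpr]
    ring
  · simp; ring

end Wedges

end ConjInv

end

theorem lemma5p11 :
    -- involutive automorphisms of connected Lie groups
    (∀ (E : Type*) [NormedAddCommGroup E] [NormedSpace ℝ E] [FiniteDimensional ℝ E]
      (G₁ : Type*) [TopologicalSpace G₁] [ChartedSpace E G₁] [Group G₁]
      [LieGroup 𝓘(ℝ, E) ∞ G₁] [ConnectedSpace G₁]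
      (τ : MulAut G₁), ContMDiff 𝓘(ℝ, E) 𝓘(ℝ, E) ∞ (fun g : G₁ => τ g) → τ * τ = 1 →
      (∀ x : GroupLieAlgebra 𝓘(ℝ, E) G₁, ∀ y ∈ ConjInv.bPart E τ, ⁅x, y⁆ ∈ ConjInv.bPart E τ) ∧
      ConjInv.subgroupLieAlgebra E (ConjInv.integralSubgroup (ConjInv.bPart E τ)) =
        (ConjInv.bPart E τ : Set (GroupLieAlgebra 𝓘(ℝ, E) G₁)) ∧
      (Subgroup.closure (conjugatesOf (ConjInv.invElt τ)) : Set (ConjInv.InvSemidirect τ)) =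
        ((SemidirectProduct.inl : G₁ →* ConjInv.InvSemidirect τ) ''
          (ConjInv.integralSubgroup (ConjInv.bPart E τ) : Set G₁)) *
          ({1, ConjInv.invElt τ} : Set (ConjInv.InvSemidirect τ)) ∧
      (Subgroup.closure (conjugatesOf (ConjInv.invElt τ)) = ⊤ ↔
        ConjInv.fixedPart E τ = ConjInv.antiBracket E τ)) ∧
    -- wedge reflections in the Poincaré group and in the conformal group
    (∀ (d : ℕ) (hd : 2 ≤ d) (W : Set (Fin d → ℝ)), ConjInv.IsWedge d hd W →
      ∀ r : (Fin d → ℝ) ≃ᵃ[ℝ] (Fin d → ℝ), ConjInv.IsWedgeReflection d hd W r →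
      (∃ hr : r ∈ ConjInv.Pplus d,
        Subgroup.closure (conjugatesOf (⟨r, hr⟩ : ConjInv.Pplus d)) = ⊤ ↔ 2 < d) ∧
      (∃ ρ : ConjInv.SO 2 (d + 2), ConjInv.ActsAs ρ r) ∧
      (∀ ρ : ConjInv.SO 2 (d + 2), ConjInv.ActsAs ρ r →
        Subgroup.closure (conjugatesOf ρ) = ⊤)) ∧
    -- the conformal group of the one-dimensional Minkowski space, with the point reflections
    (∀ r : (Fin 1 → ℝ) ≃ᵃ[ℝ] (Fin 1 → ℝ),
      (∃ c : Fin 1 → ℝ, r = AffineEquiv.pointReflection ℝ c) →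
      (∃ ρ : ConjInv.SO 2 (1 + 2), ConjInv.ActsAs ρ r) ∧
      (∀ ρ : ConjInv.SO 2 (1 + 2), ConjInv.ActsAs ρ r →
        Subgroup.closure (conjugatesOf ρ) = ⊤)) := by
  refine ⟨?_, ?_, ?_⟩
  · intro E _ _ _ G₁ _ _ _ _ _ τ hsm hτ
    exact ConjInv.involutive_automorphism_subgroup hsm hτ
  · intro d hd W _ r hr
    exact ConjInv.wedge_reflection_generates hd hr
  · intro r hr
    exact ConjInv.point_reflection_generates hr
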